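/- For a finite set $I$ let $\mathrm{Ex}(I)$ be the exterior algebra over $\mathbb{Z}$ on the free module with basis $(e^I_i)_{i\in I}$, with the differential $d=\sum_{i\in I}\theta_i$ of degree $-1$, where $\theta_i$ is the left antiderivation with $\theta_i(e_j)=\delta_{ij}$. Let $\mathrm{Pasc}(I)$ be the quotient complex $\mathrm{Ex}(I)/\mathbb{Z}\cdot 1$, graded by the dimension, $\dim(e_{i_1}\wedge\dots\wedge e_{i_p})=p-1$. (So $\mathrm{Pasc}(\emptyset)=0$.) For $i\in I$ and exterior products of basis vectors $x=e_{i_1}\wedge\dots\wedge e_{i_p}$, $P=\{i_1,\dots,i_p\}\subset I$, and $y=e_{j_1}\wedge\dots\wedge e_{j_q}$ with $\{j_1,\dots,j_q\}\subset J$ (both nonempty), put in $\mathrm{Pasc}((I\setminus\{i\})\sqcup J)$ $$x\circ_i y=\begin{cases}(-1)^{\dim x}\,\theta_i(x\wedge y)&\text{if } i\in P,\\ x&\text{if } i\notin P,\ \dim y=0,\\ 0&\text{if } i\notin P,\ \dim y>0.\end{cases}$$ With relabelling of basis vectors along bijections and the unit $e_1\in\mathrm{Pasc}(\{1\})$ this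 makes $\mathrm{Pasc}$ a symmetric operad in chain complexes of $\mathbb{Z}$-modules. Let $\mathcal{F}$ be the free differential graded symmetric operad on the complex with $\mathfrak{S}_2$-action $\mathrm{Pasc}(\{1,2\})$, with generators $e_1,e_2$ (dimension $0$) and $e_1\wedge e_2$ (dimension $1$). For $x,y\in\mathcal F(\{1,2\})$ view $x\circ_1y$ in $\mathcal F(\{1,2,3\})$ by keeping the labels $1,2$ of $y$ and giving the label $3$ to the input $2$ of $x$; let the cycle $\tau:3\to2\to1\to3$ act on $\mathcal F(\{1,2,3\})$ by relabelling. Let $\mathcal{I}\subset\mathcal{F}$ be the ideal (of the underlying graded symmetric operad) generated by the relations \begin{align*} e_1\circ_1e_1&=\tau^2(e_2\circ_1e_1), & e_2\circ_1e_1&=e_2\circ_1e_2, & e_1\circ_1e_2&=\tau(e_2\circ_1e_2),\\ e_2\circ_1(e_1\wedge e_2)&=0, & \tau((e_1\wedge e_2)\circ_1e_2)&=e_1\circ_1(e_1\wedge e_2), & -\tau^2((e_1\wedge e_2)\circ_1e_1)&=e_1\circ_1(e_1\wedge e_2),\\ &&(e_1\wedge e_2)\circ_1(e_1\wedge e_2)&=\tau((e_1\wedge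 e_2)\circ_1(e_1\wedge e_2)). \end{align*} Then $\mathcal{I}$ is stable under the differential, and there is an isomorphism of differential graded symmetric operads $\mathcal{F}/\mathcal{I}\cong\mathrm{Pasc}$ which is the identity on the generators $\mathrm{Pasc}(\{1,2\})$. In particular $\mathrm{Pasc}$ is a binary quadratic operad, i.e. it has a presentation by binary generators and relations of arity three. -/

import Mathlib

universe u v w

/-! ### Canonical bijections between label sets -/

namespace OperadLabels

/-- The bijection `(I ∖ {i}) ⊔ J ≃ (I' ∖ {e i}) ⊔ J'` induced by `e : I ≃ I'`, `f : J ≃ J'`. -/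
def congr {I I' J J' : Type} (e : I ≃ I') (f : J ≃ J') (i : I) :
    {k : I // k ≠ i} ⊕ J ≃ {k : I' // k ≠ e i} ⊕ J' :=
  Equiv.sumCongr (e.subtypeEquiv fun _ => e.injective.ne_iff.symm) f

/-- `({∗} ∖ {∗}) ⊔ J ≃ J`. -/
def unitLeft (J : Type) : {k : Unit // k ≠ ()} ⊕ J ≃ J where
  toFun
    | .inl k => (k.2 rfl).elim
    | .inr j => j
  invFun := .inr
  left_inv
    | .inl k => (k.2 rfl).elim
    | .inr _ => rfl
  right_inv _ := rfl

/-- `(I ∖ {i}) ⊔ {∗} ≃ I`, sending `∗` to `i`. -/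
noncomputable def unitRight {I : Type} (i : I) : {k : I // k ≠ i} ⊕ Unit ≃ I :=
  Equiv.ofBijective (Sum.elim Subtype.val fun _ => i) (by
    constructor
    · rintro (⟨a, ha⟩ | a) (⟨b, hb⟩ | b) h
      · simpa using h
      · exact (ha h).elim
      · exact (hb h.symm).elim
      · rfl
    · intro k
      by_cases h : k = i
      · exact ⟨.inr (), h.symm⟩
      · exact ⟨.inl ⟨k, h⟩, rfl⟩)

/-- Labels for `(x ∘_i y) ∘_j z` and `x ∘_i (y ∘_j z)`, with `i ∈ I`, `j ∈ J`:
`((I ∖ {i}) ⊔ J) ∖ {j} ⊔ K ≃ (I ∖ {i}) ⊔ ((J ∖ {j}) ⊔ K)`. -/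
def seq {I J : Type} (K : Type) (i : I) (j : J) :
    {a : {k : I // k ≠ i} ⊕ J // a ≠ .inr j} ⊕ K ≃ {k : I // k ≠ i} ⊕ ({l : J // l ≠ j} ⊕ K) where
  toFun
    | .inl ⟨.inl k, _⟩ => .inl k
    | .inl ⟨.inr l, h⟩ => .inr (.inl ⟨l, fun e => h (congrArg Sum.inr e)⟩)
    | .inr c => .inr (.inr c)
  invFun
    | .inl k => .inl ⟨.inl k, Sum.inl_ne_inr⟩
    | .inr (.inl l) => .inl ⟨.inr l.1, fun e => l.2 (Sum.inr_injective e)⟩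
    | .inr (.inr c) => .inr c
  left_inv := by rintro (⟨k | l, h⟩ | c) <;> rfl
  right_inv := by rintro (k | l | c) <;> rfl

/-- Labels for `(x ∘_i y) ∘_k z` and `(x ∘_k z) ∘_i y`, with `i ≠ k` in `I`:
`((I ∖ {i}) ⊔ J) ∖ {k} ⊔ K ≃ ((I ∖ {k}) ⊔ K) ∖ {i} ⊔ J`. -/
def par {I : Type} (J K : Type) {i k : I} (h : k ≠ i) :
    {a : {l : I // l ≠ i} ⊕ J // a ≠ .inl ⟨k, h⟩} ⊕ K ≃
      {a : {l : I // l ≠ k} ⊕ K // a ≠ .inl ⟨i, h.symm⟩} ⊕ J where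
  toFun
    | .inl ⟨.inl l, hl⟩ => .inl ⟨.inl ⟨l.1, fun e => hl (congrArg Sum.inl (Subtype.ext e))⟩,
        fun e => l.2 (congrArg Subtype.val (Sum.inl_injective e))⟩
    | .inl ⟨.inr j, _⟩ => .inr j
    | .inr c => .inl ⟨.inr c, Sum.inr_ne_inl⟩
  invFun
    | .inl ⟨.inl l, hl⟩ => .inl ⟨.inl ⟨l.1, fun e => hl (congrArg Sum.inl (Subtype.ext e))⟩,
        fun e => l.2 (congrArg Subtype.val (Sum.inl_injective e))⟩
    | .inl ⟨.inr c, _⟩ => .inr c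
    | .inr j => .inl ⟨.inr j, Sum.inr_ne_inl⟩
  left_inv := by rintro (⟨l | j, hl⟩ | c) <;> rfl
  right_inv := by rintro (⟨l | c, hl⟩ | j) <;> rfl

end OperadLabels

/-! ### Differential graded symmetric operads -/

/-- A symmetric operad in chain complexes of `ℤ`-modules (homological grading by `ℤ`), as a functor
on the groupoid of finite sets with partial compositions
`∘_i : P(I) ⊗ P(J) → P((I ∖ {i}) ⊔ J)`. Degrees of differentials and compositions are given up to
a proof of equality, so that no transport along equalities of degrees is needed. -/
structure DGOperad where
  /-- the component of degree `n` of `P(I)` -/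
  obj (I : Type) [Finite I] (n : ℤ) : Type v
  [addCommGroup (I : Type) [Finite I] (n : ℤ) : AddCommGroup (obj I n)]
  /-- the differential, of degree `-1` -/
  d {I : Type} [Finite I] {m n : ℤ} (h : n + 1 = m) : obj I m →+ obj I n
  /-- relabelling along a bijection -/
  map {I J : Type} [Finite I] [Finite J] (e : I ≃ J) {n : ℤ} : obj I n →+ obj J n
  /-- the unit -/
  one : obj Unit 0
  /-- the partial composition `x ∘_i y` -/
  comp {I J : Type} [Finite I] [Finite J] (i : I) {m n p : ℤ} (h : m + n = p) :
    obj I m →+ obj J n →+ obj ({k : I // k ≠ i} ⊕ J) p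
  d_d {I : Type} [Finite I] {m n p : ℤ} (h : n + 1 = m) (h' : p + 1 = n) (x : obj I m) :
    d h' (d h x) = 0
  map_refl {I : Type} [Finite I] {n : ℤ} (x : obj I n) : map (Equiv.refl I) x = x
  map_trans {I J K : Type} [Finite I] [Finite J] [Finite K] (e : I ≃ J) (f : J ≃ K) {n : ℤ}
    (x : obj I n) : map (e.trans f) x = map f (map e x)
  map_d {I J : Type} [Finite I] [Finite J] (e : I ≃ J) {m n : ℤ} (h : n + 1 = m) (x : obj I m) :
    map e (d h x) = d h (map e x)
  comp_map {I J I' J' : Type} [Finite I] [Finite J] [Finite I'] [Finite J']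
    (e : I ≃ I') (f : J ≃ J') (i : I) {m n p : ℤ} (h : m + n = p) (x : obj I m) (y : obj J n) :
    comp (e i) h (map e x) (map f y) = map (OperadLabels.congr e f i) (comp i h x y)
  one_comp {J : Type} [Finite J] {n : ℤ} (h : 0 + n = n) (y : obj J n) :
    map (OperadLabels.unitLeft J) (comp () h one y) = y
  comp_one {I : Type} [Finite I] (i : I) {n : ℤ} (h : n + 0 = n) (x : obj I n) :
    map (OperadLabels.unitRight i) (comp i h x one) = x
  comp_seq {I J K : Type} [Finite I] [Finite J] [Finite K] (i : I) (j : J) {a b c ab bc abc : ℤ}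
    (hab : a + b = ab) (hbc : b + c = bc) (h₁ : ab + c = abc) (h₂ : a + bc = abc)
    (x : obj I a) (y : obj J b) (z : obj K c) :
    map (OperadLabels.seq K i j) (comp (.inr j) h₁ (comp i hab x y) z) =
      comp i h₂ x (comp j hbc y z)
  comp_par {I J K : Type} [Finite I] [Finite J] [Finite K] {i k : I} (hk : k ≠ i)
    {a b c ab ac abc : ℤ} (hab : a + b = ab) (hac : a + c = ac) (h₁ : ab + c = abc)
    (h₂ : ac + b = abc) (x : obj I a) (y : obj J b) (z : obj K c) :
    map (OperadLabels.par J K hk) (comp (.inl ⟨k, hk⟩) h₁ (comp i hab x y) z) =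
      (b * c).negOnePow • comp (.inl ⟨i, hk.symm⟩) h₂ (comp k hac x z) y
  d_comp {I J : Type} [Finite I] [Finite J] (i : I) {m n p m' n' p' : ℤ} (h : m + n = p)
    (hm : m' + 1 = m) (hn : n' + 1 = n) (hp : p' + 1 = p) (h₁ : m' + n = p') (h₂ : m + n' = p')
    (x : obj I m) (y : obj J n) :
    d hp (comp i h x y) = comp i h₁ (d hm x) y + m.negOnePow • comp i h₂ x (d hn y)

attribute [instance] DGOperad.addCommGroup

namespace DGOperad

/-- Isomorphisms of differential graded operads. -/
structure Iso (P : DGOperad.{v}) (Q : DGOperad.{w}) where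
  equiv (I : Type) [Finite I] (n : ℤ) : P.obj I n ≃+ Q.obj I n
  equiv_d {I : Type} [Finite I] {m n : ℤ} (h : n + 1 = m) (x : P.obj I m) :
    equiv I n (P.d h x) = Q.d h (equiv I m x)
  equiv_map {I J : Type} [Finite I] [Finite J] (e : I ≃ J) {n : ℤ} (x : P.obj I n) :
    equiv J n (P.map e x) = Q.map e (equiv I n x)
  equiv_one : equiv Unit 0 P.one = Q.one
  equiv_comp {I J : Type} [Finite I] [Finite J] (i : I) {m n p : ℤ} (h : m + n = p)
    (x : P.obj I m) (y : P.obj J n) :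
    equiv _ p (P.comp i h x y) = Q.comp i h (equiv I m x) (equiv J n y)

/-- A (two-sided, symmetric) operadic ideal of the underlying graded operad. -/
structure Ideal (P : DGOperad.{v}) where
  carrier (I : Type) [Finite I] (n : ℤ) : AddSubgroup (P.obj I n)
  map_mem {I J : Type} [Finite I] [Finite J] (e : I ≃ J) {n : ℤ} {x : P.obj I n} :
    x ∈ carrier I n → P.map e x ∈ carrier J n
  comp_mem_left {I J : Type} [Finite I] [Finite J] (i : I) {m n p : ℤ} (h : m + n = p)
    {x : P.obj I m} (y : P.obj J n) : x ∈ carrier I m → P.comp i h x y ∈ carrier _ p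
  comp_mem_right {I J : Type} [Finite I] [Finite J] (i : I) {m n p : ℤ} (h : m + n = p)
    (x : P.obj I m) {y : P.obj J n} : y ∈ carrier J n → P.comp i h x y ∈ carrier _ p

/-- The ideal is stable under the differential. -/
def Ideal.IsDifferential {P : DGOperad.{v}} (A : P.Ideal) : Prop :=
  ∀ ⦃I : Type⦄ [Finite I] ⦃m n : ℤ⦄ (h : n + 1 = m) (x : P.obj I m),
    x ∈ A.carrier I m → P.d h x ∈ A.carrier I n

/-- The smallest operadic ideal containing a set `R` of homogeneous elements of `P(K)`. -/
def idealSpan (P : DGOperad.{v}) (K : Type) [Finite K] (R : ∀ n : ℤ, Set (P.obj K n)) :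
    P.Ideal where
  carrier I _ n :=
    { carrier := {x | ∀ A : P.Ideal, (∀ k, R k ⊆ A.carrier K k) → x ∈ A.carrier I n}
      zero_mem' := fun _ _ => zero_mem _
      add_mem' := fun hx hy A hA => add_mem (hx A hA) (hy A hA)
      neg_mem' := fun hx A hA => neg_mem (hx A hA) }
  map_mem e _ _ hx A hA := A.map_mem e (hx A hA)
  comp_mem_left i _ _ _ h _ y hx A hA := A.comp_mem_left i h y (hx A hA)
  comp_mem_right i _ _ _ h x _ hy A hA := A.comp_mem_right i h x (hy A hA)

/-- The quotient of a differential graded operad by a differential operadic ideal. -/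
def quotient (P : DGOperad.{v}) (A : P.Ideal) (hA : A.IsDifferential) : DGOperad.{v} where
  obj I _ n := P.obj I n ⧸ A.carrier I n
  d h := QuotientAddGroup.map _ _ (P.d h) fun x hx => hA h x hx
  map e _ := QuotientAddGroup.map _ _ (P.map e) fun _ hx => A.map_mem e hx
  one := QuotientAddGroup.mk P.one
  comp {I J} _ _ i m n p h := QuotientAddGroup.lift _
    (AddMonoidHom.mk' (fun x => QuotientAddGroup.map (A.carrier J n) (A.carrier _ p)
        (P.comp i h x) fun _ hy => A.comp_mem_right i h x hy) (by
      intro x x'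
      ext y
      exact congrArg QuotientAddGroup.mk (by simp)))
    (by
      intro x hx
      ext y
      exact (QuotientAddGroup.eq_zero_iff _).2 (A.comp_mem_left i h y hx))
  d_d h h' x := by
    induction x using QuotientAddGroup.induction_on with | H x => ?_
    exact congrArg QuotientAddGroup.mk (P.d_d h h' x)
  map_refl x := by
    induction x using QuotientAddGroup.induction_on with | H x => ?_
    exact congrArg QuotientAddGroup.mk (P.map_refl x)
  map_trans e f _ x := by
    induction x using QuotientAddGroup.induction_on with | H x => ?_
    exact congrArg QuotientAddGroup.mk (P.map_trans e f x)
  map_d e _ _ h x := by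
    induction x using QuotientAddGroup.induction_on with | H x => ?_
    exact congrArg QuotientAddGroup.mk (P.map_d e h x)
  comp_map e f i _ _ _ h x y := by
    induction x using QuotientAddGroup.induction_on with | H x => ?_
    induction y using QuotientAddGroup.induction_on with | H y => ?_
    exact congrArg QuotientAddGroup.mk (P.comp_map e f i h x y)
  one_comp h y := by
    induction y using QuotientAddGroup.induction_on with | H y => ?_
    exact congrArg QuotientAddGroup.mk (P.one_comp h y)
  comp_one i _ h x := by
    induction x using QuotientAddGroup.induction_on with | H x => ?_
    exact congrArg QuotientAddGroup.mk (P.comp_one i h x)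
  comp_seq i j _ _ _ _ _ _ hab hbc h₁ h₂ x y z := by
    induction x using QuotientAddGroup.induction_on with | H x => ?_
    induction y using QuotientAddGroup.induction_on with | H y => ?_
    induction z using QuotientAddGroup.induction_on with | H z => ?_
    exact congrArg QuotientAddGroup.mk (P.comp_seq i j hab hbc h₁ h₂ x y z)
  comp_par hk _ _ _ _ _ _ hab hac h₁ h₂ x y z := by
    induction x using QuotientAddGroup.induction_on with | H x => ?_
    induction y using QuotientAddGroup.induction_on with | H y => ?_
    induction z using QuotientAddGroup.induction_on with | H z => ?_
    exact congrArg QuotientAddGroup.mk (P.comp_par hk hab hac h₁ h₂ x y z)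
  d_comp i _ _ _ _ _ _ h hm hn hp h₁ h₂ x y := by
    induction x using QuotientAddGroup.induction_on with | H x => ?_
    induction y using QuotientAddGroup.induction_on with | H y => ?_
    exact congrArg QuotientAddGroup.mk (P.d_comp i h hm hn hp h₁ h₂ x y)

/-- The projection onto the quotient. -/
def toQuotient (P : DGOperad.{v}) (A : P.Ideal) (hA : A.IsDifferential) (I : Type) [Finite I]
    (n : ℤ) : P.obj I n →+ (P.quotient A hA).obj I n :=
  QuotientAddGroup.mk' (A.carrier I n)

end DGOperad

/-! ### The free differential graded operad on binary operations -/

/-- A chain complex of `ℤ`-modules with an action of the symmetric group of `{1, 2}`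
(labels `1, 2` are `0, 1 : Fin 2`). -/
structure DGBinaryModule where
  obj (n : ℤ) : Type u
  [addCommGroup (n : ℤ) : AddCommGroup (obj n)]
  d {m n : ℤ} (h : n + 1 = m) : obj m →+ obj n
  act (σ : Equiv.Perm (Fin 2)) {n : ℤ} : obj n →+ obj n
  d_d {m n p : ℤ} (h : n + 1 = m) (h' : p + 1 = n) (x : obj m) : d h' (d h x) = 0
  act_one {n : ℤ} (x : obj n) : act 1 x = x
  act_mul (σ τ : Equiv.Perm (Fin 2)) {n : ℤ} (x : obj n) : act (σ * τ) x = act σ (act τ x)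
  act_d (σ : Equiv.Perm (Fin 2)) {m n : ℤ} (h : n + 1 = m) (x : obj m) :
    act σ (d h x) = d h (act σ x)

attribute [instance] DGBinaryModule.addCommGroup

/-- The component `P({1, 2})` of an operad. -/
def DGOperad.binary (P : DGOperad.{v}) : DGBinaryModule.{v} where
  obj n := P.obj (Fin 2) n
  d h := P.d h
  act σ _ := P.map σ
  d_d := P.d_d
  act_one := P.map_refl
  act_mul σ τ _ x := P.map_trans τ σ x
  act_d σ _ _ h x := P.map_d σ h x

namespace FreeDGOperad

/-- Formal expressions in the operations of a differential graded operad, with elements of `E`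
as binary generators. -/
inductive Term (E : DGBinaryModule.{u}) : Type → ℤ → Type (max u 1)
  | gen {n : ℤ} (x : E.obj n) : Term E (Fin 2) n
  | zero {I : Type} {n : ℤ} : Term E I n
  | add {I : Type} {n : ℤ} (x y : Term E I n) : Term E I n
  | neg {I : Type} {n : ℤ} (x : Term E I n) : Term E I n
  | d {I : Type} {m n : ℤ} (h : n + 1 = m) (x : Term E I m) : Term E I n
  | map {I J : Type} [Finite I] [Finite J] (e : I ≃ J) {n : ℤ} (x : Term E I n) : Term E J n
  | one : Term E Unit 0
  | comp {I J : Type} [Finite I] [Finite J] (i : I) {m n p : ℤ} (h : m + n = p)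
      (x : Term E I m) (y : Term E J n) : Term E ({k : I // k ≠ i} ⊕ J) p

/-- The expression `x` or `-x`, according to the sign `s`. -/
def Term.sign {E : DGBinaryModule.{u}} {I : Type} {n : ℤ} (s : ℤˣ) (x : Term E I n) : Term E I n :=
  if s = 1 then x else x.neg

/-- The congruence on formal expressions generated by the axioms of a differential graded operad
and by the requirement that `E` maps to the operad by a morphism of complexes with an action of the
symmetric group of `{1, 2}`. -/
inductive Rel (E : DGBinaryModule.{u}) : ∀ {I : Type} {n : ℤ}, Term E I n → Term E I n → Prop
  | refl {I : Type} {n : ℤ} (x : Term E I n) : Rel E x x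
  | symm {I : Type} {n : ℤ} {x y : Term E I n} : Rel E x y → Rel E y x
  | trans {I : Type} {n : ℤ} {x y z : Term E I n} : Rel E x y → Rel E y z → Rel E x z
  -- compatibility with the operations
  | add_congr {I : Type} {n : ℤ} {x x' y y' : Term E I n} :
      Rel E x x' → Rel E y y' → Rel E (x.add y) (x'.add y')
  | neg_congr {I : Type} {n : ℤ} {x x' : Term E I n} : Rel E x x' → Rel E x.neg x'.neg
  | d_congr {I : Type} {m n : ℤ} (h : n + 1 = m) {x x' : Term E I m} :
      Rel E x x' → Rel E (x.d h) (x'.d h)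
  | map_congr {I J : Type} [Finite I] [Finite J] (e : I ≃ J) {n : ℤ} {x x' : Term E I n} :
      Rel E x x' → Rel E (x.map e) (x'.map e)
  | comp_congr {I J : Type} [Finite I] [Finite J] (i : I) {m n p : ℤ} (h : m + n = p)
      {x x' : Term E I m} {y y' : Term E J n} :
      Rel E x x' → Rel E y y' → Rel E (x.comp i h y) (x'.comp i h y')
  -- abelian groups
  | add_assoc {I : Type} {n : ℤ} (x y z : Term E I n) : Rel E ((x.add y).add z) (x.add (y.add z))
  | add_comm {I : Type} {n : ℤ} (x y : Term E I n) : Rel E (x.add y) (y.add x)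
  | zero_add {I : Type} {n : ℤ} (x : Term E I n) : Rel E (Term.zero.add x) x
  | neg_add {I : Type} {n : ℤ} (x : Term E I n) : Rel E (x.neg.add x) Term.zero
  -- additivity of the operations
  | d_add {I : Type} {m n : ℤ} (h : n + 1 = m) (x y : Term E I m) :
      Rel E ((x.add y).d h) ((x.d h).add (y.d h))
  | map_add {I J : Type} [Finite I] [Finite J] (e : I ≃ J) {n : ℤ} (x y : Term E I n) :
      Rel E ((x.add y).map e) ((x.map e).add (y.map e))
  | add_comp {I J : Type} [Finite I] [Finite J] (i : I) {m n p : ℤ} (h : m + n = p)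
      (x x' : Term E I m) (y : Term E J n) :
      Rel E ((x.add x').comp i h y) ((x.comp i h y).add (x'.comp i h y))
  | comp_add {I J : Type} [Finite I] [Finite J] (i : I) {m n p : ℤ} (h : m + n = p)
      (x : Term E I m) (y y' : Term E J n) :
      Rel E (x.comp i h (y.add y')) ((x.comp i h y).add (x.comp i h y'))
  -- axioms of a differential graded operad
  | d_d {I : Type} {m n p : ℤ} (h : n + 1 = m) (h' : p + 1 = n) (x : Term E I m) :
      Rel E ((x.d h).d h') Term.zero
  | map_refl {I : Type} [Finite I] {n : ℤ} (x : Term E I n) : Rel E (x.map (Equiv.refl I)) x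
  | map_trans {I J K : Type} [Finite I] [Finite J] [Finite K] (e : I ≃ J) (f : J ≃ K) {n : ℤ}
      (x : Term E I n) : Rel E (x.map (e.trans f)) ((x.map e).map f)
  | map_d {I J : Type} [Finite I] [Finite J] (e : I ≃ J) {m n : ℤ} (h : n + 1 = m)
      (x : Term E I m) : Rel E ((x.d h).map e) ((x.map e).d h)
  | comp_map {I J I' J' : Type} [Finite I] [Finite J] [Finite I'] [Finite J']
      (e : I ≃ I') (f : J ≃ J') (i : I) {m n p : ℤ} (h : m + n = p)
      (x : Term E I m) (y : Term E J n) :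
      Rel E ((x.map e).comp (e i) h (y.map f)) ((x.comp i h y).map (OperadLabels.congr e f i))
  | one_comp {J : Type} [Finite J] {n : ℤ} (h : 0 + n = n) (y : Term E J n) :
      Rel E ((Term.one.comp () h y).map (OperadLabels.unitLeft J)) y
  | comp_one {I : Type} [Finite I] (i : I) {n : ℤ} (h : n + 0 = n) (x : Term E I n) :
      Rel E ((x.comp i h Term.one).map (OperadLabels.unitRight i)) x
  | comp_seq {I J K : Type} [Finite I] [Finite J] [Finite K] (i : I) (j : J)
      {a b c ab bc abc : ℤ} (hab : a + b = ab) (hbc : b + c = bc) (h₁ : ab + c = abc)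
      (h₂ : a + bc = abc) (x : Term E I a) (y : Term E J b) (z : Term E K c) :
      Rel E (((x.comp i hab y).comp (.inr j) h₁ z).map (OperadLabels.seq K i j))
        (x.comp i h₂ (y.comp j hbc z))
  | comp_par {I J K : Type} [Finite I] [Finite J] [Finite K] {i k : I} (hk : k ≠ i)
      {a b c ab ac abc : ℤ} (hab : a + b = ab) (hac : a + c = ac) (h₁ : ab + c = abc)
      (h₂ : ac + b = abc) (x : Term E I a) (y : Term E J b) (z : Term E K c) :
      Rel E (((x.comp i hab y).comp (.inl ⟨k, hk⟩) h₁ z).map (OperadLabels.par J K hk))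
        (((x.comp k hac z).comp (.inl ⟨i, hk.symm⟩) h₂ y).sign (b * c).negOnePow)
  | d_comp {I J : Type} [Finite I] [Finite J] (i : I) {m n p m' n' p' : ℤ} (h : m + n = p)
      (hm : m' + 1 = m) (hn : n' + 1 = n) (hp : p' + 1 = p) (h₁ : m' + n = p') (h₂ : m + n' = p')
      (x : Term E I m) (y : Term E J n) :
      Rel E ((x.comp i h y).d hp)
        (((x.d hm).comp i h₁ y).add ((x.comp i h₂ (y.d hn)).sign m.negOnePow))
  -- the map from `E`
  | gen_add {n : ℤ} (x y : E.obj n) : Rel E (Term.gen (x + y)) ((Term.gen x).add (Term.gen y))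
  | gen_d {m n : ℤ} (h : n + 1 = m) (x : E.obj m) : Rel E (Term.gen (E.d h x)) ((Term.gen x).d h)
  | gen_act (σ : Equiv.Perm (Fin 2)) {n : ℤ} (x : E.obj n) :
      Rel E (Term.gen (E.act σ x)) ((Term.gen x).map σ)

/-- Formal expressions up to the congruence. -/
def Obj (E : DGBinaryModule.{u}) (I : Type) (n : ℤ) : Type (max u 1) :=
  Quot (fun x y : Term E I n => Rel E x y)

variable {E : DGBinaryModule.{u}}

instance (I : Type) (n : ℤ) : AddCommGroup (Obj E I n) :=
  let A : Add (Obj E I n) := ⟨Quot.map₂ Term.add (fun _ _ _ h => .add_congr (.refl _) h)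
    fun _ _ _ h => .add_congr h (.refl _)⟩
  let Z : Zero (Obj E I n) := ⟨Quot.mk _ Term.zero⟩
  let N : Neg (Obj E I n) := ⟨Quot.map Term.neg fun _ _ h => .neg_congr h⟩
  let G : AddGroup (Obj E I n) := AddGroup.ofLeftAxioms
    (by rintro ⟨x⟩ ⟨y⟩ ⟨z⟩; exact Quot.sound (.add_assoc x y z))
    (by rintro ⟨x⟩; exact Quot.sound (.zero_add x))
    (by rintro ⟨x⟩; exact Quot.sound (.neg_add x))
  { G with add_comm := by rintro ⟨x⟩ ⟨y⟩; exact Quot.sound (.add_comm x y) }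

/-- The class of a formal expression. -/
def mk {I : Type} {n : ℤ} (x : Term E I n) : Obj E I n := Quot.mk _ x

theorem mk_sign {I : Type} {n : ℤ} (s : ℤˣ) (x : Term E I n) : mk (x.sign s) = s • mk x := by
  rcases Int.units_eq_one_or s with rfl | rfl
  · rw [one_smul]; rfl
  · rw [Units.neg_smul, one_smul]; rfl

end FreeDGOperad

/-- The free differential graded operad on a complex `E` of binary operations with an action of
the symmetric group of `{1, 2}`. -/
def freeDGOperad (E : DGBinaryModule.{u}) : DGOperad.{max u 1} where
  obj I _ n := FreeDGOperad.Obj E I n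
  d h := AddMonoidHom.mk' (Quot.map (FreeDGOperad.Term.d h) fun _ _ r => .d_congr h r)
    (by rintro ⟨x⟩ ⟨y⟩; exact Quot.sound (.d_add h x y))
  map e _ := AddMonoidHom.mk' (Quot.map (FreeDGOperad.Term.map e) fun _ _ r => .map_congr e r)
    (by rintro ⟨x⟩ ⟨y⟩; exact Quot.sound (.map_add e x y))
  one := FreeDGOperad.mk .one
  comp i _ _ _ h := AddMonoidHom.mk' (fun x => AddMonoidHom.mk'
      (Quot.map₂ (FreeDGOperad.Term.comp i h) (fun _ _ _ r => .comp_congr i h (.refl _) r)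
        (fun _ _ _ r => .comp_congr i h r (.refl _)) x)
      (by rintro ⟨y⟩ ⟨y'⟩; induction x using Quot.ind with | mk x => ?_
          exact Quot.sound (.comp_add i h x y y')))
    (by rintro ⟨x⟩ ⟨x'⟩; ext ⟨y⟩; exact Quot.sound (.add_comp i h x x' y))
  d_d h h' := by rintro ⟨x⟩; exact Quot.sound (.d_d h h' x)
  map_refl := by rintro I _ n ⟨x⟩; exact Quot.sound (.map_refl x)
  map_trans e f _ := by rintro ⟨x⟩; exact Quot.sound (.map_trans e f x)
  map_d e _ _ h := by rintro ⟨x⟩; exact Quot.sound (.map_d e h x)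
  comp_map e f i _ _ _ h := by rintro ⟨x⟩ ⟨y⟩; exact Quot.sound (.comp_map e f i h x y)
  one_comp h := by rintro ⟨y⟩; exact Quot.sound (.one_comp h y)
  comp_one i _ h := by rintro ⟨x⟩; exact Quot.sound (.comp_one i h x)
  comp_seq i j _ _ _ _ _ _ hab hbc h₁ h₂ := by
    rintro ⟨x⟩ ⟨y⟩ ⟨z⟩; exact Quot.sound (.comp_seq i j hab hbc h₁ h₂ x y z)
  comp_par hk _ _ _ _ _ _ hab hac h₁ h₂ := by
    rintro ⟨x⟩ ⟨y⟩ ⟨z⟩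
    exact (Quot.sound (.comp_par hk hab hac h₁ h₂ x y z)).trans (FreeDGOperad.mk_sign _ _)
  d_comp i _ _ _ _ _ _ h hm hn hp h₁ h₂ := by
    rintro ⟨x⟩ ⟨y⟩
    exact (Quot.sound (.d_comp i h hm hn hp h₁ h₂ x y)).trans
      (congrArg (FreeDGOperad.mk ((x.d hm).comp i h₁ y) + ·) (FreeDGOperad.mk_sign _ _))

/-- The inclusion of the generators in the free operad. -/
def freeDGOperad.gen (E : DGBinaryModule.{u}) (n : ℤ) :
    E.obj n →+ (freeDGOperad E).obj (Fin 2) n :=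
  AddMonoidHom.mk' (fun x => FreeDGOperad.mk (.gen x)) fun x y => Quot.sound (.gen_add x y)

namespace DGOperad

/-- Morphisms of differential graded operads. -/
structure Hom (P : DGOperad.{v}) (Q : DGOperad.{w}) where
  app (I : Type) [Finite I] (n : ℤ) : P.obj I n →+ Q.obj I n
  app_d {I : Type} [Finite I] {m n : ℤ} (h : n + 1 = m) (x : P.obj I m) :
    app I n (P.d h x) = Q.d h (app I m x)
  app_map {I J : Type} [Finite I] [Finite J] (e : I ≃ J) {n : ℤ} (x : P.obj I n) :
    app J n (P.map e x) = Q.map e (app I n x)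
  app_one : app Unit 0 P.one = Q.one
  app_comp {I J : Type} [Finite I] [Finite J] (i : I) {m n p : ℤ} (h : m + n = p)
    (x : P.obj I m) (y : P.obj J n) :
    app _ p (P.comp i h x y) = Q.comp i h (app I m x) (app J n y)

end DGOperad

namespace FreeDGOperad

variable {E : DGBinaryModule.{u}}

/-- Evaluation of a formal expression in an operad `Q`, given the values of the generators. -/
noncomputable def Term.eval (Q : DGOperad.{w}) (f : ∀ n, E.obj n →+ Q.binary.obj n) {I : Type}
    {n : ℤ} (x : Term E I n) : ∀ [Finite I], Q.obj I n := by
  induction x with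
  | gen x => exact @fun _ => f _ x
  | zero => exact @fun _ => 0
  | add _ _ x y => exact @fun _ => x + y
  | neg _ x => exact @fun _ => -x
  | d h _ x => exact @fun _ => Q.d h x
  | map e _ x => exact @fun _ => Q.map e x
  | one => exact @fun _ => Q.one
  | comp i h _ _ x y => exact @fun _ => Q.comp i h x y

theorem eval_sign (Q : DGOperad.{w}) (f : ∀ n, E.obj n →+ Q.binary.obj n) {I : Type} [Finite I]
    {n : ℤ} (s : ℤˣ) (x : Term E I n) : (x.sign s).eval Q f = s • x.eval Q f := by
  rcases Int.units_eq_one_or s with rfl | rfl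
  · rw [one_smul]; rfl
  · rw [Units.neg_smul, one_smul]; rfl

theorem eval_rel (Q : DGOperad.{w}) (f : ∀ n, E.obj n →+ Q.binary.obj n)
    (hd : ∀ {m n : ℤ} (h : n + 1 = m) x, f n (E.d h x) = Q.binary.d h (f m x))
    (hs : ∀ σ n x, f n (E.act σ x) = Q.binary.act σ (f n x)) {I : Type} {n : ℤ}
    {x y : Term E I n} (r : Rel E x y) : ∀ [Finite I], x.eval Q f = y.eval Q f := by
  induction r with
  | refl x => intro _; rfl
  | symm _ ih => intro _; exact ih.symm
  | trans _ _ h1 h2 => intro _; exact h1.trans h2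
  | add_congr _ _ h1 h2 => intro _; exact congrArg₂ (· + ·) h1 h2
  | neg_congr _ h1 => intro _; exact congrArg (- ·) h1
  | d_congr h _ h1 => intro _; exact congrArg (Q.d h) h1
  | map_congr e _ h1 => intro _; exact congrArg (Q.map e) h1
  | comp_congr i h _ _ h1 h2 => intro _; exact congrArg₂ (fun x y => Q.comp i h x y) h1 h2
  | add_assoc x y z => intro _; exact _root_.add_assoc _ _ _
  | add_comm x y => intro _; exact _root_.add_comm _ _
  | zero_add x => intro _; exact _root_.zero_add _
  | neg_add x => intro _; exact neg_add_cancel _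
  | d_add h x y => intro _; exact _root_.map_add _ _ _
  | map_add e x y => intro _; exact _root_.map_add _ _ _
  | add_comp i h x x' y =>
    intro _
    exact (DFunLike.congr_fun (_root_.map_add (Q.comp i h) (x.eval Q f) (x'.eval Q f)) _)
  | comp_add i h x y y' => intro _; exact _root_.map_add _ _ _
  | d_d h h' x => intro _; exact Q.d_d h h' _
  | map_refl x => intro _; exact Q.map_refl _
  | map_trans e g x => intro _; exact Q.map_trans e g _
  | map_d e h x => intro _; exact Q.map_d e h _
  | comp_map e g i h x y => intro _; exact Q.comp_map e g i h _ _
  | one_comp h y => intro _; exact Q.one_comp h _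
  | comp_one i h y => intro _; exact Q.comp_one i h _
  | comp_seq i j hab hbc h₁ h₂ x y z => intro _; exact Q.comp_seq i j hab hbc h₁ h₂ _ _ _
  | comp_par hk hab hac h₁ h₂ x y z =>
    intro _
    exact (Q.comp_par hk hab hac h₁ h₂ (x.eval Q f) (y.eval Q f) (z.eval Q f)).trans
      (eval_sign Q f _ ((x.comp _ hac z).comp _ h₂ y)).symm
  | d_comp i h hm hn hp h₁ h₂ x y =>
    intro _
    exact (Q.d_comp i h hm hn hp h₁ h₂ (x.eval Q f) (y.eval Q f)).trans
      (congrArg (Q.comp i h₁ (Q.d hm (x.eval Q f)) (y.eval Q f) + ·)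
        (eval_sign Q f _ (x.comp i h₂ (y.d hn))).symm)
  | gen_add x y => intro _; exact _root_.map_add _ _ _
  | gen_d h x => intro _; exact hd h x
  | gen_act σ x => intro _; exact hs σ _ x

end FreeDGOperad

/-- The universal property of the free operad: a morphism of complexes with symmetric group action
from `E` to `Q({1, 2})` extends uniquely to a morphism of differential graded operads. -/
theorem freeDGOperad.existsUnique_lift (E : DGBinaryModule.{u}) (Q : DGOperad.{w})
    (f : ∀ n, E.obj n →+ Q.binary.obj n)
    (hd : ∀ {m n : ℤ} (h : n + 1 = m) x, f n (E.d h x) = Q.binary.d h (f m x))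
    (hs : ∀ σ n x, f n (E.act σ x) = Q.binary.act σ (f n x)) :
    ∃! φ : DGOperad.Hom (freeDGOperad E) Q,
      ∀ n x, φ.app (Fin 2) n (freeDGOperad.gen E n x) = f n x := by
  let φ : DGOperad.Hom (freeDGOperad E) Q :=
    { app := fun I _ n => AddMonoidHom.mk' (Quot.lift (fun x : FreeDGOperad.Term E I n =>
        x.eval Q f) fun _ _ r => FreeDGOperad.eval_rel Q f hd hs r) (by rintro ⟨x⟩ ⟨y⟩; rfl)
      app_d := by rintro I _ m n h ⟨x⟩; rfl
      app_map := by rintro I J _ _ e n ⟨x⟩; rfl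
      app_one := rfl
      app_comp := by rintro I J _ _ i m n p h ⟨x⟩ ⟨y⟩; rfl }
  refine ⟨φ, fun _ _ => rfl, ?_⟩
  rintro ⟨app, h1, h2, h3, h4⟩ hg
  have key : ∀ {I : Type} {n : ℤ} (x : FreeDGOperad.Term E I n), ∀ [Finite I],
      app I n (FreeDGOperad.mk x) = x.eval Q f := by
    intro I n x
    induction x with
    | gen x => intro _; exact hg _ x
    | zero => intro _; exact map_zero (app _ _)
    | add x y hx hy =>
      intro _
      exact (map_add (app _ _) (FreeDGOperad.mk x) (FreeDGOperad.mk y)).trans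
        (congrArg₂ (· + ·) hx hy)
    | neg x hx =>
      intro _
      exact (map_neg (app _ _) (FreeDGOperad.mk x)).trans (congrArg (- ·) hx)
    | d h x hx => intro _; exact (h1 h (FreeDGOperad.mk x)).trans (congrArg (Q.d h) hx)
    | map e x hx => intro _; exact (h2 e (FreeDGOperad.mk x)).trans (congrArg (Q.map e) hx)
    | one => intro _; exact h3
    | comp i h x y hx hy =>
      intro _
      exact (h4 i h (FreeDGOperad.mk x) (FreeDGOperad.mk y)).trans
        (congrArg₂ (fun x y => Q.comp i h x y) hx hy)
  have : app = φ.app := by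
    funext I _ n
    ext ⟨x⟩
    exact key x
  subst this
  rfl

/-! ### The operad Pasc -/

namespace Pasc

section ExteriorAlgebra

variable {M N : Type} [AddCommGroup M] [AddCommGroup N]

/-- The left contraction by a linear form, i.e. the antiderivation of degree `-1` of the exterior
algebra which extends it. -/
noncomputable def contract (f : Module.Dual ℤ M) :
    ExteriorAlgebra ℤ M →ₗ[ℤ] ExteriorAlgebra ℤ M :=
  CliffordAlgebra.contractLeft (Q := (0 : QuadraticForm ℤ M)) f

theorem contract_ι_mul (f : Module.Dual ℤ M) (v : M) (a : ExteriorAlgebra ℤ M) :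
    contract f (ExteriorAlgebra.ι ℤ v * a) = f v • a - ExteriorAlgebra.ι ℤ v * contract f a :=
  CliffordAlgebra.contractLeft_ι_mul _ _ _

theorem contract_algebraMap (f : Module.Dual ℤ M) (r : ℤ) :
    contract f (algebraMap ℤ _ r) = 0 :=
  CliffordAlgebra.contractLeft_algebraMap _ _ _

theorem contract_contract (f : Module.Dual ℤ M) (a : ExteriorAlgebra ℤ M) :
    contract f (contract f a) = 0 :=
  CliffordAlgebra.contractLeft_contractLeft _ _

theorem contract_comm (f g : Module.Dual ℤ M) (a : ExteriorAlgebra ℤ M) :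
    contract f (contract g a) = -contract g (contract f a) :=
  CliffordAlgebra.contractLeft_comm _ _ _

/-- Induction along multiplication on the left by vectors. -/
theorem induction_left {C : ExteriorAlgebra ℤ M → Prop} (a : ExteriorAlgebra ℤ M)
    (h0 : ∀ r : ℤ, C (algebraMap ℤ _ r)) (hadd : ∀ a b, C a → C b → C (a + b))
    (hmul : ∀ a v, C a → C (ExteriorAlgebra.ι ℤ v * a)) : C a :=
  CliffordAlgebra.left_induction (Q := (0 : QuadraticForm ℤ M)) h0 hadd hmul a

theorem contract_map (f : Module.Dual ℤ N) (α : M →ₗ[ℤ] N) (a : ExteriorAlgebra ℤ M) :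
    contract f (ExteriorAlgebra.map α a) = ExteriorAlgebra.map α (contract (f ∘ₗ α) a) := by
  induction a using induction_left with
  | h0 r => rw [AlgHom.commutes, contract_algebraMap, contract_algebraMap, map_zero]
  | hadd a b ha hb => simp [ha, hb]
  | hmul a v ha => simp [contract_ι_mul, ha]

theorem contract_zero (a : ExteriorAlgebra ℤ M) : contract 0 a = 0 := by
  simp [contract]

theorem contract_sub (f g : Module.Dual ℤ M) (a : ExteriorAlgebra ℤ M) :
    contract (f - g) a = contract f a - contract g a := by
  simp [contract]

/-- The grading automorphism. -/
noncomputable def inv : ExteriorAlgebra ℤ M →ₐ[ℤ] ExteriorAlgebra ℤ M :=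
  CliffordAlgebra.involute (Q := (0 : QuadraticForm ℤ M))

theorem inv_ι (v : M) : inv (ExteriorAlgebra.ι ℤ v) = -ExteriorAlgebra.ι ℤ v :=
  CliffordAlgebra.involute_ι _

theorem contract_mul (f : Module.Dual ℤ M) (a b : ExteriorAlgebra ℤ M) :
    contract f (a * b) = contract f a * b + inv a * contract f b := by
  induction a using induction_left with
  | h0 r =>
    rw [contract_algebraMap, AlgHom.commutes, zero_mul, zero_add, ← Algebra.smul_def,
      ← Algebra.smul_def, map_smul]
  | hadd a c ha hc => simp only [add_mul, map_add, ha, hc]; abel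
  | hmul a v ha =>
    rw [mul_assoc, contract_ι_mul, ha, contract_ι_mul, map_mul, inv_ι]
    simp only [sub_mul, mul_add, neg_mul, mul_assoc, smul_mul_assoc]
    abel

theorem ι_mul_comm (v : M) (b : ExteriorAlgebra ℤ M) :
    ExteriorAlgebra.ι ℤ v * b = inv b * ExteriorAlgebra.ι ℤ v := by
  induction b using induction_left with
  | h0 r => rw [AlgHom.commutes, Algebra.commutes]
  | hadd a c ha hc => simp only [add_mul, mul_add, map_add, ha, hc]
  | hmul a w ha =>
    rw [map_mul, inv_ι, mul_assoc, ← ha, ← mul_assoc, ← mul_assoc,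
      eq_neg_of_add_eq_zero_left (ExteriorAlgebra.ι_add_mul_swap v w), neg_mul, neg_mul,
      neg_mul]

theorem mem_induction {C : ℕ → ExteriorAlgebra ℤ M → Prop} (h0 : ∀ r : ℤ, C 0 (algebraMap ℤ _ r))
    (hadd : ∀ n a b, C n a → C n b → C n (a + b))
    (hmul : ∀ n v a, C n a → C (n + 1) (ExteriorAlgebra.ι ℤ v * a)) {n : ℕ}
    {a : ExteriorAlgebra ℤ M} (ha : a ∈ ⋀[ℤ]^n M) : C n a := by
  refine Submodule.pow_induction_on_left' _ (C := fun n a _ => C n a) h0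
    (fun a b n _ _ => hadd n a b) ?_ ha
  rintro _ ⟨v, rfl⟩ n a _ h
  exact hmul n v a h

theorem inv_of_mem {n : ℕ} {a : ExteriorAlgebra ℤ M} (ha : a ∈ ⋀[ℤ]^n M) :
    inv a = (-1 : ℤ) ^ n • a := by
  refine mem_induction (C := fun n a => inv a = (-1 : ℤ) ^ n • a) ?_ ?_ ?_ ha
  · intro r; rw [AlgHom.commutes, pow_zero, one_smul]
  · intro n a b ha hb; rw [map_add, ha, hb, smul_add]
  · intro n v a ha
    rw [map_mul, inv_ι, ha, pow_succ, mul_neg_one, neg_smul, neg_mul, mul_smul_comm]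

theorem mul_comm_of_mem {p q : ℕ} {a b : ExteriorAlgebra ℤ M} (ha : a ∈ ⋀[ℤ]^p M)
    (hb : b ∈ ⋀[ℤ]^q M) : a * b = (-1 : ℤ) ^ (p * q) • (b * a) := by
  refine mem_induction (C := fun p a => a * b = (-1 : ℤ) ^ (p * q) • (b * a)) ?_ ?_ ?_ ha
  · intro r; rw [zero_mul, pow_zero, one_smul, Algebra.commutes]
  · intro n a c ha hc; rw [add_mul, ha, hc, mul_add, smul_add]
  · intro n v a ha
    rw [mul_assoc, ha, mul_smul_comm, ← mul_assoc, ι_mul_comm, inv_of_mem hb, smul_mul_assoc,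
      smul_mul_assoc, smul_smul, mul_assoc, add_mul, one_mul, pow_add]

theorem contract_of_mem_zero (f : Module.Dual ℤ M) {a : ExteriorAlgebra ℤ M}
    (ha : a ∈ ⋀[ℤ]^0 M) : contract f a = 0 := by
  rw [ExteriorAlgebra.exteriorPower, pow_zero, Submodule.mem_one] at ha
  obtain ⟨r, rfl⟩ := ha
  exact contract_algebraMap f r

theorem ι_mul_mem (v : M) {n : ℕ} {a : ExteriorAlgebra ℤ M} (ha : a ∈ ⋀[ℤ]^n M) :
    ExteriorAlgebra.ι ℤ v * a ∈ ⋀[ℤ]^(n + 1) M := by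
  rw [ExteriorAlgebra.exteriorPower, pow_succ']
  exact Submodule.mul_mem_mul ⟨_, rfl⟩ ha

theorem contract_mem (f : Module.Dual ℤ M) {n : ℕ} {a : ExteriorAlgebra ℤ M}
    (ha : a ∈ ⋀[ℤ]^(n + 1) M) : contract f a ∈ ⋀[ℤ]^n M := by
  have key : ∀ {m : ℕ}, a ∈ ⋀[ℤ]^m M →
      a ∈ ⋀[ℤ]^m M ∧ ∀ n, m = n + 1 → contract f a ∈ ⋀[ℤ]^n M := by
    intro m ha
    refine mem_induction
      (C := fun m a => a ∈ ⋀[ℤ]^m M ∧ ∀ n, m = n + 1 → contract f a ∈ ⋀[ℤ]^n M) ?_ ?_ ?_ ha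
    · intro r
      refine ⟨?_, fun n h => by simp at h⟩
      rw [ExteriorAlgebra.exteriorPower, pow_zero]
      exact Submodule.algebraMap_mem r
    · intro m a b ha hb
      refine ⟨add_mem ha.1 hb.1, fun n h => ?_⟩
      rw [map_add]
      exact add_mem (ha.2 n h) (hb.2 n h)
    · rintro m v a ⟨ha, ih⟩
      refine ⟨ι_mul_mem v ha, fun n h => ?_⟩
      obtain rfl : m = n := by omega
      rw [contract_ι_mul]
      refine sub_mem (Submodule.smul_mem _ _ ha) ?_
      rcases m with _ | m
      · rw [contract_of_mem_zero f ha, mul_zero]; exact zero_mem _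
      · exact ι_mul_mem v (ih m rfl)
  exact (key ha).2 n rfl

theorem map_mem (α : M →ₗ[ℤ] N) {n : ℕ} {a : ExteriorAlgebra ℤ M} (ha : a ∈ ⋀[ℤ]^n M) :
    ExteriorAlgebra.map α a ∈ ⋀[ℤ]^n N := by
  refine mem_induction (C := fun n a => ExteriorAlgebra.map α a ∈ ⋀[ℤ]^n N) ?_ ?_ ?_ ha
  · intro r; rw [AlgHom.commutes, ExteriorAlgebra.exteriorPower, pow_zero]; exact Submodule.algebraMap_mem r
  · intro n a b ha hb; rw [map_add]; exact add_mem ha hb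
  · intro n v a ha
    rw [map_mul, ExteriorAlgebra.map_apply_ι]
    exact ι_mul_mem _ ha

theorem algebraMapInv_of_mem {n : ℕ} {a : ExteriorAlgebra ℤ M} (ha : a ∈ ⋀[ℤ]^n M) (hn : n ≠ 0) :
    ExteriorAlgebra.algebraMapInv a = 0 := by
  refine mem_induction (C := fun n a => n ≠ 0 → ExteriorAlgebra.algebraMapInv a = 0)
    ?_ ?_ ?_ ha hn
  · intro r h; exact (h rfl).elim
  · intro n a b ha hb h; rw [map_add, ha h, hb h, add_zero]
  · intro n v a ha _
    rw [map_mul]; simp [ExteriorAlgebra.algebraMapInv]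

theorem mul_mem {p q : ℕ} {a b : ExteriorAlgebra ℤ M} (ha : a ∈ ⋀[ℤ]^p M)
    (hb : b ∈ ⋀[ℤ]^q M) : a * b ∈ ⋀[ℤ]^(p + q) M := by
  rw [ExteriorAlgebra.exteriorPower, pow_add]; exact Submodule.mul_mem_mul ha hb

end ExteriorAlgebra

section Simplices

/-- `Ex(I)`, the exterior algebra on the free `ℤ`-module with basis `I`. -/
abbrev Ex (I : Type) : Type := ExteriorAlgebra ℤ (I →₀ ℤ)

/-- The generator `e_i` of `Ex(I)`. -/
noncomputable def e {I : Type} (i : I) : Ex I := ExteriorAlgebra.ι ℤ (Finsupp.single i 1)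

/-- The antiderivation `θ_i` of degree `-1` of `Ex(I)` with `θ_i(e_i) = 1` and `θ_i(e_j) = 0` for
`j ≠ i`. -/
noncomputable def θ {I : Type} (i : I) : Ex I →ₗ[ℤ] Ex I := contract (Finsupp.lapply i)

/-- The linear form with value `1` on each basis vector. -/
noncomputable def total (I : Type) : Module.Dual ℤ (I →₀ ℤ) :=
  Finsupp.linearCombination ℤ fun _ => (1 : ℤ)

/-- The differential `d = ∑ i, θ_i` of `Ex(I)`. -/
noncomputable def boundary (I : Type) : Ex I →ₗ[ℤ] Ex I := contract (total I)

theorem boundary_eq_sum (I : Type) [Fintype I] (x : Ex I) : boundary I x = ∑ i, θ i x := by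
  have : total I = ∑ i, Finsupp.lapply i := by
    classical
    ext i
    simp [total, Finsupp.single_apply]
  simp [boundary, θ, contract, this]

/-- The linear form on `Ex(I)` with value `1` on each `e_i` and value `0` on all exterior products
of a number of generators different from `1`. -/
noncomputable def aug {I : Type} (x : Ex I) : ℤ := ExteriorAlgebra.algebraMapInv (boundary I x)

/-- The homogeneous component of dimension `n` of `Ex(I) / ℤ 1`, where the exterior product of
`n + 1` generators has dimension `n`: dividing by the unit removes the exterior power of degree `0`
and leaves the other ones unchanged. -/
noncomputable def face (I : Type) : ℤ → Submodule ℤ (Ex I)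
  | .ofNat n => ⋀[ℤ]^(n + 1) (I →₀ ℤ)
  | .negSucc _ => ⊥

/-- The morphism `Ex(I) → Ex(J)`, `e_i ↦ e_{f(i)}`. -/
noncomputable def relabel {I J : Type} (f : I → J) : Ex I →ₐ[ℤ] Ex J :=
  ExteriorAlgebra.map (Finsupp.lmapDomain ℤ ℤ f)

/-- The morphism `Ex(I ⊔ J) → Ex((I ∖ {i}) ⊔ J)` which sends `e_i` to `0` and the other generators
to themselves. -/
noncomputable def restrict {I : Type} (i : I) (J : Type) :
    Ex (I ⊕ J) →ₐ[ℤ] Ex ({k : I // k ≠ i} ⊕ J) :=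
  ExteriorAlgebra.map (Finsupp.lcomapDomain (Sum.map Subtype.val id)
    (Subtype.val_injective.sumMap Function.injective_id))

/-- The composition `x ∘_i y` of `x` of dimension `m` with `y`, namely
`(-1)^m θ_i(x ∧ y) + aug(y) x`. If `x` and `y` are exterior products of generators, then
the first term vanishes if `e_i` does not appear in `x`, and the second term becomes `0` in
`Ex((I ∖ {i}) ⊔ J)` if `e_i` appears in `x`. -/
noncomputable def circ {I J : Type} (i : I) (m : ℤ) (x : Ex I) (y : Ex J) :
    Ex ({k : I // k ≠ i} ⊕ J) :=
  restrict i J (m.negOnePow • θ (.inl i) (relabel .inl x * relabel .inr y) +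
    aug y • relabel .inl x)

/-- The differential of `Ex(I) / ℤ 1` with values in dimension `n`: it is that of `Ex(I)`, except
that the differential of elements of dimension `0` vanishes. -/
noncomputable def diff (I : Type) (n : ℤ) : Ex I →ₗ[ℤ] Ex I :=
  if 0 ≤ n then boundary I else 0

/-! Verification of the axioms. -/

theorem face_cases {I : Type} {n : ℤ} {x : Ex I} (hx : x ∈ face I n) :
    x = 0 ∨ ∃ k : ℕ, n = k ∧ x ∈ ⋀[ℤ]^(k + 1) (I →₀ ℤ) := by
  rcases n with k | k
  · exact .inr ⟨k, rfl, hx⟩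
  · exact .inl (by simpa [face] using hx)

theorem mem_face {I : Type} {n : ℕ} {x : Ex I} (hx : x ∈ ⋀[ℤ]^(n + 1) (I →₀ ℤ)) :
    x ∈ face I n := hx

theorem diff_mem {I : Type} {m n : ℤ} (h : n + 1 = m) {x : Ex I} (hx : x ∈ face I m) :
    diff I n x ∈ face I n := by
  unfold diff
  split_ifs with hn
  · rcases face_cases hx with rfl | ⟨k, rfl, hx⟩
    · rw [map_zero]; exact zero_mem _
    · lift n to ℕ using hn
      obtain rfl : n + 1 = k := by exact_mod_cast h
      exact mem_face (contract_mem _ hx)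
  · exact zero_mem _

theorem map_mem_face {I J : Type} (α : (I →₀ ℤ) →ₗ[ℤ] (J →₀ ℤ)) {n : ℤ} {x : Ex I}
    (hx : x ∈ face I n) : ExteriorAlgebra.map α x ∈ face J n := by
  rcases face_cases hx with rfl | ⟨k, rfl, hx⟩
  · rw [map_zero]; exact zero_mem _
  · exact mem_face (map_mem α hx)

/-- On generators: `e_i ↦ 0`, and `e_k ↦ e_k` for `k ≠ i`. -/
noncomputable def alpha {I : Type} (i : I) (J : Type) :
    (I →₀ ℤ) →ₗ[ℤ] ({k : I // k ≠ i} ⊕ J →₀ ℤ) :=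
  (Finsupp.lcomapDomain (Sum.map Subtype.val id)
    (Subtype.val_injective.sumMap Function.injective_id)) ∘ₗ Finsupp.lmapDomain ℤ ℤ Sum.inl

theorem alpha_self {I : Type} (i : I) (J : Type) : alpha i J (Finsupp.single i 1) = 0 := by
  classical
  ext a
  rcases a with ⟨k, hk⟩ | j
  · simp [alpha, Finsupp.lcomapDomain]
  · simp [alpha, Finsupp.lcomapDomain]

theorem alpha_ne {I : Type} {i k : I} (h : k ≠ i) (J : Type) :
    alpha i J (Finsupp.single k 1) = Finsupp.single (.inl ⟨k, h⟩) 1 := by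
  classical
  ext a
  rcases a with ⟨l, hl⟩ | j
  · simp [alpha, Finsupp.lcomapDomain, Finsupp.single_apply]
  · simp [alpha, Finsupp.lcomapDomain]

theorem restrict_relabel_inr {I J : Type} (i : I) (y : Ex J) :
    restrict i J (relabel .inr y) = relabel .inr y := by
  have : (Finsupp.lcomapDomain (R := ℤ) (M := ℤ) (Sum.map (Subtype.val (p := (· ≠ i))) (id : J → J))
      (Subtype.val_injective.sumMap Function.injective_id)) ∘ₗ Finsupp.lmapDomain ℤ ℤ Sum.inr
      = Finsupp.lmapDomain ℤ ℤ Sum.inr := by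
    classical
    ext j a
    rcases a with ⟨l, hl⟩ | j
    · simp [Finsupp.lcomapDomain]
    · simp [Finsupp.lcomapDomain, Finsupp.single_apply]
  rw [restrict, relabel, relabel, ← AlgHom.comp_apply, ExteriorAlgebra.map_comp_map, this]

theorem restrict_relabel_inl {I J : Type} (i : I) (x : Ex I) :
    restrict i J (relabel .inl x) = ExteriorAlgebra.map (alpha i J) x := by
  rw [restrict, relabel, ← AlgHom.comp_apply, ExteriorAlgebra.map_comp_map, alpha]

theorem circ_eq {I J : Type} (i : I) (m : ℤ) (x : Ex I) (y : Ex J) :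
    circ i m x y = (m.negOnePow : ℤ) • (ExteriorAlgebra.map (alpha i J) (θ i x) * relabel .inr y) +
      aug y • ExteriorAlgebra.map (alpha i J) x := by
  have h1 : θ (.inl i) (relabel (Sum.inl : I → I ⊕ J) x) = relabel .inl (θ i x) := by
    have : Finsupp.lapply (R := ℤ) (M := ℤ) (Sum.inl i) ∘ₗ
        Finsupp.lmapDomain ℤ ℤ (Sum.inl : I → I ⊕ J) = Finsupp.lapply i := by
      classical
      ext k
      simp [Finsupp.single_apply]
    rw [θ, relabel, contract_map, this, θ]
  have h2 : θ (.inl i) (relabel (Sum.inr : J → I ⊕ J) y) = 0 := by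
    rw [θ, relabel, contract_map]
    convert map_zero (ExteriorAlgebra.map (Finsupp.lmapDomain ℤ ℤ (Sum.inr : J → I ⊕ J)))
    convert contract_zero y
    ext k
    simp
  have h3 : θ (.inl i) (relabel .inl x * relabel .inr y) =
      (relabel .inl (θ i x) * relabel .inr y : Ex (I ⊕ J)) := by
    rw [← h1]
    unfold θ at *
    rw [contract_mul, h2, mul_zero, add_zero]
  rw [circ, h3, map_add, Units.smul_def, map_smul, map_smul, map_mul, restrict_relabel_inr,
    restrict_relabel_inl, restrict_relabel_inl]

theorem theta_mem {I : Type} (f : Module.Dual ℤ (I →₀ ℤ)) {m : ℕ} {x : Ex I}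
    (hx : x ∈ face I m) : contract f x ∈ ⋀[ℤ]^m (I →₀ ℤ) := contract_mem f hx

theorem circ_mem {I J : Type} (i : I) {m n p : ℤ} (h : m + n = p) {x : Ex I} {y : Ex J}
    (hx : x ∈ face I m) (hy : y ∈ face J n) : circ i m x y ∈ face _ p := by
  rw [circ_eq]
  rcases face_cases hx with rfl | ⟨m, rfl, hx⟩
  · simp
  rcases face_cases hy with rfl | ⟨n, rfl, hy⟩
  · simp [aug]
  subst h
  refine add_mem (Submodule.smul_mem _ _ ?_) ?_
  · exact mul_mem (p := m) (q := n + 1) (map_mem _ (contract_mem _ hx)) (map_mem _ hy)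
  · rcases n with _ | n
    · refine Submodule.smul_mem _ _ ?_
      simpa using map_mem_face (alpha i J) (mem_face hx)
    · rw [aug, boundary, algebraMapInv_of_mem (contract_mem _ hy) (by omega), zero_smul]
      exact zero_mem _

theorem aug_add {I : Type} (x y : Ex I) : aug (x + y) = aug x + aug y := by simp [aug]

theorem aug_smul {I : Type} (r : ℤ) (x : Ex I) : aug (r • x) = r * aug x := by
  rw [aug, map_smul, map_smul, smul_eq_mul, aug]

theorem aug_zero {I : Type} : aug (0 : Ex I) = 0 := by simp [aug]

theorem circ_add_left {I J : Type} (i : I) (m : ℤ) (x x' : Ex I) (y : Ex J) :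
    circ i m (x + x') y = circ i m x y + circ i m x' y := by
  simp only [circ_eq, map_add, add_mul, smul_add]; abel

theorem circ_add_right {I J : Type} (i : I) (m : ℤ) (x : Ex I) (y y' : Ex J) :
    circ i m x (y + y') = circ i m x y + circ i m x y' := by
  simp only [circ_eq, map_add, mul_add, smul_add, aug_add, add_smul]; abel

theorem total_comp_alpha {I : Type} (i : I) (J : Type) :
    total _ ∘ₗ alpha i J = total I - Finsupp.lapply i := by
  classical
  ext k
  by_cases h : k = i
  · subst h
    simp [alpha_self, total]
  · simp [alpha_ne h, total, h]

theorem lapply_inl_comp_alpha {I : Type} {i k : I} (h : k ≠ i) (J : Type) :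
    Finsupp.lapply (R := ℤ) (M := ℤ) (.inl ⟨k, h⟩) ∘ₗ alpha i J = Finsupp.lapply k := by
  classical
  ext l
  by_cases hl : l = i
  · subst hl
    simp [alpha_self, h.symm]
  · simp [alpha_ne hl, Finsupp.single_apply]

theorem lapply_inr_comp_alpha {I J : Type} (i : I) (j : J) :
    Finsupp.lapply (R := ℤ) (M := ℤ) (.inr j) ∘ₗ alpha i J = 0 := by
  classical
  ext l
  by_cases hl : l = i
  · subst hl
    simp [alpha_self]
  · simp [alpha_ne hl]

theorem total_comp_lmapDomain {I J : Type} (f : I → J) :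
    total J ∘ₗ Finsupp.lmapDomain ℤ ℤ f = total I := by
  ext; simp [total]

theorem lapply_comp_lmapDomain {I J : Type} {f : I → J} (hf : Function.Injective f) (i : I) :
    Finsupp.lapply (R := ℤ) (M := ℤ) (f i) ∘ₗ Finsupp.lmapDomain ℤ ℤ f = Finsupp.lapply i := by
  classical
  ext k
  simp [Finsupp.single_apply, hf.eq_iff]

theorem lapply_comp_lmapDomain_zero {I J : Type} {f : I → J} {j : J} (hf : ∀ i, f i ≠ j) :
    Finsupp.lapply (R := ℤ) (M := ℤ) j ∘ₗ Finsupp.lmapDomain ℤ ℤ f = 0 := by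
  classical
  ext k
  simp [hf]

theorem boundary_map_alpha {I : Type} (i : I) (J : Type) (x : Ex I) :
    boundary _ (ExteriorAlgebra.map (alpha i J) x) =
      ExteriorAlgebra.map (alpha i J) (boundary I x) - ExteriorAlgebra.map (alpha i J) (θ i x) := by
  rw [boundary, contract_map, total_comp_alpha, contract_sub, map_sub, boundary, θ]

theorem theta_inl_map_alpha {I : Type} {i k : I} (h : k ≠ i) (J : Type) (x : Ex I) :
    θ (.inl ⟨k, h⟩) (ExteriorAlgebra.map (alpha i J) x) =
      ExteriorAlgebra.map (alpha i J) (θ k x) := by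
  rw [θ, contract_map, lapply_inl_comp_alpha, θ]

theorem theta_inr_map_alpha {I J : Type} (i : I) (j : J) (x : Ex I) :
    θ (.inr j) (ExteriorAlgebra.map (alpha i J) x) = 0 := by
  rw [θ, contract_map, lapply_inr_comp_alpha, contract_zero, map_zero]

theorem boundary_relabel {I J : Type} (f : I → J) (x : Ex I) :
    boundary J (relabel f x) = relabel f (boundary I x) := by
  rw [boundary, relabel, contract_map, total_comp_lmapDomain, boundary]

theorem theta_relabel {I J : Type} {f : I → J} (hf : Function.Injective f) (i : I) (x : Ex I) :
    θ (f i) (relabel f x) = relabel f (θ i x) := by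
  rw [θ, relabel, contract_map, lapply_comp_lmapDomain hf, θ]

theorem theta_relabel_zero {I J : Type} {f : I → J} {j : J} (hf : ∀ i, f i ≠ j) (x : Ex I) :
    θ j (relabel f x) = 0 := by
  rw [θ, relabel, contract_map, lapply_comp_lmapDomain_zero hf, contract_zero, map_zero]

theorem theta_mul {I : Type} (i : I) (x y : Ex I) : θ i (x * y) = θ i x * y + inv x * θ i y :=
  contract_mul _ _ _

theorem boundary_mul {I : Type} (x y : Ex I) :
    boundary I (x * y) = boundary I x * y + inv x * boundary I y :=
  contract_mul _ _ _

theorem aug_relabel {I J : Type} (f : I → J) (x : Ex I) : aug (relabel f x) = aug x := by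
  have : (ExteriorAlgebra.algebraMapInv (R := ℤ) (M := J →₀ ℤ)).comp (relabel f) =
      ExteriorAlgebra.algebraMapInv := by
    ext; simp [relabel, ExteriorAlgebra.algebraMapInv]
  rw [aug, boundary_relabel, ← AlgHom.comp_apply, this, aug]

theorem algebraMapInv_map {I J : Type} (α : (I →₀ ℤ) →ₗ[ℤ] (J →₀ ℤ)) (x : Ex I) :
    ExteriorAlgebra.algebraMapInv (ExteriorAlgebra.map α x) =
      ExteriorAlgebra.algebraMapInv x := by
  have : (ExteriorAlgebra.algebraMapInv (R := ℤ) (M := J →₀ ℤ)).comp (ExteriorAlgebra.map α) =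
      ExteriorAlgebra.algebraMapInv := by
    ext; simp [ExteriorAlgebra.algebraMapInv]
  rw [← AlgHom.comp_apply, this]

theorem algebraMapInv_of_mem_face {I : Type} {n : ℤ} {x : Ex I} (hx : x ∈ face I n) :
    ExteriorAlgebra.algebraMapInv x = 0 := by
  rcases face_cases hx with rfl | ⟨k, rfl, hx⟩
  · exact map_zero _
  · exact algebraMapInv_of_mem hx (Nat.succ_ne_zero k)

theorem aug_of_mem {I : Type} {n : ℤ} {x : Ex I} (hx : x ∈ face I n) (hn : n ≠ 0) :
    aug x = 0 := by
  rcases face_cases hx with rfl | ⟨k, rfl, hx⟩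
  · exact aug_zero
  · exact algebraMapInv_of_mem (contract_mem _ hx) (by exact_mod_cast hn)

theorem inv_map_theta {I J : Type} (α : (I →₀ ℤ) →ₗ[ℤ] (J →₀ ℤ)) (i : I) {n : ℤ} {x : Ex I}
    (hx : x ∈ face I n) : inv (ExteriorAlgebra.map α (θ i x)) =
      (n.negOnePow : ℤ) • ExteriorAlgebra.map α (θ i x) := by
  rcases face_cases hx with rfl | ⟨k, rfl, hx⟩
  · simp
  · rw [θ, inv_of_mem (map_mem α (contract_mem _ hx)), Int.coe_negOnePow_natCast]

theorem negOnePow_mul_self (n : ℤ) : (n.negOnePow : ℤ) * n.negOnePow = 1 := by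
  rcases Int.units_eq_one_or n.negOnePow with h | h <;> simp [h]

theorem aug_circ {I J : Type} (i : I) {m n : ℤ} {x : Ex I} {y : Ex J} (hx : x ∈ face I m)
    (hy : y ∈ face J n) : aug (circ i m x y) = aug x * aug y := by
  have h1 : ExteriorAlgebra.algebraMapInv (relabel (Sum.inr : J → {k : I // k ≠ i} ⊕ J) y) = 0 :=
    algebraMapInv_of_mem_face (map_mem_face _ hy)
  have h2 : aug (ExteriorAlgebra.map (alpha i J) x) =
      aug x - ExteriorAlgebra.algebraMapInv (θ i x) := by
    rw [aug, boundary_map_alpha, map_sub, algebraMapInv_map, algebraMapInv_map, aug]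
  have h3 : (m.negOnePow : ℤ) * (m.negOnePow * ExteriorAlgebra.algebraMapInv (θ i x)) =
      ExteriorAlgebra.algebraMapInv (θ i x) := by
    rw [← mul_assoc, negOnePow_mul_self, one_mul]
  have h4 : aug (ExteriorAlgebra.map (alpha i J) (θ i x) * relabel Sum.inr y) =
      m.negOnePow * ExteriorAlgebra.algebraMapInv (θ i x) * aug y := by
    rw [aug, boundary_mul, map_add, map_mul, h1, mul_zero, zero_add, map_mul, inv_map_theta _ _ hx,
      map_smul, algebraMapInv_map]
    have := aug_relabel (Sum.inr : J → {k : I // k ≠ i} ⊕ J) y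
    rw [aug] at this
    rw [this, smul_eq_mul]
  rw [circ_eq, aug_add, aug_smul, aug_smul, h2, h4]
  linear_combination aug y * h3

theorem hom_ext_e {I J : Type} {f g : Ex I →ₐ[ℤ] Ex J}
    (h : ∀ i, f (e i) = g (e i)) (x : Ex I) : f x = g x := by
  have : f = g := by
    ext i
    exact h i
  rw [this]

theorem relabel_e {I J : Type} (f : I → J) (i : I) : relabel f (e i) = e (f i) := by
  simp [relabel, e]

theorem map_alpha_self {I : Type} (i : I) (J : Type) :
    ExteriorAlgebra.map (alpha i J) (e i) = 0 := by
  rw [e, ExteriorAlgebra.map_apply_ι, alpha_self, map_zero]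

theorem map_alpha_ne {I : Type} {i k : I} (h : k ≠ i) (J : Type) :
    ExteriorAlgebra.map (alpha i J) (e k) = e (.inl ⟨k, h⟩) := by
  rw [e, ExteriorAlgebra.map_apply_ι, alpha_ne h, e]

theorem seq_inl_inl {I J : Type} (K : Type) (i : I) (j : J) (x : Ex I) :
    relabel (OperadLabels.seq K i j)
      (ExteriorAlgebra.map (alpha (.inr j) K) (ExteriorAlgebra.map (alpha i J) x)) =
      ExteriorAlgebra.map (alpha i _) x := by
  rw [← AlgHom.comp_apply, ← AlgHom.comp_apply]
  refine hom_ext_e (fun k => ?_) x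
  simp only [AlgHom.comp_apply]
  by_cases h : k = i
  · subst h
    rw [map_alpha_self, map_alpha_self, map_zero, map_zero]
  · rw [map_alpha_ne h, map_alpha_ne h, map_alpha_ne Sum.inl_ne_inr, relabel_e]
    rfl

theorem seq_inl_inr {I J : Type} (K : Type) (i : I) (j : J) (y : Ex J) :
    relabel (OperadLabels.seq K i j)
      (ExteriorAlgebra.map (alpha (.inr j) K)
        (relabel (Sum.inr : J → {k : I // k ≠ i} ⊕ J) y)) =
      relabel Sum.inr (ExteriorAlgebra.map (alpha j K) y) := by
  rw [← AlgHom.comp_apply, ← AlgHom.comp_apply, ← AlgHom.comp_apply]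
  refine hom_ext_e (fun k => ?_) y
  simp only [AlgHom.comp_apply]
  by_cases h : k = j
  · subst h
    rw [relabel_e, map_alpha_self, map_alpha_self, map_zero, map_zero]
  · have h' : (Sum.inr k : {l : I // l ≠ i} ⊕ J) ≠ .inr j := fun e => h (Sum.inr_injective e)
    rw [relabel_e, map_alpha_ne h, map_alpha_ne h', relabel_e, relabel_e]
    rfl

theorem relabel_relabel {I J K : Type} (f : I → J) (g : J → K) (x : Ex I) :
    relabel g (relabel f x) = relabel (g ∘ f) x := by
  rw [← AlgHom.comp_apply]
  refine hom_ext_e (fun i => ?_) x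
  simp [relabel_e]

theorem par_inl_inl {I J K : Type} {i k : I} (h : k ≠ i) (x : Ex I) :
    relabel (OperadLabels.par J K h)
      (ExteriorAlgebra.map (alpha (.inl ⟨k, h⟩) K) (ExteriorAlgebra.map (alpha i J) x)) =
      ExteriorAlgebra.map (alpha (.inl ⟨i, h.symm⟩) J) (ExteriorAlgebra.map (alpha k K) x) := by
  rw [← AlgHom.comp_apply, ← AlgHom.comp_apply, ← AlgHom.comp_apply]
  refine hom_ext_e (fun l => ?_) x
  simp only [AlgHom.comp_apply]
  by_cases hi : l = i
  · subst hi
    rw [map_alpha_self, map_alpha_ne h.symm, map_alpha_self, map_zero, map_zero]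
  by_cases hk : l = k
  · subst hk
    rw [map_alpha_self, map_alpha_ne h, map_alpha_self, map_zero, map_zero]
  have h1 : (Sum.inl ⟨l, hi⟩ : {l : I // l ≠ i} ⊕ J) ≠ .inl ⟨k, h⟩ :=
    fun e => hk (congrArg Subtype.val (Sum.inl_injective e))
  have h2 : (Sum.inl ⟨l, hk⟩ : {l : I // l ≠ k} ⊕ K) ≠ .inl ⟨i, h.symm⟩ :=
    fun e => hi (congrArg Subtype.val (Sum.inl_injective e))
  rw [map_alpha_ne hi, map_alpha_ne hk, map_alpha_ne h1, map_alpha_ne h2, relabel_e]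
  rfl

theorem map_alpha_relabel_inr {I J : Type} (K : Type) (i : I) (y : Ex J) :
    ExteriorAlgebra.map (alpha (.inl i) K) (relabel (Sum.inr : J → I ⊕ J) y) =
      relabel (fun j => .inl ⟨.inr j, Sum.inr_ne_inl⟩) y := by
  rw [← AlgHom.comp_apply]
  refine hom_ext_e (fun j => ?_) y
  simp only [AlgHom.comp_apply]
  rw [relabel_e, relabel_e, map_alpha_ne Sum.inr_ne_inl]

theorem congr_inl {I I' J J' : Type} (f : I ≃ I') (g : J ≃ J') (i : I) (x : Ex I) :
    relabel (OperadLabels.congr f g i) (ExteriorAlgebra.map (alpha i J) x) =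
      ExteriorAlgebra.map (alpha (f i) J') (relabel f x) := by
  rw [← AlgHom.comp_apply, ← AlgHom.comp_apply]
  refine hom_ext_e (fun k => ?_) x
  simp only [AlgHom.comp_apply]
  by_cases h : k = i
  · subst h
    rw [relabel_e, map_alpha_self, map_alpha_self, map_zero]
  · rw [relabel_e, map_alpha_ne h, map_alpha_ne (f.injective.ne h), relabel_e]
    rfl

theorem relabel_congr {I J : Type} {f g : I → J} (h : ∀ i, f i = g i) (x : Ex I) :
    relabel f x = relabel g x := by rw [funext h]

theorem relabel_id {I : Type} {f : I → I} (h : ∀ i, f i = i) (x : Ex I) : relabel f x = x :=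
  hom_ext_e (f := relabel f) (g := AlgHom.id ℤ _) (fun i => by simp [relabel_e, h]) x

/-- Equivariance. -/
theorem circ_map {I I' J J' : Type} (f : I ≃ I') (g : J ≃ J') (i : I) (m : ℤ) (x : Ex I)
    (y : Ex J) : circ (f i) m (relabel f x) (relabel g y) =
      relabel (OperadLabels.congr f g i) (circ i m x y) := by
  rw [circ_eq, circ_eq, map_add, map_smul, map_smul, map_mul, congr_inl, congr_inl,
    theta_relabel f.injective, aug_relabel, relabel_relabel, relabel_relabel]
  rfl

/-- Sequential associativity. -/
theorem circ_seq {I J K : Type} (i : I) (j : J) {a b c ab : ℤ} (hab : a + b = ab) {x : Ex I}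
    {y : Ex J} {z : Ex K} (hx : x ∈ face I a) (hy : y ∈ face J b) (hz : z ∈ face K c) :
    relabel (OperadLabels.seq K i j) (circ (.inr j) ab (circ i a x y) z) =
      circ i a x (circ j b y z) := by
  have h1 : θ (.inr j) (circ i a x y) =
      ExteriorAlgebra.map (alpha i J) (θ i x) * relabel .inr (θ j y) := by
    rw [circ_eq, map_add, map_smul, map_smul, theta_mul, theta_inr_map_alpha, theta_inr_map_alpha,
      theta_relabel Sum.inr_injective, inv_map_theta _ _ hx, zero_mul, zero_add, smul_zero,
      add_zero, smul_mul_assoc, smul_smul, negOnePow_mul_self, one_smul]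
  rw [circ_eq (Sum.inr j), h1, circ_eq i a x (circ j b y z), aug_circ j hy hz, circ_eq i a x y,
    circ_eq j b y z]
  simp only [map_add, map_mul, map_smul, seq_inl_inl, seq_inl_inr, relabel_relabel, mul_add,
    smul_add, mul_smul_comm, smul_smul]
  have h2 : relabel (⇑(OperadLabels.seq K i j) ∘ Sum.inr) z =
      relabel ((Sum.inr : _ → {k : I // k ≠ i} ⊕ _) ∘ (Sum.inr : K → {l : J // l ≠ j} ⊕ K)) z :=
    relabel_congr (fun _ => rfl) z
  rw [h2, ← hab, Int.negOnePow_add, Units.val_mul, mul_assoc, mul_comm (aug z), mul_comm (aug z),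
    ← add_assoc]

/-- Parallel associativity. -/
theorem circ_par {I J K : Type} {i k : I} (h : k ≠ i) {a b c ab ac : ℤ} (hab : a + b = ab)
    (hac : a + c = ac) {x : Ex I} {y : Ex J} {z : Ex K} (hy : y ∈ face J b) (hz : z ∈ face K c) :
    relabel (OperadLabels.par J K h) (circ (.inl ⟨k, h⟩) ab (circ i a x y) z) =
      ((b * c).negOnePow : ℤ) • circ (.inl ⟨i, h.symm⟩) ac (circ k a x z) y := by
  have key : ∀ {I J : Type} {i k : I} (h : k ≠ i) (x : Ex I) (y : Ex J),
      θ (.inl ⟨k, h⟩) (circ i a x y) =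
        (a.negOnePow : ℤ) • (ExteriorAlgebra.map (alpha i J) (θ k (θ i x)) * relabel .inr y) +
          aug y • ExteriorAlgebra.map (alpha i J) (θ k x) := by
    intro I J i k h x y
    rw [circ_eq, map_add, map_smul, map_smul, theta_mul, theta_inl_map_alpha, theta_inl_map_alpha,
      theta_relabel_zero (fun _ => Sum.inr_ne_inl), mul_zero, add_zero]
  have hθ : θ i (θ k x) = -θ k (θ i x) := contract_comm _ _ _
  rw [circ_eq (Sum.inl ⟨k, h⟩ : {l : I // l ≠ i} ⊕ J) ab (circ i a x y) z,
    circ_eq (Sum.inl ⟨i, h.symm⟩ : {l : I // l ≠ k} ⊕ K) ac (circ k a x z) y, key, key, hθ, circ_eq i a x y,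
    circ_eq k a x z]
  simp only [map_add, map_mul, map_smul, map_neg, par_inl_inl, map_alpha_relabel_inr,
    relabel_relabel, add_mul, smul_add, smul_smul, smul_mul_assoc,
    neg_mul, smul_neg]
  have hY : relabel (⇑(OperadLabels.par J K h) ∘ fun j => Sum.inl ⟨Sum.inr j, Sum.inr_ne_inl⟩) y =
      relabel Sum.inr y := relabel_congr (fun _ => rfl) y
  have hZ : relabel (⇑(OperadLabels.par J K h) ∘ Sum.inr) z =
      relabel (fun j => Sum.inl ⟨Sum.inr j, Sum.inr_ne_inl⟩) z := relabel_congr (fun _ => rfl) z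
  have e1 : (ab.negOnePow : ℤ) * aug y = (b * c).negOnePow * (aug y * a.negOnePow) := by
    by_cases hb : b = 0
    · subst hb; rw [← hab]; simp [mul_comm]
    · simp [aug_of_mem hy hb]
  have e2 : aug z * (a.negOnePow : ℤ) = (b * c).negOnePow * (ac.negOnePow * aug z) := by
    by_cases hc : c = 0
    · subst hc; rw [← hac]; simp [mul_comm]
    · simp [aug_of_mem hz hc]
  have e3 : aug z * aug y = (b * c).negOnePow * (aug y * aug z) := by
    by_cases hc : c = 0
    · subst hc; simp [mul_comm]
    · simp [aug_of_mem hz hc]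
  rw [hY, hZ, e1, e2, e3]
  have hc : ∀ (T Y Z : Ex ({a : {l : I // l ≠ k} ⊕ K // a ≠ .inl ⟨i, h.symm⟩} ⊕ J)),
      Y ∈ face _ b → Z ∈ face _ c →
      ((ab.negOnePow : ℤ) * a.negOnePow) • (T * Y * Z) =
        -((((b * c).negOnePow : ℤ) * (ac.negOnePow * a.negOnePow)) • (T * Z * Y)) := by
    intro T Y Z hY hZ
    rcases face_cases hY with rfl | ⟨b, rfl, hY⟩
    · simp
    rcases face_cases hZ with rfl | ⟨c, rfl, hZ⟩
    · simp
    rw [mul_assoc T Y Z, mul_comm_of_mem hY hZ, mul_smul_comm, smul_smul, ← mul_assoc, ← neg_smul,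
      ← hab, ← hac, Int.negOnePow_add, Int.negOnePow_add, ← Nat.cast_mul]
    congr 1
    simp only [Units.val_mul, Int.coe_negOnePow_natCast]
    have hb : (-1 : ℤ) ^ b * (-1) ^ b = 1 := by rw [← mul_pow]; simp
    have e : (-1 : ℤ) ^ ((b + 1) * (c + 1)) = -((-1) ^ (b * c) * (-1) ^ b * (-1) ^ c) := by ring
    rw [e]
    linear_combination (-((-1 : ℤ) ^ (b * c) * (-1) ^ c) * a.negOnePow * a.negOnePow) * hb
  rw [hc _ (relabel Sum.inr y) (relabel (fun j => Sum.inl ⟨Sum.inr j, Sum.inr_ne_inl⟩) z)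
    (map_mem_face _ hy) (map_mem_face _ hz)]
  abel

theorem boundary_circ {I J : Type} (i : I) {m m' : ℤ} (hm : m' + 1 = m) {x : Ex I}
    (y : Ex J) (hx : x ∈ face I m) : boundary _ (circ i m x y) =
      circ i m' (boundary I x) y + (m.negOnePow : ℤ) • circ i m x (boundary J y) -
        aug y • ExteriorAlgebra.map (alpha i J) (θ i x) := by
  have h1 : θ i (boundary I x) = -boundary I (θ i x) := contract_comm _ _ _
  have h2 : θ i (θ i x) = 0 := contract_contract _ _
  have h3 : aug (boundary J y) = 0 := by
    rw [aug, boundary, contract_contract, map_zero]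
  have h4 : (m.negOnePow : ℤ) = -m'.negOnePow := by
    rw [← hm, Int.negOnePow_succ, Units.val_neg]
  rw [circ_eq, circ_eq, circ_eq, map_add, map_smul, map_smul, boundary_mul, boundary_map_alpha,
    boundary_map_alpha, boundary_relabel, h1, h2, h3, inv_map_theta _ _ hx]
  simp only [map_zero, sub_zero, zero_smul, add_zero, smul_add, smul_mul_assoc, smul_smul,
    negOnePow_mul_self, one_smul, map_neg, neg_mul, smul_neg, smul_sub]
  rw [h4, neg_smul]
  abel

theorem diff_of_nonneg (I : Type) {n : ℤ} (h : 0 ≤ n) : diff I n = boundary I := if_pos h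

theorem diff_of_neg (I : Type) {n : ℤ} (h : ¬ 0 ≤ n) (x : Ex I) : diff I n x = 0 := by
  rw [diff, if_neg h, LinearMap.zero_apply]

/-- The composition is a morphism of complexes. -/
theorem diff_circ {I J : Type} (i : I) {m n m' n' p' : ℤ} (hm : m' + 1 = m) (hn : n' + 1 = n)
    (hp : p' + 1 = m + n) {x : Ex I} {y : Ex J} (hx : x ∈ face I m) (hy : y ∈ face J n) :
    diff _ p' (circ i m x y) =
      circ i m' (diff I m' x) y + (m.negOnePow : ℤ) • circ i m x (diff J n' y) := by
  rcases face_cases hx with rfl | ⟨m, rfl, hx'⟩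
  · simp [circ_eq]
  rcases face_cases hy with rfl | ⟨n, rfl, hy'⟩
  · simp [circ_eq, aug_zero]
  have key := boundary_circ i hm y hx
  have hx0 : circ i m' (0 : Ex I) y = 0 := by simp [circ_eq]
  have hy0 : circ i m x (0 : Ex J) = 0 := by simp [circ_eq, aug_zero]
  rcases n with _ | n
  · rw [diff_of_neg J (n := n') (by push_cast at hn; omega), hy0, smul_zero, add_zero]
    rcases m with _ | m
    · rw [diff_of_neg _ (n := p') (by push_cast at hp; omega),
        diff_of_neg I (n := m') (by push_cast at hm; omega), hx0]
    · rw [diff_of_nonneg _ (n := p') (by push_cast at hp; omega),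
        diff_of_nonneg I (n := m') (by push_cast at hm; omega), key]
      have hb : boundary J y ∈ ⋀[ℤ]^0 (J →₀ ℤ) := contract_mem _ hy'
      rw [ExteriorAlgebra.exteriorPower, pow_zero, Submodule.mem_one] at hb
      obtain ⟨r, hr⟩ := hb
      have h1 : aug y = r := by
        rw [aug, ← hr]; exact ExteriorAlgebra.algebraMap_leftInverse _ r
      have h2 : aug (boundary J y) = 0 := by
        rw [aug, boundary, contract_contract, map_zero]
      rw [circ_eq i _ x (boundary J y), h2, zero_smul, add_zero, ← hr, h1, AlgHom.commutes,
        smul_smul, negOnePow_mul_self, one_smul, ← Algebra.commutes, ← Algebra.smul_def]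
      abel
  · have h1 : aug y = 0 := aug_of_mem hy (by omega)
    rw [diff_of_nonneg _ (n := p') (by push_cast at hp; omega),
      diff_of_nonneg J (n := n') (by push_cast at hn; omega), key, h1, zero_smul, sub_zero]
    rcases m with _ | m
    · have h2 : θ i (boundary I x) = 0 := contract_of_mem_zero _ (contract_mem _ hx')
      have h3 : circ i m' (boundary I x) y = 0 := by simp [circ_eq, h2, h1]
      rw [diff_of_neg I (n := m') (by push_cast at hm; omega), h3, hx0]
    · rw [diff_of_nonneg I (n := m') (by push_cast at hm; omega)]

theorem one_circ {J : Type} (y : Ex J) :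
    relabel (OperadLabels.unitLeft J) (circ () 0 (e ()) y) = y := by
  have h : θ () (e ()) = 1 := by
    simp [θ, e, contract]
  rw [circ_eq, h, map_alpha_self, smul_zero, add_zero, map_one, one_mul, Int.negOnePow_zero,
    Units.val_one, one_smul, relabel_relabel]
  exact relabel_id (fun _ => rfl) y

theorem aug_e {I : Type} (i : I) : aug (e i) = 1 := by
  simp [aug, boundary, contract, e, total]

theorem circ_one {I : Type} (i : I) {n : ℤ} {x : Ex I} (hx : x ∈ face I n) :
    relabel (OperadLabels.unitRight i) (circ i n x (e ())) = x := by
  let γ : Ex I →ₐ[ℤ] Ex I :=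
    (relabel (OperadLabels.unitRight i)).comp (ExteriorAlgebra.map (alpha i Unit))
  have hγi : γ (e i) = 0 := by
    simp only [γ, AlgHom.comp_apply, map_alpha_self, map_zero]
  have hγk : ∀ k, k ≠ i → γ (e k) = e k := by
    intro k hk
    simp only [γ, AlgHom.comp_apply]
    rw [map_alpha_ne hk, relabel_e]
    rfl
  have hγ : ∀ v : I →₀ ℤ, ExteriorAlgebra.ι ℤ v = γ (ExteriorAlgebra.ι ℤ v) + v i • e i := by
    intro v
    have : ExteriorAlgebra.ι ℤ =
        γ.toLinearMap ∘ₗ ExteriorAlgebra.ι ℤ + (Finsupp.lapply i).smulRight (e i) := by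
      classical
      ext k
      by_cases hk : k = i
      · subst hk
        simpa [e] using hγi
      · have h := (hγk k hk).symm
        rw [e] at h
        simpa [hk] using h
    exact DFunLike.congr_fun this v
  have hee : e i * e i = 0 := ExteriorAlgebra.ι_sq_zero _
  have key : ∀ x : Ex I, x = γ x + e i * γ (θ i x) := by
    intro x
    induction x using induction_left with
    | h0 r => rw [θ, contract_algebraMap, AlgHom.commutes, map_zero, mul_zero, add_zero]
    | hadd a b ha hb =>
      rw [map_add, map_add, map_add, mul_add, add_add_add_comm, ← ha, ← hb]
    | hmul a v ha =>
      have hswap : e i * γ (ExteriorAlgebra.ι ℤ v) = -(γ (ExteriorAlgebra.ι ℤ v) * e i) := by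
        have h1 : γ (ExteriorAlgebra.ι ℤ v) = ExteriorAlgebra.ι ℤ v - v i • e i := by
          rw [eq_sub_iff_add_eq]; exact (hγ v).symm
        rw [h1, mul_sub, sub_mul, mul_smul_comm, smul_mul_assoc, hee, smul_zero, sub_zero, sub_zero]
        exact eq_neg_of_add_eq_zero_left (ExteriorAlgebra.ι_add_mul_swap _ _)
      have h2 : θ i (ExteriorAlgebra.ι ℤ v * a) = v i • a - ExteriorAlgebra.ι ℤ v * θ i a :=
        contract_ι_mul _ _ _
      rw [h2, map_sub, map_smul, map_mul, map_mul, mul_sub, ← mul_assoc (e i), hswap]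
      conv_lhs => rw [ha, hγ v]
      simp only [add_mul, mul_add, smul_mul_assoc, ← mul_assoc, hee, zero_mul, smul_zero,
        mul_smul_comm, neg_mul]
      abel
  have hcomm : γ (θ i x) * e i = (n.negOnePow : ℤ) • (e i * γ (θ i x)) := by
    rcases face_cases hx with rfl | ⟨k, rfl, hx⟩
    · simp
    · have h1 : γ (θ i x) ∈ ⋀[ℤ]^k (I →₀ ℤ) := map_mem _ (map_mem _ (contract_mem _ hx))
      have h2 : e i ∈ ⋀[ℤ]^1 (I →₀ ℤ) := by
        rw [ExteriorAlgebra.exteriorPower, pow_one]; exact ⟨_, rfl⟩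
      rw [mul_comm_of_mem h1 h2, mul_one, Int.coe_negOnePow_natCast]
  rw [circ_eq, aug_e, one_smul, map_add, map_smul, map_mul, relabel_relabel, relabel_e]
  change (n.negOnePow : ℤ) • (γ (θ i x) * e i) + γ x = x
  rw [hcomm, smul_smul, negOnePow_mul_self, one_smul, add_comm]
  exact (key x).symm

end Simplices

end Pasc

/-- The operad Pasc: `Pasc(I)` is the quotient of the complex `Ex(I)` by its unit, graded by the
dimension, with the composition `Pasc.circ`. (For empty `I` this is `0`.) -/
noncomputable def pasc : DGOperad.{0} where
  obj I _ n := Pasc.face I n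
  d {I} _ m n h := AddMonoidHom.mk' (fun x => ⟨Pasc.diff I n x, Pasc.diff_mem h x.2⟩)
    fun x y => Subtype.ext (map_add _ _ _)
  map e n := AddMonoidHom.mk' (fun x => ⟨Pasc.relabel e x, Pasc.map_mem_face _ x.2⟩)
    fun x y => Subtype.ext (map_add _ _ _)
  one := ⟨Pasc.e (), Pasc.mem_face (n := 0) (by
    rw [ExteriorAlgebra.exteriorPower, zero_add, pow_one]; exact ⟨_, rfl⟩)⟩
  comp i m n p h := AddMonoidHom.mk' (fun x => AddMonoidHom.mk'
      (fun y => ⟨Pasc.circ i m x y, Pasc.circ_mem i h x.2 y.2⟩)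
      fun y y' => Subtype.ext (Pasc.circ_add_right i m x.1 y.1 y'.1))
    fun x x' => by ext y; exact Pasc.circ_add_left i m x.1 x'.1 y.1
  d_d h h' x := Subtype.ext (by
    change Pasc.diff _ _ (Pasc.diff _ _ x.1) = 0
    unfold Pasc.diff
    split_ifs
    · exact Pasc.contract_contract _ _
    all_goals simp)
  map_refl x := Subtype.ext (Pasc.relabel_id (fun _ => rfl) x.1)
  map_trans e f n x := Subtype.ext (Pasc.relabel_relabel e f x.1).symm
  map_d e m n h x := Subtype.ext (by
    change Pasc.relabel e (Pasc.diff _ _ x.1) = Pasc.diff _ _ (Pasc.relabel e x.1)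
    unfold Pasc.diff
    split_ifs
    · exact (Pasc.boundary_relabel e x.1).symm
    · simp)
  comp_map e f i m n p h x y := Subtype.ext (Pasc.circ_map e f i m x.1 y.1)
  one_comp h y := Subtype.ext (Pasc.one_circ y.1)
  comp_one i n h x := Subtype.ext (Pasc.circ_one i x.2)
  comp_seq i j _ _ _ _ _ _ hab hbc h₁ h₂ x y z :=
    Subtype.ext (Pasc.circ_seq i j hab x.2 y.2 z.2)
  comp_par hk _ _ _ _ _ _ hab hac h₁ h₂ x y z :=
    Subtype.ext (Pasc.circ_par hk hab hac y.2 z.2)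
  d_comp i _ _ _ _ _ _ h hm hn hp h₁ h₂ x y :=
    Subtype.ext (Pasc.diff_circ i hm hn (hp.trans h.symm) x.2 y.2)

/-! ### The presentation -/

namespace DGOperad

/-- The labels of `x ∘_1 y` for `x, y` with labels `1, 2`: the inputs of `y` keep their labels
and the input `2` of `x` gets the label `3`. (Labels `1, 2, 3` are `0, 1, 2` in `Fin`.) -/
def circOneLabels : {k : Fin 2 // k ≠ 0} ⊕ Fin 2 ≃ Fin 3 where
  toFun := Sum.elim (fun _ => 2) Fin.castSucc
  invFun := ![.inr 0, .inr 1, .inl ⟨1, by decide⟩]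
  left_inv := by decide
  right_inv := by decide

/-- `x ∘_1 y ∈ P({1, 2, 3})` for `x, y ∈ P({1, 2})`. -/
def circOne (P : DGOperad.{v}) {m n p : ℤ} (h : m + n = p) (x : P.obj (Fin 2) m)
    (y : P.obj (Fin 2) n) : P.obj (Fin 3) p :=
  P.map circOneLabels (P.comp 0 h x y)

/-- The action on `P({1, 2, 3})` of the cycle `τ : 3 → 2 → 1 → 3`. -/
def cycle (P : DGOperad.{v}) {n : ℤ} : P.obj (Fin 3) n →+ P.obj (Fin 3) n :=
  P.map (Equiv.subRight (1 : Fin 3))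

/-- `P` is isomorphic, as a differential graded operad, to the quotient of the free operad on the
binary operations `E` by the operadic ideal generated by a set `R` of elements of arity three of
the free operad, via an isomorphism which is `f` on generators. The ideal is the one of the
underlying graded operad; its stability under the differential, needed for the quotient to be a
differential graded operad, is part of the condition. -/
def IsPresentedBy (P : DGOperad.{v}) (E : DGBinaryModule.{u}) (f : ∀ n, E.obj n →+ P.obj (Fin 2) n)
    (R : ∀ n, Set ((freeDGOperad E).obj (Fin 3) n)) : Prop :=
  ∃ hd : ((freeDGOperad E).idealSpan (Fin 3) R).IsDifferential,
  ∃ φ : Iso ((freeDGOperad E).quotient ((freeDGOperad E).idealSpan (Fin 3) R) hd) P,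
    ∀ n x, φ.equiv (Fin 2) n
      ((freeDGOperad E).toQuotient _ hd (Fin 2) n (freeDGOperad.gen E n x)) = f n x

/-- `P` is binary quadratic: it has a presentation by binary generators and relations between
compositions of two generators, i.e. relations in arity three of the free operad. -/
def IsBinaryQuadratic (P : DGOperad.{v}) : Prop :=
  ∃ (E : DGBinaryModule.{v}) (f : ∀ n, E.obj n →+ P.obj (Fin 2) n)
    (R : ∀ n, Set ((freeDGOperad E).obj (Fin 3) n)), P.IsPresentedBy E f R

end DGOperad

namespace Pasc

/-- The elements `e_1` (`i = 0`) and `e_2` (`i = 1`) of `Pasc({1, 2})`. -/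
noncomputable def gen₀ (i : Fin 2) : pasc.binary.obj 0 :=
  ⟨e i, mem_face (n := 0) (by rw [ExteriorAlgebra.exteriorPower, pow_one]; exact ⟨_, rfl⟩)⟩

/-- The element `e_1 ∧ e_2` of `Pasc({1, 2})`. -/
noncomputable def gen₁ : pasc.binary.obj 1 :=
  ⟨e 0 * e 1, mem_face (n := 1) (by
    rw [ExteriorAlgebra.exteriorPower, pow_two]
    exact Submodule.mul_mem_mul ⟨_, rfl⟩ ⟨_, rfl⟩)⟩

/-- The free operad on `Pasc({1, 2})`. -/
noncomputable abbrev Free : DGOperad.{1} := freeDGOperad pasc.binary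

/-- The generator `e_1` of the free operad. -/
noncomputable def e₁ : Free.obj (Fin 2) 0 := freeDGOperad.gen _ 0 (gen₀ 0)

/-- The generator `e_2` of the free operad. -/
noncomputable def e₂ : Free.obj (Fin 2) 0 := freeDGOperad.gen _ 0 (gen₀ 1)

/-- The generator `e_1 ∧ e_2` of the free operad. -/
noncomputable def e₁₂ : Free.obj (Fin 2) 1 := freeDGOperad.gen _ 1 gen₁

/-- The seven relations, as elements of the free operad which have to vanish. -/
inductive Relations : ∀ n : ℤ, Free.obj (Fin 3) n → Prop
  /-- `e_1 ∘_1 e_1 = τ² (e_2 ∘_1 e_1)` -/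
  | rel₁ : Relations 0 (Free.circOne (add_zero 0) e₁ e₁ -
      Free.cycle (Free.cycle (Free.circOne (add_zero 0) e₂ e₁)))
  /-- `e_2 ∘_1 e_1 = e_2 ∘_1 e_2` -/
  | rel₂ : Relations 0 (Free.circOne (add_zero 0) e₂ e₁ - Free.circOne (add_zero 0) e₂ e₂)
  /-- `e_1 ∘_1 e_2 = τ (e_2 ∘_1 e_2)` -/
  | rel₃ : Relations 0 (Free.circOne (add_zero 0) e₁ e₂ -
      Free.cycle (Free.circOne (add_zero 0) e₂ e₂))
  /-- `e_2 ∘_1 (e_1 ∧ e_2) = 0` -/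
  | rel₄ : Relations 1 (Free.circOne (zero_add 1) e₂ e₁₂)
  /-- `τ ((e_1 ∧ e_2) ∘_1 e_2) = e_1 ∘_1 (e_1 ∧ e_2)` -/
  | rel₅ : Relations 1 (Free.cycle (Free.circOne (add_zero 1) e₁₂ e₂) -
      Free.circOne (zero_add 1) e₁ e₁₂)
  /-- `-τ² ((e_1 ∧ e_2) ∘_1 e_1) = e_1 ∘_1 (e_1 ∧ e_2)` -/
  | rel₆ : Relations 1 (-Free.cycle (Free.cycle (Free.circOne (add_zero 1) e₁₂ e₁)) -
      Free.circOne (zero_add 1) e₁ e₁₂)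
  /-- `(e_1 ∧ e_2) ∘_1 (e_1 ∧ e_2) = τ ((e_1 ∧ e_2) ∘_1 (e_1 ∧ e_2))` -/
  | rel₇ : Relations 2 (Free.circOne (one_add_one_eq_two) e₁₂ e₁₂ -
      Free.cycle (Free.circOne (one_add_one_eq_two) e₁₂ e₁₂))

end Pasc

/-!
The seven relations hold in Pasc, and their differentials are combinations of relations, so the
ideal is differential and the free operad modulo the relations maps to Pasc. To see that this map is
bijective, let `P` be the quotient.

*Rewriting.* Write `adjoin g x` for `g ∘_1 x` with `g` a generator: it has the labels of `x` and one
new label `∗`, which is attached to the root. The relations show that the span of the compositions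
`g ∘_1 g'` in `P({1, 2, 3})` is stable under the cycle `τ` (`Pasc.Presentation.cycle_mem`), so that
any input of a composition of two generators can be moved to the root. By associativity this extends
to all operations (`DGOperad.mem_rooted`): for nonempty `K`, each element of `P(K ⊔ {∗})` is of the
form `adjoin e₁ y + adjoin e₁₂ z + adjoin e₂ w` with `y`, `z`, `w` in `P(K)`
(`Pasc.Presentation.exists_eq_adjoin_add`). Moreover `P(∅) = 0`, and `P({∗})` is spanned by the
unit.

*Injectivity.* In Pasc, the three summands are `y`, `-e_∗ ∧ z` and `aug(w) e_∗`
(`Pasc.toEx_adjoin_of_eq_e_zero` and the two lemmas after it). If their sum vanishes in Pasc, then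
so do `y`, `z` and `aug(w)`, hence `y = z = 0` by induction on the number of labels, and it remains
to see that `adjoin e₂ w = 0` if `aug(w) = 0`. This is `Pasc.Presentation.adjoin_e₂_eq_zero`, again
by induction, using that `adjoin e₂ (adjoin e₁₂ x) = 0` and that `adjoin e₂ (adjoin e₁ x)` and
`adjoin e₂ (adjoin e₂ x)` are both equal to `adjoin e₁ (adjoin e₂ x)` with the new labels exchanged.

*Surjectivity* (`Pasc.Presentation.exists_val_eq`) follows by induction from the decomposition of
an element of `Ex(K ⊔ {∗})` according to the occurrence of `e_∗`.
-/

/-! ### Operads generated by binary operations -/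

namespace OperadLabels

/-- The labels of `g ∘_1 x` for a binary operation `g`: those of `x`, and a new one for the
input `2` of `g`. -/
def adjoin (K : Type) : {k : Fin 2 // k ≠ 0} ⊕ K ≃ Option K where
  toFun
    | .inl _ => none
    | .inr k => some k
  invFun
    | none => .inl ⟨1, by decide⟩
    | some k => .inr k
  left_inv := by
    rintro (⟨k, hk⟩ | k)
    · obtain rfl : k = 1 := by omega
      rfl
    · rfl
  right_inv := by rintro (_ | k) <;> rfl

end OperadLabels

namespace DGOperad

section

variable (P : DGOperad.{v})

theorem comp_map_left {I J I' : Type} [Finite I] [Finite J] [Finite I'] (e : I ≃ I') (i : I)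
    {m n p : ℤ} (h : m + n = p) (x : P.obj I m) (y : P.obj J n) :
    P.comp (e i) h (P.map e x) y =
      P.map (OperadLabels.congr e (Equiv.refl J) i) (P.comp i h x y) := by
  rw [← P.comp_map, P.map_refl]

theorem comp_map_right {I J J' : Type} [Finite I] [Finite J] [Finite J'] (f : J ≃ J') (i : I)
    {m n p : ℤ} (h : m + n = p) (x : P.obj I m) (y : P.obj J n) :
    P.comp i h x (P.map f y) =
      P.map (Equiv.sumCongr (Equiv.refl {k : I // k ≠ i}) f) (P.comp i h x y) := by
  have h1 := P.comp_map (Equiv.refl I) f i h x y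
  rw [P.map_refl] at h1
  exact h1

theorem map_symm_map {I J : Type} [Finite I] [Finite J] (e : I ≃ J) {n : ℤ} (x : P.obj I n) :
    P.map e.symm (P.map e x) = x := by
  rw [← P.map_trans, Equiv.self_trans_symm, P.map_refl]

theorem map_map_symm {I J : Type} [Finite I] [Finite J] (e : I ≃ J) {n : ℤ} (x : P.obj J n) :
    P.map e (P.map e.symm x) = x := by
  rw [← P.map_trans, Equiv.symm_trans_self, P.map_refl]

theorem comp_comp {I J K : Type} [Finite I] [Finite J] [Finite K] (i : I) (j : J)
    {a b c ab bc abc : ℤ} (hab : a + b = ab) (hbc : b + c = bc) (h₁ : ab + c = abc)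
    (h₂ : a + bc = abc) (x : P.obj I a) (y : P.obj J b) (z : P.obj K c) :
    P.comp (.inr j) h₁ (P.comp i hab x y) z =
      P.map (OperadLabels.seq K i j).symm (P.comp i h₂ x (P.comp j hbc y z)) := by
  rw [← P.comp_seq i j hab hbc h₁ h₂, map_symm_map]

theorem map_one_comp {I J : Type} [Finite I] [Finite J] (e : Unit ≃ I) {n : ℤ} (h : 0 + n = n)
    (y : P.obj J n) : P.comp (e ()) h (P.map e P.one) y =
      P.map ((OperadLabels.unitLeft J).symm.trans (OperadLabels.congr e (Equiv.refl J) ())) y := by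
  rw [comp_map_left, P.map_trans]
  congr 1
  conv_rhs => rw [← P.one_comp h y, map_symm_map]

theorem comp_one_eq {I : Type} [Finite I] (i : I) {n : ℤ} (h : n + 0 = n) (x : P.obj I n) :
    P.comp i h x P.one = P.map (OperadLabels.unitRight i).symm x := by
  conv_rhs => rw [← P.comp_one i h x, map_symm_map]

/-- The unit is a cycle, by the Leibniz rule for `1 ∘ 1`. -/
theorem d_one {n : ℤ} (h : n + 1 = 0) : P.d h P.one = 0 := by
  have h1 := P.d_comp () (zero_add 0) h h h (add_zero n) (zero_add n) P.one P.one
  rw [Int.negOnePow_zero, one_smul] at h1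
  have h2 := congrArg (P.map (OperadLabels.unitLeft Unit)) h1
  have h3 : OperadLabels.unitLeft Unit = OperadLabels.unitRight () := Equiv.ext fun _ => rfl
  rw [P.map_d, P.one_comp, map_add, P.one_comp, h3, P.comp_one] at h2
  simpa using h2

/-- The composition `g ∘_1 x` of a binary operation with `x`, where `none` is the label of the
input `2` of `g`. -/
def adjoin {K : Type} [Finite K] {m n p : ℤ} (h : m + n = p) :
    P.obj (Fin 2) m →+ P.obj K n →+ P.obj (Option K) p :=
  (P.comp 0 h).compr₂ (P.map (OperadLabels.adjoin K))

theorem adjoin_apply {K : Type} [Finite K] {m n p : ℤ} (h : m + n = p) (g : P.obj (Fin 2) m)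
    (x : P.obj K n) : P.adjoin h g x = P.map (OperadLabels.adjoin K) (P.comp 0 h g x) := rfl

theorem comp_zero_eq_map_adjoin {K : Type} [Finite K] {m n p : ℤ} (h : m + n = p)
    (g : P.obj (Fin 2) m) (x : P.obj K n) :
    P.comp 0 h g x = P.map (OperadLabels.adjoin K).symm (P.adjoin h g x) :=
  (P.map_symm_map _ _).symm

theorem map_adjoin {K L : Type} [Finite K] [Finite L] (e : K ≃ L) {m n p : ℤ} (h : m + n = p)
    (g : P.obj (Fin 2) m) (x : P.obj K n) :
    P.map (Equiv.optionCongr e) (P.adjoin h g x) = P.adjoin h g (P.map e x) := by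
  rw [adjoin_apply, adjoin_apply, comp_map_right, ← P.map_trans, ← P.map_trans]
  have h1 : (OperadLabels.adjoin K).trans (Equiv.optionCongr e) =
      (Equiv.sumCongr (Equiv.refl _) e).trans (OperadLabels.adjoin L) := by
    ext (⟨k, hk⟩ | k) : 1 <;> rfl
  rw [h1]

variable (G : ∀ n : ℤ, AddSubgroup (P.obj (Fin 2) n))

/-- The elements of the form `g(y, j)` with `g` in `G`, together with the relabelled unit in case
that `j` is the only label. In terms of trees: the input `j` is attached to the root. -/
inductive IsRooted {J : Type} [Finite J] (j : J) : ∀ {n : ℤ}, P.obj J n → Prop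
  | unit (e : Unit ≃ J) (he : e () = j) : IsRooted j (P.map e P.one)
  | adjoin {K : Type} [Finite K] (e : Option K ≃ J) (he : e none = j) {m n p : ℤ} (h : m + n = p)
      {g : P.obj (Fin 2) m} (hg : g ∈ G m) (y : P.obj K n) : IsRooted j (P.map e (P.adjoin h g y))

/-- The span of the elements with the input `j` attached to the root. -/
def rooted {J : Type} [Finite J] (j : J) (n : ℤ) : AddSubgroup (P.obj J n) :=
  AddSubgroup.closure {x | P.IsRooted G j x}

/-- The span of the compositions `g ∘_1 g'` in arity three. -/
def circOneSpan (n : ℤ) : AddSubgroup (P.obj (Fin 3) n) :=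
  AddSubgroup.closure {t | ∃ (a b : ℤ) (h : a + b = n), ∃ g ∈ G a, ∃ g' ∈ G b,
    t = P.circOne h g g'}

variable {P G}

theorem map_mem_rooted {I J : Type} [Finite I] [Finite J] (e : I ≃ J) {i : I} {j : J}
    (hj : e i = j) {n : ℤ} {x : P.obj I n} (hx : x ∈ P.rooted G i n) :
    P.map e x ∈ P.rooted G j n := by
  subst hj
  refine (AddSubgroup.closure_le (K := (P.rooted G (e i) n).comap (P.map e))).2 ?_ hx
  rintro x (⟨f, rfl⟩ | ⟨f, rfl, h, hg, y⟩)
  · exact AddSubgroup.subset_closure (P.map_trans f e P.one ▸ .unit (f.trans e) rfl)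
  · exact AddSubgroup.subset_closure
      (P.map_trans f e (P.adjoin h _ y) ▸ .adjoin (f.trans e) rfl h hg y)

theorem adjoin_mem_rooted {K : Type} [Finite K] {m n p : ℤ} (h : m + n = p)
    {g : P.obj (Fin 2) m} (hg : g ∈ G m) (y : P.obj K n) :
    P.adjoin h g y ∈ P.rooted G none p := by
  rw [← P.map_refl (P.adjoin h g y)]
  exact AddSubgroup.subset_closure (.adjoin (Equiv.refl _) rfl h hg y)

theorem comp_zero_mem_rooted {K : Type} [Finite K] {m n p : ℤ} (h : m + n = p)
    {g : P.obj (Fin 2) m} (hg : g ∈ G m) (y : P.obj K n) :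
    P.comp 0 h g y ∈ P.rooted G (.inl ⟨1, one_ne_zero⟩) p := by
  rw [comp_zero_eq_map_adjoin]
  exact map_mem_rooted (OperadLabels.adjoin K).symm (i := none) rfl (adjoin_mem_rooted h hg y)

theorem comp_map_mem_rooted {I J I' J' : Type} [Finite I] [Finite J] [Finite I'] [Finite J']
    (e : I ≃ I') (f : J ≃ J') {i : I} {i' : I'} (hi : e i = i') {m n p : ℤ} (h : m + n = p)
    {x : P.obj I m} {y : P.obj J n} (j : {k : I // k ≠ i} ⊕ J) {j' : {k : I' // k ≠ i'} ⊕ J'}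
    (hj : Sum.map (fun k => e k.1) f j = Sum.map Subtype.val id j')
    (hx : P.comp i h x y ∈ P.rooted G j p) :
    P.comp i' h (P.map e x) (P.map f y) ∈ P.rooted G j' p := by
  subst hi
  rw [P.comp_map]
  refine map_mem_rooted _ ?_ hx
  refine (Subtype.val_injective.sumMap Function.injective_id) ?_
  rw [← hj]
  rcases j with k | k <;> rfl

theorem comp_map_left_mem_rooted {I J I' : Type} [Finite I] [Finite J] [Finite I']
    (e : I ≃ I') {i : I} {i' : I'} (hi : e i = i') {m n p : ℤ} (h : m + n = p)
    {x : P.obj I m} {y : P.obj J n} (j : {k : I // k ≠ i} ⊕ J) {j' : {k : I' // k ≠ i'} ⊕ J}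
    (hj : Sum.map (fun k => e k.1) id j = Sum.map Subtype.val id j')
    (hx : P.comp i h x y ∈ P.rooted G j p) :
    P.comp i' h (P.map e x) y ∈ P.rooted G j' p := by
  rw [← P.map_refl y]
  exact comp_map_mem_rooted e (Equiv.refl J) hi h j hj hx

/-- Composing at an input of the subtree `y` of `g(y, j)` keeps `j` attached to the root. -/
theorem comp_comp_mem_rooted {J K : Type} [Finite J] [Finite K] (j : J) {a b c ab abc : ℤ}
    (hab : a + b = ab) (h₁ : ab + c = abc) {g : P.obj (Fin 2) a} (hg : g ∈ G a) (y : P.obj J b)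
    (z : P.obj K c) : P.comp (.inr j) h₁ (P.comp 0 hab g y) z ∈
      P.rooted G (.inl ⟨.inl ⟨1, one_ne_zero⟩, Sum.inl_ne_inr⟩) abc := by
  rw [comp_comp P 0 j hab rfl h₁ (by omega)]
  exact map_mem_rooted (OperadLabels.seq K (0 : Fin 2) j).symm (i := .inl ⟨1, one_ne_zero⟩) rfl
    (comp_zero_mem_rooted _ hg _)

/-- For `t` in the span of the `g ∘_1 g'`, the input `3` of `t` is attached to the root, and this
remains so after compositions at the inputs `1` and `2`. -/
theorem comp_mem_rooted_of_mem_circOneSpan {K L : Type} [Finite K] [Finite L] {p a b q r : ℤ}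
    {t : P.obj (Fin 3) p} (ht : t ∈ P.circOneSpan G p) (h₁ : p + b = q) (h₂ : q + a = r)
    (x : P.obj K a) (y : P.obj L b) :
    P.comp (.inl ⟨0, zero_ne_one⟩ : {k : Fin 3 // k ≠ 1} ⊕ L) h₂ (P.comp 1 h₁ t y) x ∈
      P.rooted G (.inl ⟨.inl ⟨2, by decide⟩, by simp⟩) r := by
  let F : P.obj (Fin 3) p →+
      P.obj ({a : {k : Fin 3 // k ≠ 1} ⊕ L // a ≠ .inl ⟨0, zero_ne_one⟩} ⊕ K) r :=
    ((P.comp (.inl ⟨0, zero_ne_one⟩ : {k : Fin 3 // k ≠ 1} ⊕ L) h₂).flip x).comp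
      ((P.comp 1 h₁).flip y)
  refine (AddSubgroup.closure_le (K := AddSubgroup.comap F
    (P.rooted G (.inl ⟨.inl ⟨2, by decide⟩, by simp⟩) r))).2 ?_ ht
  rintro _ ⟨m, n, h, g, hg, g', hg', rfl⟩
  have h3 : P.comp 1 h₁ (P.circOne h g g') y =
      P.map ((OperadLabels.seq L (0 : Fin 2) (1 : Fin 2)).symm.trans
        (OperadLabels.congr circOneLabels (Equiv.refl L) (.inr 1)))
        (P.comp 0 (by omega) g (P.comp 1 rfl g' y)) := by
    rw [P.map_trans, ← comp_comp P 0 1 h rfl h₁]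
    exact comp_map_left P circOneLabels (.inr 1) h₁ (P.comp 0 h g g') y
  change P.comp (.inl ⟨0, zero_ne_one⟩ : {k : Fin 3 // k ≠ 1} ⊕ L) h₂
    (P.comp 1 h₁ (P.circOne h g g') y) x ∈ P.rooted G (.inl ⟨.inl ⟨2, by decide⟩, by simp⟩) r
  rw [h3]
  have h4 := comp_comp_mem_rooted (.inl ⟨0, zero_ne_one⟩ : {k : Fin 2 // k ≠ 1} ⊕ L)
    (by omega : m + (n + b) = q) h₂ hg (P.comp 1 rfl g' y) x
  refine comp_map_left_mem_rooted _ ?_ _ _ ?_ h4 <;> rfl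

theorem comp_map_mem_rooted_of_mem_circOneSpan {I K L : Type} [Finite I] [Finite K] [Finite L]
    {p a b q r : ℤ} {t : P.obj (Fin 3) p} (ht : t ∈ P.circOneSpan G p) (e : Fin 3 ≃ I)
    {i j k : I} (hi : e 0 = i) (hj : e 1 = j) (hk : e 2 = k) (hij : i ≠ j) (hkj : k ≠ j)
    (hki : (Sum.inl ⟨k, hkj⟩ : {l : I // l ≠ j} ⊕ L) ≠ .inl ⟨i, hij⟩) (h₁ : p + b = q)
    (h₂ : q + a = r) (x : P.obj K a) (y : P.obj L b) :
    P.comp (.inl ⟨i, hij⟩) h₂ (P.comp j h₁ (P.map e t) y) x ∈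
      P.rooted G (.inl ⟨.inl ⟨k, hkj⟩, hki⟩) r := by
  subst hi hj hk
  rw [comp_map_left]
  have h3 := comp_mem_rooted_of_mem_circOneSpan ht h₁ h₂ x y
  refine comp_map_left_mem_rooted _ ?_ _ _ ?_ h3 <;> rfl

/-- Compositions of generators at the input `2` are compositions at the input `1` up to relabelling,
and stability under `cycle` allows the label `3` of `t` to be put on an input of the inner
generator. -/
theorem exists_comp_one_eq (hswap : ∀ (σ : Equiv.Perm (Fin 2)) n, ∀ g ∈ G n, P.map σ g ∈ G n)
    (hτ : ∀ n, ∀ t ∈ P.circOneSpan G n, P.cycle t ∈ P.circOneSpan G n) {m n p : ℤ} (h : m + n = p)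
    {g : P.obj (Fin 2) m} (hg : g ∈ G m) {g' : P.obj (Fin 2) n} (hg' : g' ∈ G n) :
    ∃ t ∈ P.circOneSpan G p, ∃ e : Fin 3 ≃ {k : Fin 2 // k ≠ 1} ⊕ Fin 2,
      e 0 = .inl ⟨0, zero_ne_one⟩ ∧ e 1 = .inr 0 ∧ e 2 = .inr 1 ∧ P.comp 1 h g g' = P.map e t := by
  have ht : P.circOne h (P.map (Equiv.swap 0 1) g) g' ∈ P.circOneSpan G p :=
    AddSubgroup.subset_closure ⟨_, _, h, _, hswap _ _ _ hg, _, hg', rfl⟩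
  have h1 : P.comp 1 h g g' = P.map (circOneLabels.symm.trans
      (OperadLabels.congr (Equiv.swap 0 1) (Equiv.refl _) 0))
      (P.circOne h (P.map (Equiv.swap 0 1) g) g') := by
    rw [P.map_trans, circOne, map_symm_map, ← comp_map_left, ← P.map_trans]
    congr 2
    simp [P.map_refl]
  -- The label `3` of `circOne` is on the outer generator; applying `τ` twice moves it to the second
  -- input of the inner one.
  refine ⟨_, hτ _ _ (hτ _ _ ht), (Equiv.subRight (1 : Fin 3)).trans (circOneLabels.symm.trans
      (OperadLabels.congr (Equiv.swap 0 1) (Equiv.refl _) 0)), ?_, ?_, ?_, ?_⟩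
  · decide
  · decide
  · decide
  · rw [h1, P.map_trans (Equiv.subRight _)]
    congr 1
    simp only [cycle]
    rw [← P.map_trans, ← P.map_trans]
    exact (P.map_refl _).symm.trans (by congr 2; decide)

/-- In the composition of `g(x, ∗)` at `∗` with `g'(y, j)`, the input `j` can be moved to the root:
this is `g ∘_2 g'` composed with `x` and `y` at its first two inputs. -/
theorem comp_adjoin_adjoin_mem_rooted
    (hswap : ∀ (σ : Equiv.Perm (Fin 2)) n, ∀ g ∈ G n, P.map σ g ∈ G n)
    (hτ : ∀ n, ∀ t ∈ P.circOneSpan G n, P.cycle t ∈ P.circOneSpan G n) {K L : Type} [Finite K]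
    [Finite L] {m a m' b p q r : ℤ} (h : m + a = p) (h' : m' + b = q) (h₁ : p + q = r)
    {g : P.obj (Fin 2) m} (hg : g ∈ G m) {g' : P.obj (Fin 2) m'} (hg' : g' ∈ G m')
    (x : P.obj K a) (y : P.obj L b) :
    P.comp none h₁ (P.adjoin h g x) (P.adjoin h' g' y) ∈ P.rooted G (.inr none) r := by
  obtain ⟨t, ht, e, he0, he1, he2, het⟩ :=
    exists_comp_one_eq hswap hτ (rfl : m + m' = m + m') hg hg'
  have h2 : P.comp 1 (rfl : m + q = m + q) g (P.comp 0 h' g' y) =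
      P.map (OperadLabels.seq L (1 : Fin 2) (0 : Fin 2))
        (P.comp (.inr 0) (by omega) (P.map e t) y) := by
    rw [← het, P.comp_seq 1 0 rfl h']
  have h3 : P.comp (.inl ⟨0, zero_ne_one⟩ : {k : Fin 2 // k ≠ 1} ⊕ _) (by omega : m + q + a = r)
      (P.comp 1 rfl g (P.comp 0 h' g' y)) x ∈
        P.rooted G (.inl ⟨.inr (.inl ⟨1, one_ne_zero⟩), Sum.inr_ne_inl⟩) r := by
    rw [h2]
    have h6 := comp_map_mem_rooted_of_mem_circOneSpan ht e he0 he1 he2 Sum.inl_ne_inr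
      (fun h => one_ne_zero (Sum.inr_injective h))
      (fun h => Sum.inr_ne_inl (congrArg Subtype.val (Sum.inl_injective h)))
      (by omega : m + m' + b = m + q) (by omega : m + q + a = r) x y
    refine comp_map_left_mem_rooted _ ?_ _ _ ?_ h6 <;> rfl
  have h4 : P.comp (.inl ⟨1, one_ne_zero⟩ : {k : Fin 2 // k ≠ 0} ⊕ _) h₁ (P.comp 0 h g x)
      (P.comp 0 h' g' y) ∈ P.rooted G (.inr (.inl ⟨1, one_ne_zero⟩)) r := by
    have h5 := P.comp_par (i := (0 : Fin 2)) (k := 1) one_ne_zero h rfl h₁ (by omega) g x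
      (P.comp 0 h' g' y)
    rw [← P.map_symm_map (OperadLabels.par K _ one_ne_zero) (P.comp _ h₁ (P.comp 0 h g x) _), h5]
    rw [Units.smul_def]
    refine map_mem_rooted _ ?_ (zsmul_mem h3 _)
    rfl
  refine comp_map_mem_rooted (OperadLabels.adjoin K) (OperadLabels.adjoin L) ?_ h₁ _ ?_ h4 <;> rfl

end
end DGOperad

namespace DGOperad

section

variable {P : DGOperad.{v}} {G : ∀ n : ℤ, AddSubgroup (P.obj (Fin 2) n)}

theorem comp_some_adjoin_mem_rooted {J K : Type} [Finite J] [Finite K] (j : J)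
    {a b c ab abc : ℤ} (hab : a + b = ab) (h₁ : ab + c = abc) {g : P.obj (Fin 2) a} (hg : g ∈ G a)
    (y : P.obj J b) (z : P.obj K c) : P.comp (some j) h₁ (P.adjoin hab g y) z ∈
      P.rooted G (.inl ⟨none, Option.some_ne_none j |>.symm⟩) abc := by
  have h := comp_comp_mem_rooted j hab h₁ hg y z
  refine comp_map_left_mem_rooted (OperadLabels.adjoin J) ?_ _ _ ?_ h <;> rfl

theorem comp_map_one_mem_rooted {I J : Type} [Finite I] [Finite J] {i : I} {m n : ℤ}
    (h : m + 0 = n) (e : Unit ≃ J) {x : P.obj I m} (hx : x ∈ P.rooted G i m) :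
    P.comp i h x (P.map e P.one) ∈ P.rooted G (.inr (e ())) n := by
  obtain rfl := (add_zero _).symm.trans h
  rw [comp_map_right, comp_one_eq]
  have h1 := map_mem_rooted (OperadLabels.unitRight i).symm (j := .inr ())
    ((Equiv.symm_apply_eq _).2 rfl) hx
  refine map_mem_rooted _ ?_ h1
  rfl

theorem comp_none_adjoin_mem_rooted
    (hswap : ∀ (σ : Equiv.Perm (Fin 2)) n, ∀ g ∈ G n, P.map σ g ∈ G n)
    (hτ : ∀ n, ∀ t ∈ P.circOneSpan G n, P.cycle t ∈ P.circOneSpan G n) {K J : Type} [Finite K]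
    [Finite J] {a b m n p : ℤ} (h' : a + b = m) (h : m + n = p) {g : P.obj (Fin 2) a}
    (hg : g ∈ G a) (x : P.obj K b) {l : J} {y : P.obj J n} (hy : y ∈ P.rooted G l n) :
    P.comp none h (P.adjoin h' g x) y ∈ P.rooted G (.inr l) p := by
  refine (AddSubgroup.closure_le (K := (P.rooted G (.inr l) p).comap
    (P.comp none h (P.adjoin h' g x)))).2 ?_ hy
  rintro _ (⟨f, rfl⟩ | ⟨f, rfl, h'', hg', y⟩)
  · exact comp_map_one_mem_rooted h f (adjoin_mem_rooted h' hg x)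
  · have h3 := comp_adjoin_adjoin_mem_rooted hswap hτ h' h'' h hg hg' x y
    have h4 := comp_map_mem_rooted (i' := none) (j' := .inr (f none)) (Equiv.refl (Option K)) f rfl
      h _ rfl h3
    rwa [P.map_refl] at h4

theorem comp_mem_rooted (hswap : ∀ (σ : Equiv.Perm (Fin 2)) n, ∀ g ∈ G n, P.map σ g ∈ G n)
    (hτ : ∀ n, ∀ t ∈ P.circOneSpan G n, P.cycle t ∈ P.circOneSpan G n) {I J : Type} [Finite I]
    [Finite J] (i : I) {m n p : ℤ} (h : m + n = p) {x : P.obj I m} {y : P.obj J n}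
    (hx : ∀ k, x ∈ P.rooted G k m) (hy : ∀ l, y ∈ P.rooted G l n) (j : {k : I // k ≠ i} ⊕ J) :
    P.comp i h x y ∈ P.rooted G j p := by
  rcases j with ⟨k, hk⟩ | l
  · refine (AddSubgroup.closure_le (K := (P.rooted G (.inl ⟨k, hk⟩) p).comap
      ((P.comp i h).flip y))).2 ?_ (hx k)
    rintro _ (⟨f, rfl⟩ | ⟨f, rfl, h', hg, x⟩)
    · obtain ⟨a, rfl⟩ := f.surjective i
      exact (hk rfl).elim
    · obtain ⟨a | a, rfl⟩ := f.surjective i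
      · exact (hk rfl).elim
      · have h3 := comp_some_adjoin_mem_rooted a h' h hg x y
        refine comp_map_left_mem_rooted f ?_ h _ ?_ h3 <;> rfl
  · refine (AddSubgroup.closure_le (K := (P.rooted G (.inr l) p).comap
      ((P.comp i h).flip y))).2 ?_ (hx i)
    rintro _ (⟨f, rfl⟩ | ⟨f, rfl, h', hg, x⟩)
    · obtain rfl := (zero_add _).symm.trans h
      change P.comp (f ()) h (P.map f P.one) y ∈ P.rooted G (.inr l) _
      rw [map_one_comp]
      refine map_mem_rooted _ ?_ (hy l)
      rfl
    · have h3 := comp_none_adjoin_mem_rooted hswap hτ h' h hg x (hy l)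
      refine comp_map_left_mem_rooted f ?_ h _ ?_ h3 <;> rfl

theorem d_mem_rooted (hd : ∀ {m n} (h : n + 1 = m), ∀ g ∈ G m, P.d h g ∈ G n) {J : Type}
    [Finite J] {j : J} {m n : ℤ} (h : n + 1 = m) {x : P.obj J m} (hx : x ∈ P.rooted G j m) :
    P.d h x ∈ P.rooted G j n := by
  refine (AddSubgroup.closure_le (K := (P.rooted G j n).comap (P.d h))).2 ?_ hx
  rintro _ (⟨f, rfl⟩ | ⟨f, rfl, h', hg, x⟩)
  · change P.d h (P.map f P.one) ∈ P.rooted G (f ()) _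
    rw [← P.map_d, d_one, map_zero (P.map f)]
    exact zero_mem _
  · change P.d h (P.map f (P.adjoin h' _ x)) ∈ P.rooted G (f none) _
    rw [← P.map_d]
    refine map_mem_rooted f rfl ?_
    rw [adjoin_apply, ← P.map_d,
      P.d_comp 0 h' (sub_add_cancel _ _) (sub_add_cancel _ _) h (by omega) (by omega), map_add,
      Units.smul_def, map_zsmul, ← adjoin_apply, ← adjoin_apply]
    exact add_mem (adjoin_mem_rooted _ (hd _ _ hg) _)
      (zsmul_mem (adjoin_mem_rooted _ hg _) _)

theorem mem_rooted_of_mem (hswap : ∀ (σ : Equiv.Perm (Fin 2)) n, ∀ g ∈ G n, P.map σ g ∈ G n)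
    {n : ℤ} {g : P.obj (Fin 2) n} (hg : g ∈ G n) (j : Fin 2) : g ∈ P.rooted G j n := by
  have key : ∀ g ∈ G n, g ∈ P.rooted G 1 n := by
    intro g hg
    rw [← P.comp_one 0 (add_zero n) g]
    refine map_mem_rooted _ ?_ (comp_zero_mem_rooted _ hg _)
    rfl
  fin_cases j
  · have h := map_mem_rooted (Equiv.swap (0 : Fin 2) 1) (i := 1) (j := 0) rfl
      (key _ (hswap (Equiv.swap 0 1) n g hg))
    rw [← P.map_trans, show (Equiv.swap (0 : Fin 2) 1).trans (Equiv.swap 0 1) = Equiv.refl _ from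
      Equiv.swap_swap 0 1, P.map_refl] at h
    exact h
  · exact key g hg

variable (P G) in
/-- The only suboperad containing the binary operations `G` is `P`. -/
def IsGeneratedBy : Prop :=
  ∀ W : ∀ (I : Type) [Finite I] (n : ℤ), AddSubgroup (P.obj I n),
    (∀ n, G n ≤ W (Fin 2) n) → P.one ∈ W Unit 0 →
    (∀ {I : Type} [Finite I] {m n : ℤ} (h : n + 1 = m), ∀ x ∈ W I m, P.d h x ∈ W I n) →
    (∀ {I J : Type} [Finite I] [Finite J] (e : I ≃ J) {n : ℤ}, ∀ x ∈ W I n, P.map e x ∈ W J n) →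
    (∀ {I J : Type} [Finite I] [Finite J] (i : I) {m n p : ℤ} (h : m + n = p),
      ∀ x ∈ W I m, ∀ y ∈ W J n, P.comp i h x y ∈ W _ p) →
    ∀ (I : Type) [Finite I] (n : ℤ) (x : P.obj I n), x ∈ W I n

/-- If compositions of two generators can be rewritten so that a given input is attached to the
root, then this is so for all operations. -/
theorem mem_rooted (hswap : ∀ (σ : Equiv.Perm (Fin 2)) n, ∀ g ∈ G n, P.map σ g ∈ G n)
    (hd : ∀ {m n} (h : n + 1 = m), ∀ g ∈ G m, P.d h g ∈ G n)
    (hτ : ∀ n, ∀ t ∈ P.circOneSpan G n, P.cycle t ∈ P.circOneSpan G n) (hG : P.IsGeneratedBy G)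
    {J : Type} [Finite J] (j : J) {n : ℤ} (x : P.obj J n) : x ∈ P.rooted G j n := by
  have h := hG (fun J _ n => ⨅ j, P.rooted G j n)
    (fun n g hg => AddSubgroup.mem_iInf.2 fun j => mem_rooted_of_mem hswap hg j)
    (AddSubgroup.mem_iInf.2 fun j => AddSubgroup.subset_closure
      (by rw [← P.map_refl P.one]; exact .unit _ rfl))
    (fun h x hx => AddSubgroup.mem_iInf.2 fun j => d_mem_rooted hd h (AddSubgroup.mem_iInf.1 hx j))
    (fun e n x hx => AddSubgroup.mem_iInf.2 fun j =>
      map_mem_rooted e (e.apply_symm_apply j) (AddSubgroup.mem_iInf.1 hx _))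
    (fun i _ _ _ h x hx y hy => AddSubgroup.mem_iInf.2 fun j => comp_mem_rooted hswap hτ i h
      (AddSubgroup.mem_iInf.1 hx) (AddSubgroup.mem_iInf.1 hy) j)
  exact AddSubgroup.mem_iInf.1 (h J n x) j

theorem eq_zero_of_isEmpty (hG : P.IsGeneratedBy G) {J : Type} [Finite J] [hJ : IsEmpty J] {n : ℤ}
    (x : P.obj J n) : x = 0 := by
  let W : ∀ (I : Type) [Finite I] (n : ℤ), AddSubgroup (P.obj I n) := fun I _ n =>
    ⨅ _ : IsEmpty I, ⊥
  have hW : ∀ {I : Type} [Finite I] {n : ℤ} {x : P.obj I n}, x ∈ W I n ↔ (IsEmpty I → x = 0) := by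
    simp [W, AddSubgroup.mem_iInf]
  -- A composition `x ∘_i y` without inputs has a factor `y` without inputs.
  refine hW.1 (hG W ?_ ?_ ?_ ?_ ?_ J n x) hJ
  · exact fun n g _ => hW.2 fun h => h.elim 0
  · exact hW.2 fun h => h.elim ()
  · exact fun h x hx => hW.2 fun hI => by rw [hW.1 hx hI, map_zero]
  · exact fun e n x hx => hW.2 fun hI => by rw [hW.1 hx e.isEmpty, map_zero]
  · exact fun i _ _ _ h x hx y hy => hW.2 fun hI => by
      rw [hW.1 hy ⟨fun j => hI.elim (.inr j)⟩, map_zero]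

end
end DGOperad

/-! ### Decompositions in the exterior algebra -/

namespace Pasc

theorem e_mul_self {I : Type} (i : I) : e i * e i = 0 := ExteriorAlgebra.ι_sq_zero _

theorem θ_e_self {I : Type} (i : I) : θ i (e i) = 1 := by
  simp [θ, e, contract]

theorem θ_e_ne {I : Type} {i j : I} (h : j ≠ i) : θ i (e j) = 0 := by
  simp [θ, e, contract, h]

theorem θ_e_mul {I : Type} (i : I) (x : Ex I) : θ i (e i * x) = x - e i * θ i x := by
  have h := contract_ι_mul (Finsupp.lapply i) (Finsupp.single i (1 : ℤ)) x
  rwa [Finsupp.lapply_apply, Finsupp.single_eq_same, one_smul] at h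

/-- The morphism `Ex(K ⊔ {∗}) → Ex(K)` which sends `e_∗` to `0` and the other generators to
themselves. -/
noncomputable def forget (K : Type) : Ex (Option K) →ₐ[ℤ] Ex K :=
  ExteriorAlgebra.map (Finsupp.lcomapDomain some (Option.some_injective K))

theorem forget_e_none (K : Type) : forget K (e none) = 0 := by
  have h : Finsupp.lcomapDomain (R := ℤ) (M := ℤ) some (Option.some_injective K)
      (Finsupp.single none 1) = 0 := by
    ext; simp [Finsupp.lcomapDomain]
  rw [forget, e, ExteriorAlgebra.map_apply_ι, h, map_zero]

theorem forget_e_some {K : Type} (k : K) : forget K (e (some k)) = e k := by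
  classical
  have h : Finsupp.lcomapDomain (R := ℤ) (M := ℤ) some (Option.some_injective K)
      (Finsupp.single (some k) 1) = Finsupp.single k 1 := by
    ext; simp [Finsupp.lcomapDomain, Finsupp.single_apply]
  rw [forget, e, ExteriorAlgebra.map_apply_ι, h, e]

theorem forget_relabel_some {K : Type} (x : Ex K) : forget K (relabel some x) = x := by
  rw [← AlgHom.comp_apply]
  refine hom_ext_e (g := AlgHom.id ℤ _) (fun k => ?_) x
  rw [AlgHom.comp_apply, relabel_e, forget_e_some, AlgHom.id_apply]

/-- The decomposition of an element of `Ex(K ⊔ {∗})` according to the occurrence of `e_∗`. -/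
theorem eq_relabel_some_add {K : Type} (x : Ex (Option K)) :
    x = relabel some (forget K x) + e none * relabel some (forget K (θ none x)) := by
  let γ : Ex (Option K) →ₐ[ℤ] Ex (Option K) := (relabel some).comp (forget K)
  have hγ : ∀ v : Option K →₀ ℤ,
      ExteriorAlgebra.ι ℤ v = γ (ExteriorAlgebra.ι ℤ v) + v none • e none := by
    intro v
    have : ExteriorAlgebra.ι ℤ =
        γ.toLinearMap ∘ₗ ExteriorAlgebra.ι ℤ + (Finsupp.lapply none).smulRight (e none) := by
      ext k
      change e k = γ (e k) + (Finsupp.single k (1 : ℤ) none) • e none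
      rcases k with _ | k
      · simp [γ, forget_e_none]
      · simp [γ, forget_e_some, relabel_e]
    exact DFunLike.congr_fun this v
  change x = γ x + e none * γ (θ none x)
  induction x using induction_left with
  | h0 r => rw [θ, contract_algebraMap, AlgHom.commutes, map_zero, mul_zero, add_zero]
  | hadd a b ha hb =>
    rw [map_add, map_add, map_add, mul_add, add_add_add_comm, ← ha, ← hb]
  | hmul a v ha =>
    have hswap : e none * γ (ExteriorAlgebra.ι ℤ v) = -(γ (ExteriorAlgebra.ι ℤ v) * e none) := by
      have h1 : γ (ExteriorAlgebra.ι ℤ v) = ExteriorAlgebra.ι ℤ v - v none • e none := by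
        rw [eq_sub_iff_add_eq]; exact (hγ v).symm
      rw [h1, mul_sub, sub_mul, mul_smul_comm, smul_mul_assoc, e_mul_self, smul_zero, sub_zero,
        sub_zero]
      exact eq_neg_of_add_eq_zero_left (ExteriorAlgebra.ι_add_mul_swap _ _)
    have h2 : θ none (ExteriorAlgebra.ι ℤ v * a) =
        v none • a - ExteriorAlgebra.ι ℤ v * θ none a := contract_ι_mul _ _ _
    rw [h2, map_sub, map_smul, map_mul, map_mul, mul_sub, ← mul_assoc (e none), hswap]
    conv_lhs => rw [ha, hγ v]
    simp only [add_mul, mul_add, smul_mul_assoc, ← mul_assoc, e_mul_self, zero_mul, smul_zero,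
      mul_smul_comm, neg_mul]
    abel

theorem eq_zero_of_mem_face_of_isEmpty {I : Type} [IsEmpty I] {n : ℤ} {x : Ex I}
    (hx : x ∈ face I n) : x = 0 := by
  rcases face_cases hx with rfl | ⟨k, rfl, hx⟩
  · rfl
  · have h : ∀ {n : ℕ} {a : Ex I}, a ∈ ⋀[ℤ]^n (I →₀ ℤ) → n ≠ 0 → a = 0 := by
      intro n a ha
      refine mem_induction (C := fun n a => n ≠ 0 → a = 0) ?_ ?_ ?_ ha
      · exact fun r h => (h rfl).elim
      · exact fun n a b ha hb h => by rw [ha h, hb h, add_zero]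
      · exact fun n v a _ _ => by rw [Subsingleton.elim v 0, map_zero, zero_mul]
    exact h hx (by omega)

/-- Generators of the exterior powers of `ℤ²`. -/
theorem exists_of_mem_exteriorPower_two {n : ℕ} {a : Ex (Fin 2)} (ha : a ∈ ⋀[ℤ]^n (Fin 2 →₀ ℤ)) :
    (n = 0 → ∃ r : ℤ, a = algebraMap ℤ _ r) ∧ (n = 1 → ∃ r s : ℤ, a = r • e 0 + s • e 1) ∧
      (n = 2 → ∃ r : ℤ, a = r • (e 0 * e 1)) ∧ (3 ≤ n → a = 0) := by
  have h0 : ∀ v : Fin 2 →₀ ℤ, ExteriorAlgebra.ι ℤ v = v 0 • e 0 + v 1 • e 1 := by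
    intro v
    have : v = v 0 • Finsupp.single 0 1 + v 1 • Finsupp.single 1 1 := by
      ext i; fin_cases i <;> simp
    conv_lhs => rw [this]
    rw [map_add, map_smul, map_smul, e, e]
  have h10 : (e 1 * e 0 : Ex (Fin 2)) = -(e 0 * e 1) :=
    eq_neg_of_add_eq_zero_left (ExteriorAlgebra.ι_add_mul_swap _ _)
  refine mem_induction (C := fun n a =>
    (n = 0 → ∃ r : ℤ, a = algebraMap ℤ _ r) ∧ (n = 1 → ∃ r s : ℤ, a = r • e 0 + s • e 1) ∧
      (n = 2 → ∃ r : ℤ, a = r • (e 0 * e 1)) ∧ (3 ≤ n → a = 0)) ?_ ?_ ?_ ha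
  · exact fun r => ⟨fun _ => ⟨r, rfl⟩, by omega, by omega, by omega⟩
  · rintro n a b ⟨a0, a1, a2, a3⟩ ⟨b0, b1, b2, b3⟩
    refine ⟨fun h => ?_, fun h => ?_, fun h => ?_, fun h => by rw [a3 h, b3 h, add_zero]⟩
    · obtain ⟨r, rfl⟩ := a0 h
      obtain ⟨s, rfl⟩ := b0 h
      exact ⟨r + s, (map_add _ _ _).symm⟩
    · obtain ⟨r, s, rfl⟩ := a1 h
      obtain ⟨r', s', rfl⟩ := b1 h
      exact ⟨r + r', s + s', by module⟩
    · obtain ⟨r, rfl⟩ := a2 h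
      obtain ⟨s, rfl⟩ := b2 h
      exact ⟨r + s, by module⟩
  · rintro n v a ⟨a0, a1, a2, a3⟩
    refine ⟨by omega, fun h => ?_, fun h => ?_, fun h => ?_⟩
    · obtain ⟨r, rfl⟩ := a0 (by omega)
      refine ⟨r * v 0, r * v 1, ?_⟩
      rw [← Algebra.commutes, ← Algebra.smul_def, h0]
      module
    · obtain ⟨r, s, rfl⟩ := a1 (by omega)
      refine ⟨v 0 * s - v 1 * r, ?_⟩
      rw [h0]
      simp only [add_mul, mul_add, smul_mul_smul_comm, e_mul_self, h10]
      module
    · rcases (show n = 2 ∨ 3 ≤ n by omega) with hn | hn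
      · obtain ⟨r, rfl⟩ := a2 hn
        rw [h0, mul_smul_comm, add_mul, smul_mul_assoc, smul_mul_assoc, ← mul_assoc, ← mul_assoc,
          e_mul_self, h10, neg_mul, mul_assoc, e_mul_self]
        simp
      · rw [a3 hn, mul_zero]

theorem relabel_adjoin_relabel_inr {K : Type} (x : Ex K) :
    relabel (OperadLabels.adjoin K) (relabel Sum.inr x) = relabel some x := by
  rw [relabel_relabel]; rfl

theorem relabel_adjoin_map_alpha_e_one (K : Type) :
    relabel (OperadLabels.adjoin K) (ExteriorAlgebra.map (alpha (0 : Fin 2) K) (e 1)) =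
      e none := by
  rw [map_alpha_ne one_ne_zero, relabel_e]; rfl

/-! ### Operations of Pasc as elements of the exterior algebra -/

/-- The inclusion of `Pasc(I)` in the exterior algebra. -/
noncomputable def toEx {I : Type} [Finite I] {n : ℤ} : pasc.obj I n →+ Ex I :=
  (face I n).subtype.toAddMonoidHom

section

variable {I J K : Type} [Finite I] [Finite J] [Finite K]

theorem toEx_injective {n : ℤ} : Function.Injective (toEx : pasc.obj I n →+ Ex I) :=
  Subtype.val_injective

theorem toEx_mem {n : ℤ} (x : pasc.obj I n) : toEx x ∈ face I n := Subtype.property x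

theorem toEx_map (f : I ≃ J) {n : ℤ} (x : pasc.obj I n) :
    toEx (pasc.map f x) = relabel f (toEx x) := rfl

theorem toEx_adjoin {m n p : ℤ} (h : m + n = p) (g : pasc.obj (Fin 2) m) (x : pasc.obj K n) :
    toEx (pasc.adjoin h g x) = relabel (OperadLabels.adjoin K) (circ 0 m (toEx g) (toEx x)) := rfl

theorem toEx_adjoin_of_eq_e_zero {n p : ℤ} (h : 0 + n = p) {g : pasc.obj (Fin 2) 0}
    (hg : toEx g = e 0) (x : pasc.obj K n) :
    toEx (pasc.adjoin h g x) = relabel some (toEx x) := by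
  rw [toEx_adjoin, hg, circ_eq, θ_e_self, map_alpha_self, Int.negOnePow_zero]
  simp [relabel_adjoin_relabel_inr]

theorem toEx_adjoin_of_eq_e_one {n p : ℤ} (h : 0 + n = p) {g : pasc.obj (Fin 2) 0}
    (hg : toEx g = e 1) (x : pasc.obj K n) :
    toEx (pasc.adjoin h g x) = aug (toEx x) • e none := by
  rw [toEx_adjoin, hg, circ_eq, θ_e_ne one_ne_zero]
  simp [relabel_adjoin_map_alpha_e_one]

theorem toEx_adjoin_of_eq_e_zero_mul_e_one {n p : ℤ} (h : 1 + n = p) {g : pasc.obj (Fin 2) 1}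
    (hg : toEx g = e 0 * e 1) (x : pasc.obj K n) :
    toEx (pasc.adjoin h g x) = -(e none * relabel some (toEx x)) := by
  rw [toEx_adjoin, hg, circ_eq, θ_e_mul, θ_e_ne one_ne_zero, mul_zero, sub_zero,
    Int.negOnePow_one]
  simp [relabel_adjoin_map_alpha_e_one, map_alpha_self, relabel_adjoin_relabel_inr]

end

end Pasc

/-! ### Operads satisfying the relations -/

namespace Pasc

open DGOperad

/-- The binary operations in the list `e₁`, `e₂`, `e₁₂`. -/
inductive IsGenerator {P : DGOperad.{v}} (e₁ e₂ : P.obj (Fin 2) 0) (e₁₂ : P.obj (Fin 2) 1) :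
    ∀ {n : ℤ}, P.obj (Fin 2) n → Prop
  | e₁ : IsGenerator e₁ e₂ e₁₂ e₁
  | e₂ : IsGenerator e₁ e₂ e₁₂ e₂
  | e₁₂ : IsGenerator e₁ e₂ e₁₂ e₁₂

/-- The span of `e₁`, `e₂`, `e₁₂`. -/
def generatorSpan {P : DGOperad.{v}} (e₁ e₂ : P.obj (Fin 2) 0) (e₁₂ : P.obj (Fin 2) 1) (n : ℤ) :
    AddSubgroup (P.obj (Fin 2) n) :=
  AddSubgroup.closure {g | IsGenerator e₁ e₂ e₁₂ g}

/-- An operad `P` over Pasc, generated by elements `e₁`, `e₂`, `e₁₂` which map to `e_1`, `e_2`,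
`e_1 ∧ e_2` and satisfy the seven relations. -/
structure Presentation (P : DGOperad.{v}) where
  e₁ : P.obj (Fin 2) 0
  e₂ : P.obj (Fin 2) 0
  e₁₂ : P.obj (Fin 2) 1
  map_swap_e₁ : P.map (Equiv.swap (0 : Fin 2) 1) e₁ = e₂
  map_swap_e₁₂ : P.map (Equiv.swap (0 : Fin 2) 1) e₁₂ = -e₁₂
  d_e₁ {n : ℤ} (h : n + 1 = 0) : P.d h e₁ = 0
  d_e₁₂ : P.d (zero_add 1) e₁₂ = e₂ - e₁
  rel₁ : P.circOne (add_zero 0) e₁ e₁ = P.cycle (P.cycle (P.circOne (add_zero 0) e₂ e₁))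
  rel₂ : P.circOne (add_zero 0) e₂ e₁ = P.circOne (add_zero 0) e₂ e₂
  rel₃ : P.circOne (add_zero 0) e₁ e₂ = P.cycle (P.circOne (add_zero 0) e₂ e₂)
  rel₄ : P.circOne (zero_add 1) e₂ e₁₂ = 0
  rel₅ : P.cycle (P.circOne (add_zero 1) e₁₂ e₂) = P.circOne (zero_add 1) e₁ e₁₂
  rel₆ : -P.cycle (P.cycle (P.circOne (add_zero 1) e₁₂ e₁)) = P.circOne (zero_add 1) e₁ e₁₂
  rel₇ : P.circOne one_add_one_eq_two e₁₂ e₁₂ = P.cycle (P.circOne one_add_one_eq_two e₁₂ e₁₂)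
  generates : P.IsGeneratedBy (generatorSpan e₁ e₂ e₁₂)
  hom : Hom P pasc
  hom_e₁ : toEx (hom.app (Fin 2) 0 e₁) = e 0
  hom_e₂ : toEx (hom.app (Fin 2) 0 e₂) = e 1
  hom_e₁₂ : toEx (hom.app (Fin 2) 1 e₁₂) = e 0 * e 1

end Pasc

namespace DGOperad

variable (P : DGOperad.{v})

theorem cycle_cycle_cycle {n : ℤ} (x : P.obj (Fin 3) n) : P.cycle (P.cycle (P.cycle x)) = x := by
  simp only [cycle]
  rw [← P.map_trans, ← P.map_trans]
  exact (congrArg (fun f => P.map f x) (by decide)).trans (P.map_refl x)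

theorem map_swap_circOne {m n p : ℤ} (h : m + n = p) (x : P.obj (Fin 2) m) (y : P.obj (Fin 2) n) :
    P.map (Equiv.swap (0 : Fin 3) 1) (P.circOne h x y) =
      P.circOne h x (P.map (Equiv.swap (0 : Fin 2) 1) y) := by
  rw [circOne, circOne, comp_map_right, ← P.map_trans, ← P.map_trans]
  congr 2
  decide

/-- An iterated composition `x ∘_1 (y ∘_1 z)` is `(x ∘_1 y) ∘_1 z`, the labels `2` and `3` of
`x ∘_1 y` becoming the inner and the outer new label. -/
theorem adjoin_adjoin {K : Type} [Finite K] : ∃ f : {k : Fin 3 // k ≠ 0} ⊕ K ≃ Option (Option K),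
    f (.inl ⟨1, one_ne_zero⟩) = some none ∧ f (.inl ⟨2, by decide⟩) = none ∧
    (∀ k, f (.inr k) = some (some k)) ∧
    ∀ {a b c ab bc abc : ℤ} (hab : a + b = ab) (hbc : b + c = bc)
      (h₁ : ab + c = abc) (h₂ : a + bc = abc) (x : P.obj (Fin 2) a) (y : P.obj (Fin 2) b)
      (z : P.obj K c), P.adjoin h₂ x (P.adjoin hbc y z) =
        P.map f (P.comp 0 h₁ (P.circOne hab x y) z) := by
  let f : {k : Fin 3 // k ≠ circOneLabels (.inr 0)} ⊕ K ≃ Option (Option K) :=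
    ((OperadLabels.congr circOneLabels (Equiv.refl K) (.inr 0)).symm.trans
      (OperadLabels.seq K (0 : Fin 2) (0 : Fin 2))).trans
      ((Equiv.sumCongr (Equiv.refl _) (OperadLabels.adjoin K)).trans
        (OperadLabels.adjoin (Option K)))
  refine ⟨f, rfl, rfl, fun _ => rfl, ?_⟩
  intro a b c ab bc abc hab hbc h₁ h₂ x y z
  have h3 : P.adjoin h₂ x (P.adjoin hbc y z) =
      P.map f (P.comp (circOneLabels (.inr 0)) h₁ (P.map circOneLabels (P.comp 0 hab x y)) z) := by
    rw [comp_map_left, P.map_trans, P.map_trans, P.map_trans, map_symm_map,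
      P.comp_seq 0 0 hab hbc h₁ h₂, ← comp_map_right]
    rfl
  exact h3

end DGOperad

namespace Pasc.Presentation

open DGOperad

variable {P : DGOperad.{v}} (D : Presentation P)

/-- The span of the generators. -/
abbrev G (n : ℤ) : AddSubgroup (P.obj (Fin 2) n) := generatorSpan D.e₁ D.e₂ D.e₁₂ n

theorem e₁_mem : D.e₁ ∈ D.G 0 := AddSubgroup.subset_closure .e₁

theorem e₂_mem : D.e₂ ∈ D.G 0 := AddSubgroup.subset_closure .e₂

theorem e₁₂_mem : D.e₁₂ ∈ D.G 1 := AddSubgroup.subset_closure .e₁₂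

theorem map_swap_e₂ : P.map (Equiv.swap (0 : Fin 2) 1) D.e₂ = D.e₁ := by
  rw [← D.map_swap_e₁, ← P.map_trans, show (Equiv.swap (0 : Fin 2) 1).trans (Equiv.swap 0 1) =
    Equiv.refl _ from Equiv.swap_swap 0 1, P.map_refl]

theorem map_mem_G (σ : Equiv.Perm (Fin 2)) (n : ℤ) (g : P.obj (Fin 2) n) (hg : g ∈ D.G n) :
    P.map σ g ∈ D.G n := by
  obtain rfl | rfl : σ = Equiv.refl _ ∨ σ = Equiv.swap 0 1 := by revert σ; decide
  · rwa [P.map_refl]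
  · refine (AddSubgroup.closure_le (K := (D.G n).comap (P.map (Equiv.swap 0 1)))).2 ?_ hg
    rintro _ (_ | _ | _)
    · exact AddSubgroup.mem_comap.2 (D.map_swap_e₁.symm ▸ D.e₂_mem)
    · exact AddSubgroup.mem_comap.2 (D.map_swap_e₂.symm ▸ D.e₁_mem)
    · exact AddSubgroup.mem_comap.2 (D.map_swap_e₁₂.symm ▸ neg_mem D.e₁₂_mem)

theorem d_mem_G {m n : ℤ} (h : n + 1 = m) (g : P.obj (Fin 2) m) (hg : g ∈ D.G m) :
    P.d h g ∈ D.G n := by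
  refine (AddSubgroup.closure_le (K := (D.G n).comap (P.d h))).2 ?_ hg
  rintro _ (_ | _ | _)
  · exact AddSubgroup.mem_comap.2 ((D.d_e₁ h).symm ▸ zero_mem _)
  · change P.d h D.e₂ ∈ D.G _
    rw [← D.map_swap_e₁, ← P.map_d, D.d_e₁, map_zero (P.map _)]
    exact zero_mem _
  · obtain rfl := add_right_cancel (h.trans (zero_add (1 : ℤ)).symm)
    exact AddSubgroup.mem_comap.2 (D.d_e₁₂.symm ▸ sub_mem D.e₂_mem D.e₁_mem)

theorem circOne_mem {a b n : ℤ} (h : a + b = n) {g : P.obj (Fin 2) a} {g' : P.obj (Fin 2) b}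
    (hg : g ∈ D.G a) (hg' : g' ∈ D.G b) : P.circOne h g g' ∈ P.circOneSpan D.G n :=
  AddSubgroup.subset_closure ⟨_, _, h, _, hg, _, hg', rfl⟩

/-- The relations express `τ (g ∘_1 g')` by compositions of the same form, for any two generators. -/
theorem cycle_mem (n : ℤ) (t : P.obj (Fin 3) n) (ht : t ∈ P.circOneSpan D.G n) :
    P.cycle t ∈ P.circOneSpan D.G n := by
  refine (AddSubgroup.closure_le (K := (P.circOneSpan D.G n).comap P.cycle)).2 ?_ ht
  rintro _ ⟨a, b, h, g, hg, g', hg', rfl⟩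
  refine (AddSubgroup.closure_le (K := (P.circOneSpan D.G n).comap (P.cycle.comp
    ((P.map circOneLabels).comp ((P.comp 0 h).flip g'))))).2 ?_ hg
  intro g hg
  refine (AddSubgroup.closure_le (K := (P.circOneSpan D.G n).comap (P.cycle.comp
    ((P.map circOneLabels).comp (P.comp 0 h g))))).2 ?_ hg'
  intro g' hg'
  change P.cycle (P.circOne h g g') ∈ P.circOneSpan D.G n
  have m₁₁ := D.circOne_mem (add_zero 0) D.e₁_mem D.e₁_mem
  have m₁₂ := D.circOne_mem (add_zero 0) D.e₁_mem D.e₂_mem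
  have m₂₁ := D.circOne_mem (add_zero 0) D.e₂_mem D.e₁_mem
  have m₁ := D.circOne_mem (zero_add 1) D.e₁_mem D.e₁₂_mem
  rcases hg with _ | _ | _ <;> rcases hg' with _ | _ | _
  · obtain rfl := h.symm.trans (add_zero (0 : ℤ))
    rwa [D.rel₁, cycle_cycle_cycle]
  · obtain rfl := h.symm.trans (add_zero (0 : ℤ))
    rwa [D.rel₃, ← D.rel₂, ← D.rel₁]
  · obtain rfl := h.symm.trans (zero_add (1 : ℤ))
    rw [← D.rel₆, map_neg, cycle_cycle_cycle]
    exact neg_mem (D.circOne_mem _ D.e₁₂_mem D.e₁_mem)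
  · obtain rfl := h.symm.trans (add_zero (0 : ℤ))
    rwa [D.rel₂, ← D.rel₃]
  · obtain rfl := h.symm.trans (add_zero (0 : ℤ))
    rwa [← D.rel₃]
  · obtain rfl := h.symm.trans (zero_add (1 : ℤ))
    rw [D.rel₄, map_zero]
    exact zero_mem _
  · obtain rfl := h.symm.trans (add_zero (1 : ℤ))
    have h3 := congrArg (fun x => P.cycle (P.cycle x)) (D.rel₆.trans D.rel₅.symm)
    simp only [map_neg, cycle_cycle_cycle] at h3
    rw [← neg_neg (P.cycle _), h3]
    exact neg_mem (D.circOne_mem _ D.e₁₂_mem D.e₂_mem)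
  · obtain rfl := h.symm.trans (add_zero (1 : ℤ))
    rwa [D.rel₅]
  · obtain rfl := h.symm.trans (one_add_one_eq_two)
    rw [← D.rel₇]
    exact D.circOne_mem _ D.e₁₂_mem D.e₁₂_mem

end Pasc.Presentation

namespace OperadLabels

/-- The exchange of the two new labels. -/
def swapNew (K : Type) : Option (Option K) ≃ Option (Option K) where
  toFun
    | none => some none
    | some none => none
    | some (some k) => some (some k)
  invFun
    | none => some none
    | some none => none
    | some (some k) => some (some k)
  left_inv := by rintro (_ | _ | _) <;> rfl
  right_inv := by rintro (_ | _ | _) <;> rfl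

end OperadLabels

namespace Pasc.Presentation

open DGOperad

variable {P : DGOperad.{v}} (D : Presentation P) {K : Type} [Finite K]

theorem adjoin_e₂_adjoin_e₁₂ {n q r : ℤ} (h : 1 + n = q) (h' : 0 + q = r) (x : P.obj K n) :
    P.adjoin h' D.e₂ (P.adjoin h D.e₁₂ x) = 0 := by
  obtain ⟨f, -, -, -, hf⟩ := P.adjoin_adjoin (K := K)
  rw [hf (zero_add 1) h (by omega), D.rel₄, map_zero, AddMonoidHom.zero_apply, map_zero]

theorem adjoin_e₂_adjoin_e₂ {n q r : ℤ} (h : 0 + n = q) (h' : 0 + q = r) (x : P.obj K n) :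
    P.adjoin h' D.e₂ (P.adjoin h D.e₂ x) = P.adjoin h' D.e₂ (P.adjoin h D.e₁ x) := by
  obtain ⟨f, -, -, -, hf⟩ := P.adjoin_adjoin (K := K)
  rw [hf (add_zero 0) h (by omega), hf (add_zero 0) h (by omega), D.rel₂]

/-- Both sides are the operation with value the input `2`. -/
theorem circOne_e₁_e₂ : P.circOne (add_zero 0) D.e₁ D.e₂ =
    P.map (Equiv.swap (1 : Fin 3) 2) (P.circOne (add_zero 0) D.e₂ D.e₁) := by
  rw [D.rel₃, ← D.map_swap_e₁, ← map_swap_circOne, D.map_swap_e₁, cycle, ← P.map_trans]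
  congr 2
  decide

theorem adjoin_e₂_adjoin_e₁ {n q r : ℤ} (h : 0 + n = q) (h' : 0 + q = r) (x : P.obj K n) :
    P.adjoin h' D.e₂ (P.adjoin h D.e₁ x) =
      P.map (OperadLabels.swapNew K) (P.adjoin h' D.e₁ (P.adjoin h D.e₂ x)) := by
  obtain ⟨f, hf1, hf2, hf3, hf⟩ := P.adjoin_adjoin (K := K)
  let s : {k : Fin 3 // k ≠ 0} ⊕ K ≃ {k : Fin 3 // k ≠ 0} ⊕ K :=
    OperadLabels.congr (Equiv.swap (1 : Fin 3) 2) (Equiv.refl K) 0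
  have h1 : P.comp 0 (by omega : 0 + n = r) (P.circOne (add_zero 0) D.e₁ D.e₂) x =
      P.map s
        (P.comp 0 (by omega) (P.circOne (add_zero 0) D.e₂ D.e₁) x) := by
    rw [circOne_e₁_e₂]
    exact comp_map_left P (Equiv.swap (1 : Fin 3) 2) 0 _ _ x
  have h3 : s.trans (f.trans (OperadLabels.swapNew K)) = f := by
    ext a : 1
    rcases a with ⟨a, ha⟩ | k
    · obtain rfl | rfl : a = 1 ∨ a = 2 := by omega
      · exact (congrArg (OperadLabels.swapNew K) hf2).trans hf1.symm
      · exact (congrArg (OperadLabels.swapNew K) hf1).trans hf2.symm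
    · exact (congrArg (OperadLabels.swapNew K) (hf3 k)).trans (hf3 k).symm
  rw [hf (add_zero 0) h (by omega), hf (add_zero 0) h (by omega), h1, ← P.map_trans,
    ← P.map_trans, h3]

theorem mem_rooted {J : Type} [Finite J] (j : J) {n : ℤ} (x : P.obj J n) :
    x ∈ P.rooted D.G j n :=
  DGOperad.mem_rooted D.map_mem_G D.d_mem_G D.cycle_mem D.generates j x

theorem eq_zero_of_isEmpty (D : Presentation P) {J : Type} [Finite J] [IsEmpty J] {n : ℤ}
    (x : P.obj J n) : x = 0 :=
  DGOperad.eq_zero_of_isEmpty D.generates x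

/-- Every operation with an input `none` and some other inputs is a sum of compositions in which
this input is attached to the root. -/
theorem exists_eq_adjoin_add [hK : Nonempty K] {n : ℤ} (x : P.obj (Option K) n) :
    ∃ (y : P.obj K n) (z : P.obj K (n - 1)) (w : P.obj K n),
      x = P.adjoin (zero_add n) D.e₁ y + P.adjoin (add_sub_cancel 1 n) D.e₁₂ z +
        P.adjoin (zero_add n) D.e₂ w := by
  let S : AddSubgroup (P.obj (Option K) n) := (P.adjoin (zero_add n) D.e₁).range ⊔
    (P.adjoin (add_sub_cancel 1 n) D.e₁₂).range ⊔ (P.adjoin (zero_add n) D.e₂).range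
  have hS : x ∈ S := by
    refine (AddSubgroup.closure_le (K := S)).2 ?_ (D.mem_rooted none x)
    rintro _ (⟨f, hf⟩ | @⟨L, _, f, hf, a, b, _, h, g, hg, y⟩)
    · obtain ⟨k⟩ := hK
      have h1 : f (f.symm (some k)) = none := hf
      simp at h1
    · have h1 : f = Equiv.optionCongr (Equiv.removeNone f) := by
        ext a : 1
        rcases a with _ | a
        · exact hf
        · obtain ⟨k, hk⟩ := Option.ne_none_iff_exists'.1
            (fun h => Option.some_ne_none a (f.injective (h.trans hf.symm)))
          exact (Equiv.removeNone_some f ⟨k, hk⟩).symm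
      rw [h1, map_adjoin]
      refine (AddSubgroup.closure_le (K := S.comap ((P.adjoin h).flip _))).2 ?_ hg
      rintro _ (_ | _ | _)
      · obtain rfl := (zero_add _).symm.trans h
        exact AddSubgroup.mem_sup_left (AddSubgroup.mem_sup_left ⟨_, rfl⟩)
      · obtain rfl := (zero_add _).symm.trans h
        exact AddSubgroup.mem_sup_right ⟨_, rfl⟩
      · obtain rfl := eq_sub_of_add_eq' h
        exact AddSubgroup.mem_sup_left (AddSubgroup.mem_sup_right ⟨_, rfl⟩)
  obtain ⟨_, h, _, ⟨w, rfl⟩, rfl⟩ := AddSubgroup.mem_sup.1 hS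
  obtain ⟨_, ⟨y, rfl⟩, _, ⟨z, rfl⟩, rfl⟩ := AddSubgroup.mem_sup.1 h
  exact ⟨y, z, w, rfl⟩

/-- The value of an operation in Pasc, as an element of the exterior algebra. -/
noncomputable def val {J : Type} [Finite J] {n : ℤ} : P.obj J n →+ Ex J :=
  toEx.comp (D.hom.app J n)

theorem val_mem {J : Type} [Finite J] {n : ℤ} (x : P.obj J n) : D.val x ∈ face J n := toEx_mem _

theorem val_map {I J : Type} [Finite I] [Finite J] (f : I ≃ J) {n : ℤ} (x : P.obj I n) :
    D.val (P.map f x) = relabel f (D.val x) := congrArg toEx (D.hom.app_map f x)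

theorem val_one : D.val P.one = e () := congrArg toEx D.hom.app_one

theorem hom_adjoin {m n p : ℤ} (h : m + n = p) (g : P.obj (Fin 2) m) (x : P.obj K n) :
    D.hom.app _ p (P.adjoin h g x) = pasc.adjoin h (D.hom.app _ m g) (D.hom.app _ n x) := by
  rw [adjoin_apply, D.hom.app_map, D.hom.app_comp, adjoin_apply]

theorem val_adjoin_e₁ {n p : ℤ} (h : 0 + n = p) (x : P.obj K n) :
    D.val (P.adjoin h D.e₁ x) = relabel some (D.val x) :=
  (congrArg toEx (D.hom_adjoin h _ x)).trans (toEx_adjoin_of_eq_e_zero h D.hom_e₁ _)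

theorem val_adjoin_e₂ {n p : ℤ} (h : 0 + n = p) (x : P.obj K n) :
    D.val (P.adjoin h D.e₂ x) = aug (D.val x) • e none :=
  (congrArg toEx (D.hom_adjoin h _ x)).trans (toEx_adjoin_of_eq_e_one h D.hom_e₂ _)

theorem val_adjoin_e₁₂ {n p : ℤ} (h : 1 + n = p) (x : P.obj K n) :
    D.val (P.adjoin h D.e₁₂ x) = -(e none * relabel some (D.val x)) :=
  (congrArg toEx (D.hom_adjoin h _ x)).trans (toEx_adjoin_of_eq_e_zero_mul_e_one h D.hom_e₁₂ _)

theorem val_eq_zero_of_neg {J : Type} [Finite J] {n : ℤ} (hn : n < 0) (x : P.obj J n) :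
    D.val x = 0 := by
  rcases face_cases (D.val_mem x) with h | ⟨k, rfl, -⟩
  · exact h
  · omega

theorem aug_val_adjoin_e₁₂ {n p : ℤ} (h : 1 + n = p) (x : P.obj K n) :
    aug (D.val (P.adjoin h D.e₁₂ x)) = 0 := by
  by_cases hp : p = 0
  · rw [val_adjoin_e₁₂, D.val_eq_zero_of_neg (by omega), map_zero, mul_zero, neg_zero, aug_zero]
  · exact aug_of_mem (D.val_mem _) hp

/-- In arity one, `P` is spanned by the unit, whose augmentation is `1`. -/
theorem eq_zero_of_aug_eq_zero_of_isEmpty [hK : IsEmpty K] {n : ℤ} (x : P.obj (Option K) n)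
    (hx : aug (D.val x) = 0) : x = 0 := by
  let f : Unit ≃ Option K := Equiv.ofUnique Unit (Option K)
  have h0 : ∀ {L : Type} [Finite L] (f : Option L ≃ Option K) {n : ℤ} (y : P.obj L n), y = 0 := by
    intro L _ f n y
    have : IsEmpty L := (Equiv.removeNone f).isEmpty
    exact D.eq_zero_of_isEmpty y
  by_cases hn : n = 0
  · subst hn
    have hS : x ∈ AddSubgroup.zmultiples (P.map f P.one) := by
      refine (AddSubgroup.closure_le _).2 ?_ (D.mem_rooted none x)
      rintro _ (⟨g, hg⟩ | @⟨L, _, g, hg, a, b, _, h, _, -, y⟩)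
      · rw [Subsingleton.elim g f]
        exact AddSubgroup.mem_zmultiples _
      · rw [h0 g y, map_zero, map_zero]
        exact zero_mem _
    obtain ⟨m, rfl⟩ := hS
    have h1 : m = 0 := by
      rw [map_zsmul, D.val_map, D.val_one, relabel_e, aug_smul, aug_e, mul_one] at hx
      exact hx
    simp [h1]
  · refine (AddSubgroup.closure_le (⊥ : AddSubgroup (P.obj (Option K) n))).2 ?_
      (D.mem_rooted none x)
    rintro _ (⟨g, hg⟩ | @⟨L, _, g, hg, a, b, _, h, _, -, y⟩)
    · exact (hn rfl).elim
    · rw [h0 g y, map_zero, map_zero]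
      exact zero_mem _

/-- The composition `e_2 ∘_1 x` only depends on the augmentation of `x`. -/
theorem adjoin_e₂_eq_zero {K : Type} [Finite K] {n p : ℤ} (h : 0 + n = p) (x : P.obj K n)
    (hx : aug (D.val x) = 0) : P.adjoin h D.e₂ x = 0 := by
  refine (Finite.induction_empty_option (P := fun K : Type => ∀ [Finite K] {n p : ℤ} (h : 0 + n = p)
    (x : P.obj K n), aug (D.val x) = 0 → P.adjoin h D.e₂ x = 0) ?_ ?_ ?_ K) h x hx
  · intro K L f ih _ n p h x hx
    have : Finite K := Finite.of_equiv L f.symm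
    have h1 := ih h (P.map f.symm x) (by rwa [val_map, aug_relabel])
    rw [← P.map_map_symm f x, ← map_adjoin, h1, map_zero]
  · intro _ n p h x hx
    rw [D.eq_zero_of_isEmpty x, map_zero]
  · intro K _ ih _ n p h x hx
    rcases isEmpty_or_nonempty K with hK | hK
    · rw [D.eq_zero_of_aug_eq_zero_of_isEmpty x hx, map_zero]
    · obtain ⟨y, z, w, rfl⟩ := D.exists_eq_adjoin_add x
      have h1 : aug (D.val (y + w)) = 0 := by
        simpa only [map_add, aug_add, val_adjoin_e₁, aug_relabel, aug_val_adjoin_e₁₂, add_zero,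
          val_adjoin_e₂, aug_smul, aug_e, mul_one] using hx
      rw [map_add, map_add, adjoin_e₂_adjoin_e₁₂, add_zero, adjoin_e₂_adjoin_e₂, ← map_add,
        ← map_add, adjoin_e₂_adjoin_e₁, ih _ _ h1, map_zero, map_zero]

theorem eq_zero_of_val_eq_zero {J : Type} [Finite J] {n : ℤ} (x : P.obj J n)
    (hx : D.val x = 0) : x = 0 := by
  refine (Finite.induction_empty_option
    (P := fun J : Type => ∀ [Finite J] {n : ℤ} (x : P.obj J n), D.val x = 0 → x = 0)
    ?_ ?_ ?_ J) x hx
  · intro K L f ih _ n x hx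
    have : Finite K := Finite.of_equiv L f.symm
    rw [← P.map_map_symm f x, ih (P.map f.symm x) (by rw [val_map, hx, map_zero]), map_zero]
  · intro _ n x hx
    exact D.eq_zero_of_isEmpty x
  · intro K _ ih _ n x hx
    rcases isEmpty_or_nonempty K with hK | hK
    · exact D.eq_zero_of_aug_eq_zero_of_isEmpty x (by rw [hx, aug_zero])
    · obtain ⟨y, z, w, rfl⟩ := D.exists_eq_adjoin_add x
      simp only [map_add, val_adjoin_e₁, val_adjoin_e₁₂, val_adjoin_e₂] at hx
      -- The part of the sum without `e_∗` is `y`, and `θ_∗` of the sum is `-z + aug(w)`, with terms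
      -- in different degrees of the exterior algebra.
      have hy : D.val y = 0 := by
        simpa [forget_relabel_some, forget_e_none] using congrArg (forget K) hx
      have h1 : aug (D.val w) • 1 = D.val z := by
        have h2 := congrArg (fun a => forget K (θ none a)) hx
        simp only [map_add, map_neg, θ_e_mul, map_smul, θ_e_self,
          theta_relabel_zero (fun k => Option.some_ne_none k), mul_zero, sub_zero, map_zero,
          forget_relabel_some, map_one, zero_add] at h2
        exact (neg_add_eq_zero.1 h2).symm
      have hw : aug (D.val w) = 0 := by
        have h2 := congrArg ExteriorAlgebra.algebraMapInv h1
        rw [algebraMapInv_of_mem_face (D.val_mem z)] at h2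
        simpa using h2
      rw [hw, zero_smul] at h1
      rw [ih y hy, ih z h1.symm, D.adjoin_e₂_eq_zero _ w hw]
      simp

theorem e_mem_face {I : Type} (i : I) : e i ∈ face I 0 :=
  mem_face (n := 0) (by rw [ExteriorAlgebra.exteriorPower, zero_add, pow_one]; exact ⟨_, rfl⟩)

theorem exists_val_eq {J : Type} [Finite J] {n : ℤ} (x : Ex J) (hx : x ∈ face J n) :
    ∃ y : P.obj J n, D.val y = x := by
  refine (Finite.induction_empty_option (P := fun J : Type =>
    ∀ [Finite J] {n : ℤ} (x : Ex J), x ∈ face J n → ∃ y : P.obj J n, D.val y = x) ?_ ?_ ?_ J) x hx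
  · intro K L f ih _ n x hx
    have : Finite K := Finite.of_equiv L f.symm
    obtain ⟨y, hy⟩ := ih (relabel f.symm x) (map_mem_face _ hx)
    refine ⟨P.map f y, ?_⟩
    rw [val_map, hy, relabel_relabel]
    exact relabel_id (fun i => f.apply_symm_apply i) x
  · intro _ n x hx
    exact ⟨0, by rw [map_zero, eq_zero_of_mem_face_of_isEmpty hx]⟩
  · intro K _ ih _ n x hx
    rcases face_cases hx with rfl | ⟨k, rfl, hx'⟩
    · exact ⟨0, map_zero _⟩
    obtain ⟨y, hy⟩ := ih (forget K x) (map_mem_face _ hx)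
    suffices h : ∃ z : P.obj (Option K) k, D.val z = e none * relabel some (forget K (θ none x)) by
      obtain ⟨z, hz⟩ := h
      refine ⟨P.adjoin (zero_add _) D.e₁ y + z, ?_⟩
      rw [map_add, val_adjoin_e₁, hy, hz]
      exact (eq_relabel_some_add x).symm
    have hθ : θ none x ∈ ⋀[ℤ]^k (Option K →₀ ℤ) := contract_mem _ hx'
    rcases k with _ | k
    · rw [ExteriorAlgebra.exteriorPower, pow_zero, Submodule.mem_one] at hθ
      obtain ⟨r, hr⟩ := hθ
      obtain ⟨u, hu⟩ : ∃ u : P.obj (Option K) 0, D.val u = e none := by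
        rcases isEmpty_or_nonempty K with hK | ⟨⟨a⟩⟩
        · refine ⟨P.map (Equiv.ofUnique Unit (Option K)) P.one, ?_⟩
          rw [val_map, val_one, relabel_e]
          congr 1
        · obtain ⟨w, hw⟩ := ih (e a) (e_mem_face a)
          exact ⟨P.adjoin (zero_add 0) D.e₂ w, by rw [val_adjoin_e₂, hw, aug_e, one_smul]⟩
      refine ⟨r • u, ?_⟩
      rw [map_zsmul, hu, ← hr, AlgHom.commutes, AlgHom.commutes, ← Algebra.commutes,
        ← Algebra.smul_def]
    · obtain ⟨z, hz⟩ := ih (forget K (θ none x)) (mem_face (map_mem _ hθ))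
      refine ⟨-P.adjoin (by push_cast; ring) D.e₁₂ z, ?_⟩
      rw [map_neg, val_adjoin_e₁₂, neg_neg, hz]

end Pasc.Presentation

/-! ### Ideals and quotients -/

namespace DGOperad

variable {P : DGOperad.{v}} {Q : DGOperad.{w}}

theorem d_circOne (P : DGOperad.{v}) {m n p m' n' p' : ℤ} (h : m + n = p) (hm : m' + 1 = m)
    (hn : n' + 1 = n) (hp : p' + 1 = p) (h₁ : m' + n = p') (h₂ : m + n' = p')
    (x : P.obj (Fin 2) m) (y : P.obj (Fin 2) n) :
    P.d hp (P.circOne h x y) =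
      P.circOne h₁ (P.d hm x) y + m.negOnePow • P.circOne h₂ x (P.d hn y) := by
  simp only [circOne, ← P.map_d]
  rw [P.d_comp 0 h hm hn hp h₁ h₂, map_add, Units.smul_def, Units.smul_def, map_zsmul]

theorem circOne_eq_map_adjoin (P : DGOperad.{v}) {m n p : ℤ} (h : m + n = p)
    (x : P.obj (Fin 2) m) (y : P.obj (Fin 2) n) :
    P.circOne h x y =
      P.map ((OperadLabels.adjoin (Fin 2)).symm.trans circOneLabels) (P.adjoin h x y) := by
  rw [circOne, adjoin_apply, ← P.map_trans]
  congr 2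
  ext a : 1
  simp

theorem Hom.app_circOne (φ : Hom P Q) {m n p : ℤ} (h : m + n = p) (x : P.obj (Fin 2) m)
    (y : P.obj (Fin 2) n) :
    φ.app _ p (P.circOne h x y) = Q.circOne h (φ.app _ m x) (φ.app _ n y) := by
  rw [circOne, φ.app_map, φ.app_comp, circOne]

theorem Hom.app_cycle (φ : Hom P Q) {n : ℤ} (x : P.obj (Fin 3) n) :
    φ.app _ n (P.cycle x) = Q.cycle (φ.app _ n x) := φ.app_map _ x

/-- The kernel of a morphism of operads. -/
def Hom.ker (φ : Hom P Q) : P.Ideal where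
  carrier I _ n := (φ.app I n).ker
  map_mem e n x hx := by
    rw [AddMonoidHom.mem_ker] at hx ⊢
    rw [φ.app_map, hx, map_zero]
  comp_mem_left i m n p h x y hx := by
    rw [AddMonoidHom.mem_ker] at hx ⊢
    rw [φ.app_comp, hx, map_zero, AddMonoidHom.zero_apply]
  comp_mem_right i m n p h x y hy := by
    rw [AddMonoidHom.mem_ker] at hy ⊢
    rw [φ.app_comp, hy, map_zero]

/-- The morphism from the quotient by an ideal induced by a morphism which vanishes on it. -/
def Hom.quotientLift (φ : Hom P Q) (A : P.Ideal) (hA : A.IsDifferential)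
    (h : ∀ (I : Type) [Finite I] (n : ℤ) (x : P.obj I n), x ∈ A.carrier I n → φ.app I n x = 0) :
    Hom (P.quotient A hA) Q where
  app I _ n := QuotientAddGroup.lift (A.carrier I n) (φ.app I n) (h I n)
  app_d h' x := by
    induction x using QuotientAddGroup.induction_on with | H x => ?_
    exact φ.app_d h' x
  app_map e n x := by
    induction x using QuotientAddGroup.induction_on with | H x => ?_
    exact φ.app_map e x
  app_one := φ.app_one
  app_comp i m n p h' x y := by
    induction x using QuotientAddGroup.induction_on with | H x => ?_
    induction y using QuotientAddGroup.induction_on with | H y => ?_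
    exact φ.app_comp i h' x y

/-- The elements of an ideal whose differential is in the ideal. -/
def Ideal.differentialPart (A : P.Ideal) : P.Ideal where
  carrier I _ m := A.carrier I m ⊓ (A.carrier I (m - 1)).comap (P.d (sub_add_cancel m 1))
  map_mem e n x hx := ⟨A.map_mem e hx.1, AddSubgroup.mem_comap.2 (by
    rw [← P.map_d]
    exact A.map_mem e hx.2)⟩
  comp_mem_left i m n p h x y hx := ⟨A.comp_mem_left i h y hx.1, AddSubgroup.mem_comap.2 (by
    rw [P.d_comp i h (sub_add_cancel m 1) (sub_add_cancel n 1) _ (by omega) (by omega),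
      Units.smul_def]
    exact add_mem (A.comp_mem_left i _ _ hx.2) (zsmul_mem (A.comp_mem_left i _ _ hx.1) _))⟩
  comp_mem_right i m n p h x y hy := ⟨A.comp_mem_right i h x hy.1, AddSubgroup.mem_comap.2 (by
    rw [P.d_comp i h (sub_add_cancel m 1) (sub_add_cancel n 1) _ (by omega) (by omega),
      Units.smul_def]
    exact add_mem (A.comp_mem_right i _ _ hy.1) (zsmul_mem (A.comp_mem_right i _ _ hy.2) _))⟩

theorem subset_idealSpan {K : Type} [Finite K] {R : ∀ n : ℤ, Set (P.obj K n)} {n : ℤ}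
    {x : P.obj K n} (hx : x ∈ R n) : x ∈ (P.idealSpan K R).carrier K n :=
  fun _ hA => hA n hx

theorem idealSpan_isDifferential {K : Type} [Finite K] {R : ∀ n : ℤ, Set (P.obj K n)}
    (h : ∀ {m n : ℤ} (h : n + 1 = m), ∀ x ∈ R m, P.d h x ∈ (P.idealSpan K R).carrier K n) :
    (P.idealSpan K R).IsDifferential := by
  intro I _ m n hn x hx
  obtain rfl := eq_sub_of_add_eq hn
  exact (hx (P.idealSpan K R).differentialPart
    fun k x hx => ⟨subset_idealSpan hx, h _ x hx⟩).2

end DGOperad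

namespace Pasc

open DGOperad

/-! ### The relations in Pasc -/

theorem e_mul_e {I : Type} (i j : I) : e i * e j = -(e j * e i) :=
  eq_neg_of_add_eq_zero_left (ExteriorAlgebra.ι_add_mul_swap _ _)

theorem toEx_circOne {m n p : ℤ} (h : m + n = p) (x : pasc.obj (Fin 2) m)
    (y : pasc.obj (Fin 2) n) : toEx (pasc.circOne h x y) =
      relabel ((OperadLabels.adjoin (Fin 2)).symm.trans circOneLabels)
        (toEx (pasc.adjoin h x y)) := by
  rw [circOne_eq_map_adjoin, toEx_map]

theorem toEx_circOne_of_eq_e_zero {n p : ℤ} (h : 0 + n = p) {x : pasc.obj (Fin 2) 0}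
    (hx : toEx x = e 0) (y : pasc.obj (Fin 2) n) :
    toEx (pasc.circOne h x y) = relabel Fin.castSucc (toEx y) := by
  rw [toEx_circOne, toEx_adjoin_of_eq_e_zero h hx, relabel_relabel]
  rfl

theorem toEx_circOne_of_eq_e_one {n p : ℤ} (h : 0 + n = p) {x : pasc.obj (Fin 2) 0}
    (hx : toEx x = e 1) (y : pasc.obj (Fin 2) n) :
    toEx (pasc.circOne h x y) = aug (toEx y) • e 2 := by
  rw [toEx_circOne, toEx_adjoin_of_eq_e_one h hx, map_smul, relabel_e]
  rfl

theorem toEx_circOne_of_eq_e_zero_mul_e_one {n p : ℤ} (h : 1 + n = p) {x : pasc.obj (Fin 2) 1}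
    (hx : toEx x = e 0 * e 1) (y : pasc.obj (Fin 2) n) :
    toEx (pasc.circOne h x y) = -(e 2 * relabel Fin.castSucc (toEx y)) := by
  rw [toEx_circOne, toEx_adjoin_of_eq_e_zero_mul_e_one h hx, map_neg, map_mul, relabel_e,
    relabel_relabel]
  rfl

theorem toEx_cycle {n : ℤ} (x : pasc.obj (Fin 3) n) :
    toEx (pasc.cycle x) = relabel (Equiv.subRight (1 : Fin 3)) (toEx x) := rfl

/-- The morphism from the free operad to Pasc which is the identity on generators. -/
noncomputable def freeHom : Hom Free pasc :=
  (freeDGOperad.existsUnique_lift pasc.binary pasc (fun _ => AddMonoidHom.id _)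
    (fun _ _ => rfl) (fun _ _ _ => rfl)).choose

theorem freeHom_gen (n : ℤ) (x : pasc.binary.obj n) :
    freeHom.app (Fin 2) n (freeDGOperad.gen _ n x) = x :=
  (freeDGOperad.existsUnique_lift pasc.binary pasc (fun _ => AddMonoidHom.id _)
    (fun _ _ => rfl) (fun _ _ _ => rfl)).choose_spec.1 n x

theorem toEx_freeHom_e₁ : toEx (freeHom.app (Fin 2) 0 e₁) = e 0 :=
  congrArg toEx (freeHom_gen 0 (gen₀ 0))

theorem toEx_freeHom_e₂ : toEx (freeHom.app (Fin 2) 0 e₂) = e 1 :=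
  congrArg toEx (freeHom_gen 0 (gen₀ 1))

theorem toEx_freeHom_e₁₂ : toEx (freeHom.app (Fin 2) 1 e₁₂) = e 0 * e 1 :=
  congrArg toEx (freeHom_gen 1 gen₁)

theorem freeHom_relation {n : ℤ} {x : Free.obj (Fin 3) n} (hx : Relations n x) :
    freeHom.app (Fin 3) n x = 0 := by
  have c0 : (Equiv.subRight (1 : Fin 3)) 0 = 2 := rfl
  have c1 : (Equiv.subRight (1 : Fin 3)) 1 = 0 := rfl
  have c2 : (Equiv.subRight (1 : Fin 3)) 2 = 1 := rfl
  have s0 : Fin.castSucc (0 : Fin 2) = 0 := rfl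
  have s1 : Fin.castSucc (1 : Fin 2) = 1 := rfl
  have a : aug (e 0 * e 1 : Ex (Fin 2)) = 0 := by
    rw [← toEx_freeHom_e₁₂]
    exact aug_of_mem (toEx_mem _) one_ne_zero
  apply toEx_injective
  rw [map_zero]
  cases hx <;> simp only [map_sub, map_neg, Hom.app_cycle, Hom.app_circOne, toEx_cycle,
    toEx_circOne_of_eq_e_zero _ toEx_freeHom_e₁, toEx_circOne_of_eq_e_one _ toEx_freeHom_e₂,
    toEx_circOne_of_eq_e_zero_mul_e_one _ toEx_freeHom_e₁₂, toEx_freeHom_e₁, toEx_freeHom_e₂,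
    toEx_freeHom_e₁₂, relabel_e, map_mul, aug_e, one_smul, c0, c1, c2, s0, s1, sub_self,
    a, zero_smul]
  · rw [e_mul_e 1 0]; simp
  · simp
  · rw [← mul_assoc (e 1), e_mul_e 1 2, neg_mul, mul_assoc, e_mul_e 1 0]; simp

/-! ### The ideal of relations -/

/-- The operadic ideal generated by the relations. -/
noncomputable abbrev relationIdeal : Free.Ideal :=
  Free.idealSpan (Fin 3) fun n => {r | Relations n r}

theorem d_gen {m n : ℤ} (h : n + 1 = m) (x : pasc.binary.obj m) :
    Free.d h (freeDGOperad.gen _ m x) = freeDGOperad.gen _ n (pasc.binary.d h x) :=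
  (Quot.sound (.gen_d h x)).symm

theorem map_gen (σ : Equiv.Perm (Fin 2)) {n : ℤ} (x : pasc.binary.obj n) :
    Free.map σ (freeDGOperad.gen _ n x) = freeDGOperad.gen _ n (pasc.binary.act σ x) :=
  (Quot.sound (.gen_act σ x)).symm

theorem d_free_e₁ {n : ℤ} (h : n + 1 = 0) : Free.d h e₁ = 0 := by
  have h1 : pasc.binary.d h (gen₀ 0) = 0 :=
    toEx_injective (I := Fin 2) (diff_of_neg (Fin 2) (by omega) _)
  rw [e₁, d_gen, h1, map_zero]

theorem d_free_e₂ {n : ℤ} (h : n + 1 = 0) : Free.d h e₂ = 0 := by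
  have h1 : pasc.binary.d h (gen₀ 1) = 0 :=
    toEx_injective (I := Fin 2) (diff_of_neg (Fin 2) (by omega) _)
  rw [e₂, d_gen, h1, map_zero]

theorem d_free_e₁₂ : Free.d (zero_add 1) e₁₂ = e₂ - e₁ := by
  have h1 : pasc.binary.d (zero_add 1) gen₁ = gen₀ 1 - gen₀ 0 := by
    refine toEx_injective (I := Fin 2) ?_
    change diff (Fin 2) 0 (e 0 * e 1) = e 1 - e 0
    rw [diff_of_nonneg _ le_rfl, boundary_eq_sum, Fin.sum_univ_two, θ_e_mul, θ_e_ne one_ne_zero,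
      e_mul_e, map_neg, θ_e_mul, θ_e_ne zero_ne_one]
    simp [sub_eq_add_neg]
  rw [e₁₂, d_gen, h1, map_sub]
  rfl

theorem map_swap_free_e₁ : Free.map (Equiv.swap (0 : Fin 2) 1) e₁ = e₂ := by
  have h1 : pasc.binary.act (Equiv.swap 0 1) (gen₀ 0) = gen₀ 1 :=
    toEx_injective (I := Fin 2) (relabel_e _ _)
  rw [e₁, map_gen, h1, e₂]

theorem map_swap_free_e₁₂ : Free.map (Equiv.swap (0 : Fin 2) 1) e₁₂ = -e₁₂ := by
  have h1 : pasc.binary.act (Equiv.swap 0 1) gen₁ = -gen₁ := by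
    refine toEx_injective (I := Fin 2) ?_
    change relabel (Equiv.swap (0 : Fin 2) 1) (e 0 * e 1) = -(e 0 * e 1)
    rw [map_mul, relabel_e, relabel_e, e_mul_e 0 1, neg_neg]
    rfl
  rw [e₁₂, map_gen, h1, map_neg]

theorem cycle_mem_relationIdeal {n : ℤ} {x : Free.obj (Fin 3) n}
    (hx : x ∈ relationIdeal.carrier (Fin 3) n) :
    Free.cycle x ∈ relationIdeal.carrier (Fin 3) n :=
  relationIdeal.map_mem _ hx

theorem relation_mem {n : ℤ} {x : Free.obj (Fin 3) n} (hx : Relations n x) :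
    x ∈ relationIdeal.carrier (Fin 3) n := subset_idealSpan hx

theorem d_circOne_zero_zero {n : ℤ} (h : n + 1 = 0) {x y : Free.obj (Fin 2) 0}
    (hx : ∀ {n : ℤ} (h : n + 1 = 0), Free.d h x = 0)
    (hy : ∀ {n : ℤ} (h : n + 1 = 0), Free.d h y = 0) :
    Free.d h (Free.circOne (add_zero 0) x y) = 0 := by
  rw [Free.d_circOne _ h h _ (by omega) (by omega), hx, hy]
  simp [circOne]

theorem d_circOne_zero_one {x : Free.obj (Fin 2) 0}
    (hx : ∀ {n : ℤ} (h : n + 1 = 0), Free.d h x = 0) :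
    Free.d (zero_add 1) (Free.circOne (zero_add 1) x e₁₂) =
      Free.circOne (add_zero 0) x e₂ - Free.circOne (add_zero 0) x e₁ := by
  rw [Free.d_circOne _ (sub_add_cancel 0 1) (zero_add 1) _ (by omega) (by omega), hx,
    d_free_e₁₂]
  simp [circOne]

theorem d_circOne_one_zero {x : Free.obj (Fin 2) 0}
    (hx : ∀ {n : ℤ} (h : n + 1 = 0), Free.d h x = 0) :
    Free.d (zero_add 1) (Free.circOne (add_zero 1) e₁₂ x) =
      Free.circOne (add_zero 0) e₂ x - Free.circOne (add_zero 0) e₁ x := by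
  rw [Free.d_circOne _ (zero_add 1) (sub_add_cancel 0 1) _ (by omega) (by omega), hx,
    d_free_e₁₂]
  simp [circOne]

theorem d_circOne_one_one :
    Free.d one_add_one_eq_two (Free.circOne one_add_one_eq_two e₁₂ e₁₂) =
      Free.circOne (zero_add 1) e₂ e₁₂ - Free.circOne (zero_add 1) e₁ e₁₂ -
        (Free.circOne (add_zero 1) e₁₂ e₂ - Free.circOne (add_zero 1) e₁₂ e₁) := by
  rw [Free.d_circOne _ (zero_add 1) (zero_add 1) _ (by omega) (by omega), d_free_e₁₂]
  simp only [circOne, map_sub, AddMonoidHom.sub_apply, Int.negOnePow_one, Units.neg_smul, one_smul]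
  abel

theorem d_cycle {m n : ℤ} (h : n + 1 = m) (x : Free.obj (Fin 3) m) :
    Free.d h (Free.cycle x) = Free.cycle (Free.d h x) := (Free.map_d _ h x).symm

/-- The differential of each relation is a combination of relations and their images under `τ`. -/
theorem d_relation_mem {m n : ℤ} (h : n + 1 = m) {x : Free.obj (Fin 3) m} (hx : Relations m x) :
    Free.d h x ∈ relationIdeal.carrier (Fin 3) n := by
  have r₁ := relation_mem .rel₁
  have r₂ := relation_mem .rel₂
  have r₃ := relation_mem .rel₃
  have r₄ := relation_mem .rel₄
  have r₅ := relation_mem .rel₅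
  have r₆ := relation_mem .rel₆
  have c := fun {n : ℤ} {x : Free.obj (Fin 3) n} => cycle_mem_relationIdeal (x := x)
  cases hx
  · rw [map_sub, d_cycle, d_cycle, d_circOne_zero_zero h d_free_e₁ d_free_e₁,
      d_circOne_zero_zero h d_free_e₂ d_free_e₁]
    simp
  · rw [map_sub, d_circOne_zero_zero h d_free_e₂ d_free_e₁,
      d_circOne_zero_zero h d_free_e₂ d_free_e₂]
    simp
  · rw [map_sub, d_cycle, d_circOne_zero_zero h d_free_e₁ d_free_e₂,
      d_circOne_zero_zero h d_free_e₂ d_free_e₂]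
    simp
  · obtain rfl := add_right_cancel (h.trans (zero_add (1 : ℤ)).symm)
    rw [d_circOne_zero_one d_free_e₂, ← neg_sub]
    exact neg_mem r₂
  · obtain rfl := add_right_cancel (h.trans (zero_add (1 : ℤ)).symm)
    rw [map_sub, d_cycle, d_circOne_one_zero d_free_e₂, d_circOne_zero_one d_free_e₁]
    convert add_mem (sub_mem r₁ (add_mem r₃ (c r₃))) (c (c r₂)) using 1
    simp only [map_sub]
    abel
  · obtain rfl := add_right_cancel (h.trans (zero_add (1 : ℤ)).symm)
    rw [map_sub, map_neg, d_cycle, d_cycle, d_circOne_one_zero d_free_e₁,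
      d_circOne_zero_one d_free_e₁]
    convert sub_mem (add_mem (add_mem r₁ (c (c r₁))) (c r₂)) r₃ using 1
    simp only [map_sub, cycle_cycle_cycle]
    abel
  · obtain rfl := add_right_cancel (h.trans (one_add_one_eq_two (R := ℤ)).symm)
    rw [map_sub, d_cycle, d_circOne_one_one]
    convert add_mem (add_mem (sub_mem r₄ (c r₄)) (sub_mem r₅ (c (c r₅))))
      (sub_mem (c (c r₆)) (c r₆)) using 1
    simp only [map_sub, map_neg, cycle_cycle_cycle]
    abel

theorem relationIdeal_isDifferential : relationIdeal.IsDifferential :=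
  idealSpan_isDifferential fun h _ hx => d_relation_mem h hx

/-- The quotient of the free operad by the relations. -/
noncomputable abbrev FreeQuotient : DGOperad.{1} :=
  Free.quotient relationIdeal relationIdeal_isDifferential

/-- The projection to the quotient of the free operad. -/
noncomputable abbrev proj {I : Type} [Finite I] {n : ℤ} : Free.obj I n →+ FreeQuotient.obj I n :=
  Free.toQuotient relationIdeal relationIdeal_isDifferential I n

theorem proj_eq_of_sub_mem {I : Type} [Finite I] {n : ℤ} {x y : Free.obj I n}
    (h : x - y ∈ relationIdeal.carrier I n) : proj x = proj y := by
  rw [← sub_eq_zero, ← map_sub]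
  exact (QuotientAddGroup.eq_zero_iff _).2 h

theorem proj_gen_mem {n : ℤ} (x : pasc.binary.obj n) :
    proj (freeDGOperad.gen _ n x) ∈ generatorSpan (proj e₁) (proj e₂) (proj e₁₂) n := by
  rcases face_cases (toEx_mem (I := Fin 2) x) with h | ⟨k, rfl, h⟩
  · obtain rfl : x = 0 := toEx_injective (I := Fin 2) h
    rw [map_zero, map_zero]
    exact zero_mem _
  · obtain ⟨-, h1, h2, h3⟩ := exists_of_mem_exteriorPower_two h
    rcases k with _ | _ | k
    · obtain ⟨r, s, hx⟩ := h1 rfl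
      obtain rfl : x = r • gen₀ 0 + s • gen₀ 1 := toEx_injective (I := Fin 2) hx
      rw [map_add, map_zsmul, map_zsmul, map_add, map_zsmul, map_zsmul]
      exact add_mem (zsmul_mem (AddSubgroup.subset_closure .e₁) r)
        (zsmul_mem (AddSubgroup.subset_closure .e₂) s)
    · obtain ⟨r, hx⟩ := h2 rfl
      obtain rfl : x = r • gen₁ := toEx_injective (I := Fin 2) hx
      rw [map_zsmul, map_zsmul]
      exact zsmul_mem (AddSubgroup.subset_closure .e₁₂) r
    · obtain rfl : x = 0 := toEx_injective (I := Fin 2) (h3 (by omega))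
      rw [map_zero, map_zero]
      exact zero_mem _

theorem freeQuotient_isGeneratedBy :
    FreeQuotient.IsGeneratedBy (generatorSpan (proj e₁) (proj e₂) (proj e₁₂)) := by
  intro W hgen hone hd hmap hcomp I _ n x
  induction x using QuotientAddGroup.induction_on with | H x => ?_
  obtain ⟨x, rfl⟩ := Quot.exists_rep x
  have key : ∀ {I : Type} {n : ℤ} (x : FreeDGOperad.Term pasc.binary I n), ∀ [Finite I],
      proj (I := I) (n := n) (FreeDGOperad.mk x) ∈ W I n := by
    intro I n x
    induction x with
    | gen x => intro _; exact hgen _ (proj_gen_mem x)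
    | zero => intro _; exact zero_mem _
    | add x y hx hy => intro _; exact add_mem hx hy
    | neg x hx => intro _; exact neg_mem hx
    | d h x hx => intro _; exact hd h _ hx
    | map f x hx => intro _; exact hmap f _ hx
    | one => intro _; exact hone
    | comp i h x y hx hy => intro _; exact hcomp i h _ hx _ hy
  exact key x

/-- The quotient of the free operad satisfies the relations. -/
noncomputable def freeQuotientPresentation : Presentation FreeQuotient where
  e₁ := proj e₁
  e₂ := proj e₂
  e₁₂ := proj e₁₂
  map_swap_e₁ := congrArg proj map_swap_free_e₁
  map_swap_e₁₂ := congrArg proj map_swap_free_e₁₂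
  d_e₁ h := congrArg proj (d_free_e₁ h)
  d_e₁₂ := congrArg proj (d_free_e₁₂)
  rel₁ := proj_eq_of_sub_mem (relation_mem .rel₁)
  rel₂ := proj_eq_of_sub_mem (relation_mem .rel₂)
  rel₃ := proj_eq_of_sub_mem (relation_mem .rel₃)
  rel₄ := (QuotientAddGroup.eq_zero_iff _).2 (relation_mem .rel₄)
  rel₅ := proj_eq_of_sub_mem (relation_mem .rel₅)
  rel₆ := proj_eq_of_sub_mem (relation_mem .rel₆)
  rel₇ := proj_eq_of_sub_mem (relation_mem .rel₇)
  generates := freeQuotient_isGeneratedBy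
  hom := freeHom.quotientLift relationIdeal relationIdeal_isDifferential
    fun _ _ _ _ hx => hx freeHom.ker fun _ _ hr => freeHom_relation hr
  hom_e₁ := toEx_freeHom_e₁
  hom_e₂ := toEx_freeHom_e₂
  hom_e₁₂ := toEx_freeHom_e₁₂

namespace Presentation

variable {P : DGOperad.{v}} (D : Presentation P)

theorem hom_bijective (I : Type) [Finite I] (n : ℤ) : Function.Bijective (D.hom.app I n) := by
  refine ⟨(injective_iff_map_eq_zero _).2 fun x hx => ?_, fun y => ?_⟩
  · exact D.eq_zero_of_val_eq_zero x ((congrArg toEx hx).trans (map_zero _))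
  · obtain ⟨x, hx⟩ := D.exists_val_eq _ (toEx_mem y)
    exact ⟨x, toEx_injective hx⟩

/-- The isomorphism with Pasc. -/
noncomputable def iso : Iso P pasc where
  equiv I _ n := AddEquiv.ofBijective (D.hom.app I n) (D.hom_bijective I n)
  equiv_d := D.hom.app_d
  equiv_map := D.hom.app_map
  equiv_one := D.hom.app_one
  equiv_comp := D.hom.app_comp

end Presentation

theorem isPresentedBy :
    pasc.IsPresentedBy pasc.binary (fun n => AddMonoidHom.id (pasc.obj (Fin 2) n))
      (fun n => {r | Relations n r}) :=
  ⟨relationIdeal_isDifferential, freeQuotientPresentation.iso, freeHom_gen⟩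

end Pasc

theorem mainTheorem5 :
    pasc.IsPresentedBy pasc.binary (fun n => AddMonoidHom.id (pasc.obj (Fin 2) n))
      (fun n => {r | Pasc.Relations n r}) ∧
    pasc.IsBinaryQuadratic :=
  ⟨Pasc.isPresentedBy, _, _, _, Pasc.isPresentedBy⟩
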